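/- **Setting.** Let $\mathcal I$ be a finite set of leaders. Leader $i$ has a nonempty compact convex set $\mathcal X_i\subset\mathbb R^{n_i}$; put $\mathcal X=\prod_i\mathcal X_i\subset\mathbb R^n$ (Euclidean norm), $\mathcal X_{i,\delta_0}=\mathcal X_i+\delta_0\mathbb B_{n_i}$ for some $\delta_0>0$, $\mathcal X_{\delta_0}=\prod_i\mathcal X_{i,\delta_0}$. Let $D_i\supseteq\mathcal X_{i,\delta_0}$ be sets (for instance $D_i=\mathcal X_{i,\delta_0}$ or $D_i=\mathbb R^{n_i}$) and $D=\prod_iD_i$. The constants $C,R,L_f,L_{1,i},L_{2,i},M\ge 0$ and the following data are given. * (Lower level) $\mathcal Y_i\subset\mathbb R^{m_i}$ is nonempty, closed and convex, and for every $x_i\in D_i$ the map $\phi_i(x_i,\cdot)$ is strongly monotone and Lipschitz on $\mathcal Y_i$. Let $y_i(x_i)$ be the unique solution of the variational inequality $\mathrm{VI}(\phi_i(x_i,\cdot),\mathcal Y_i)$, and put $h_i(x_i)=g_i(x_i,y_i(x_i))$, $h(x)=\sum_ih_i(x_i)$, with $g_i$ measurable. * (Leaders) Every $\mathcal X_i$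 has diameter at most $C$ and $\|x\|\le R$ on $\mathcal X$. The function $h_i$ is $L_{1,i}$-Lipschitz on $D_i$ and convex on $\mathcal X_{i,\delta_0}$; $g_i(x_i,\cdot)$ is $L_{2,i}$-Lipschitz on $\mathcal Y_i$ for every $x_i\in D_i$. For $x\in\mathcal X$ and almost every $\xi$, $F_i((\cdot,x_{-i}),\xi)$ is convex and $C^1$ on an open set containing $\mathcal X_i$. At every $x\in\mathcal X_{\delta_0}$ the function $f_i(x)=\mathbb E_\xi[F_i(x,\xi)]$ is well defined for $x_i$ varying in a neighbourhood and differentiable in $x_i$, and $V(x)=(\nabla_{x_i}f_i(x))_i$ is monotone and $L_f$-Lipschitz on $\mathcal X_{\delta_0}$. * (Oracle) $\hat V(x,\xi)$ is jointly measurable, and for $x\in\mathcal X$ it is square integrable with $\mathbb E_\xi[\hat V(x,\xi)]=V(x)$ and $\mathbb E_\xi\|\hat V(x,\xi)-V(x)\|^2\le M^2$. For almost every $\xi$, $\|\hat V(x',\xi)-\hat V(x,\xi)\|\le\mathcal L(\xi)\|x'-x\|$ for all $x,x'\in D$, where $\mathcal L\ge 0$ and $\mathbb E_\xi[\mathcal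 L(\xi)^2]\le L_f^2$. Put $\sigma^2=2M^2+2\sum_iL_{1,i}^2n_i^2$ and let $$\Gamma(x)=\sup_{z\in\mathcal X}\big(\langle V(z),x-z\rangle+h(x)-h(z)\big)$$ be the gap function. **The scheme I-VRHGS.** Let $x^0\in\mathcal X$. In round $t=0,\dots,T-1$, with parameters $\gamma_t,\eta_t,\delta_t,\varepsilon_t>0$ and $b_t,K\in\mathbb N$, each player draws i.i.d. samples $\xi^{(s)}_{i,t}$ and i.i.d. directions $W^{(s)}_{i,t}$, uniform on the unit sphere of $\mathbb R^{n_i}$ ($1\le s\le b_t$), independent of the past, and forms $$\bar V^t_i=\frac1{b_t}\sum_{s}\hat V_i(x^t,\xi^{(s)}_{i,t}),\qquad \bar H^t_i=\frac1{b_t}\sum_sH_{i,x^t_i}(W^{(s)}_{i,t}),\qquad H_{i,x_i}(w)=n_iw\,\frac{h_i^{\varepsilon_t}(x_i+\delta_tw)-h^{\varepsilon_t}_i(x_i)}{\delta_t}.$$ Here $h_i^{\varepsilon}(x_i)=g_i(x_i,y_i^{\varepsilon})$, where the possibly random $y_i^{\varepsilon}\in\mathcal Y_i$ returned by the lower-level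 solver for the possibly random query $x_i$ satisfies $\mathbb E[\|y_i^{\varepsilon}-y_i(x_i)\|\mid x_i]\le\varepsilon$ almost surely. Then, with $z_0=x^t$, for $k=0,\dots,K-1$, fresh $\xi_{i,k}$ and fresh uniform directions $W_{i,k}$ (independent of the past), $$z_{k+1/2}=\Pi_{\mathcal X}\big[z_k-\gamma_t(\bar V^t+\eta_tx^t+\bar H^t)\big],$$ $$z_{k+1,i}=z_{k+1/2,i}-\gamma_t\Big(\hat V_i(z_{k+1/2},\xi_{i,k})+\eta_tz_{k+1/2,i}+H_{i,z_{k+1/2,i}}(W_{i,k})-\hat V_i(x^t,\xi_{i,k})-\eta_tx^t_i-H_{i,x^t_i}(W_{i,k})\Big),$$ and $x^{t+1}=z_K$. It is assumed that almost surely $x^t_i+\delta_t\mathbb B_{n_i}\subseteq D_i$ for all $i$ and $t<T$, i.e. that the oracles are queried where the data are regular (no restriction if $D_i=\mathbb R^{n_i}$). Let $$\bar z^T=\Big(\sum_{t<T}\gamma_t\Big)^{-1}\sum_{t<T}\gamma_t\,\frac1K\sum_{k<K}z^{(t)}_{k+1/2}.$$ **Theorem.** There is a constant $c\ge 0$, depending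 only on $\mathcal I$, $(n_i)$, $C$, $R$, $L_f$, $(L_{1,i})$ and $(L_{2,i})$, such that for every game as above, every $T\ge 1$ with $1/T\le\delta_0$, the choice $\gamma_t=\eta_t=\delta_t=1/T$, $K=T$, $b_t\ge T^2$, $\varepsilon_t=1/T^2$, and every run of the scheme, $\Gamma(\bar z^T)$ is integrable and $$\mathbb E[\Gamma(\bar z^T)]\le\frac{c\,(1+C\sigma)}{T}.$$ In particular, for a fixed game with $C\sigma>0$, $\mathbb E[\Gamma(\bar z^T)]=\mathcal O(C\sigma/T)$. -/

import Mathlib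

open MeasureTheory ProbabilityTheory
open scoped NNReal ENNReal Pointwise

noncomputable section

namespace HierGame

/-- The Euclidean space `ℝᵈ`. -/
abbrev Vec (d : ℕ) : Type := EuclideanSpace ℝ (Fin d)

/-- Strategy profiles: `∏ i, ℝ^{n i}` with the Euclidean norm. -/
abbrev Profile {ι : Type*} (n : ι → ℕ) : Type _ := PiLp 2 (fun i => Vec (n i))

/-- `y` solves the variational inequality `VI(φ, K)`. -/
def IsVISolution {d : ℕ} (φ : Vec d → Vec d) (K : Set (Vec d)) (y : Vec d) : Prop :=
  y ∈ K ∧ ∀ v ∈ K, 0 ≤ inner ℝ (φ y) (v - y)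

/-- `p` is a nearest point of `K` to `w`. -/
def IsNearest {E : Type*} [NormedAddCommGroup E] (K : Set E) (w p : E) : Prop :=
  p ∈ K ∧ ∀ q ∈ K, ‖w - p‖ ≤ ‖w - q‖

/-- The orthogonal projector onto `K` (only used for nonempty, closed and convex `K`). -/
def proj {E : Type*} [NormedAddCommGroup E] (K : Set E) (w : E) : E :=
  Classical.epsilon (IsNearest K w)

/-- The uniform distribution on the unit sphere of `ℝᵈ`. -/
def sphereUniform (d : ℕ) : Measure (Vec d) :=
  (((volume : Measure (Vec d)).toSphere Set.univ)⁻¹ •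
    (volume : Measure (Vec d)).toSphere).map Subtype.val

/-- The data of a hierarchical game with players `ι`. Leader `i` chooses `x i ∈ X i ⊆ ℝ^{n i}` and
has the loss `𝔼 F i x ξ + g i (x i) (y i)`, where `y i` solves the lower level variational
inequality `VI(φ i (x i), Y i)` in `ℝ^{m i}`. The random element `ξ` has distribution `law`, and
`Vhat` is the stochastic first order oracle. -/
structure Game {ι : Type*} (n : ι → ℕ) (Ξ : Type*) [MeasurableSpace Ξ] where
  m : ι → ℕ
  X : ∀ i, Set (Vec (n i))
  Y : ∀ i, Set (Vec (m i))
  φ : ∀ i, Vec (n i) → Vec (m i) → Vec (m i)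
  g : ∀ i, Vec (n i) → Vec (m i) → ℝ
  F : ι → Profile n → Ξ → ℝ
  Vhat : Profile n → Ξ → Profile n
  law : Measure Ξ

namespace Game

variable {ι : Type*} {n : ι → ℕ} {Ξ : Type*} [MeasurableSpace Ξ]

/-- The set `∏ i, A i` of profiles. -/
def prodSet (A : ∀ i, Set (Vec (n i))) : Set (Profile n) := {x | ∀ i, x i ∈ A i}

/-- The set of strategy profiles `∏ i, X i`. -/
def profiles (G : Game n Ξ) : Set (Profile n) := prodSet G.X

/-- The enlargement `X i + δ₀ 𝔹`. -/
def enlarged (G : Game n Ξ) (δ₀ : ℝ) (i : ι) : Set (Vec (n i)) :=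
  G.X i + Metric.closedBall 0 δ₀

/-- The lower level solution map. -/
def lowerSol (G : Game n Ξ) (i : ι) (x : Vec (n i)) : Vec (G.m i) :=
  Classical.epsilon (IsVISolution (G.φ i x) (G.Y i))

/-- The implicit function `h_i(x_i) = g_i(x_i, y_i(x_i))`. -/
def implicit (G : Game n Ξ) (i : ι) (x : Vec (n i)) : ℝ := G.g i x (G.lowerSol i x)

/-- `h(x) = ∑ i, h_i(x_i)`. -/
def implicitSum [Fintype ι] (G : Game n Ξ) (x : Profile n) : ℝ := ∑ i, G.implicit i (x i)

/-- `f_i(x) = 𝔼 F_i(x, ξ)`. -/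
def f (G : Game n Ξ) (i : ι) (x : Profile n) : ℝ := ∫ ξ, G.F i x ξ ∂G.law

/-- The profile `(u, x_{-i})`. -/
def deviate [DecidableEq ι] (x : Profile n) (i : ι) (u : Vec (n i)) : Profile n :=
  WithLp.toLp 2 (Function.update (fun j => x j) i u)

/-- The pseudo-gradient `V(x) = (∇_{x_i} f_i(x))_i`. -/
def V [DecidableEq ι] (G : Game n Ξ) (x : Profile n) : Profile n :=
  WithLp.toLp 2 (fun i => gradient (fun u => G.f i (deviate x i u)) (x i))

/-- The gap function of the mixed variational inequality `MVI(V, h)` over the strategy profiles. -/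
def gap [Fintype ι] [DecidableEq ι] (G : Game n Ξ) (x : Profile n) : ℝ :=
  ⨆ z : G.profiles, (inner ℝ (G.V z) (x - z) + G.implicitSum x - G.implicitSum z)

/-- Unique solvability of the lower level: for `x ∈ D i` the map `φ i x` is strongly monotone and
Lipschitz continuous on the closed convex set `Y i`. -/
structure LowerLevel (G : Game n Ξ) (D : ∀ i, Set (Vec (n i))) : Prop where
  nonempty : ∀ i, (G.Y i).Nonempty
  closed : ∀ i, IsClosed (G.Y i)
  convex : ∀ i, Convex ℝ (G.Y i)
  stronglyMonotone : ∀ i, ∀ x ∈ D i, ∃ μ : ℝ, 0 < μ ∧ ∀ y ∈ G.Y i, ∀ y' ∈ G.Y i,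
    μ * ‖y - y'‖ ^ 2 ≤ inner ℝ (G.φ i x y - G.φ i x y') (y - y')
  lipschitz : ∀ i, ∀ x ∈ D i, ∃ K : ℝ≥0, LipschitzOnWith K (G.φ i x) (G.Y i)

/-- Standing assumptions on the leaders' problems. `C` bounds the diameters of the sets `X i`, `R`
bounds the norm of the profiles, `Lf`, `L1 i`, `L2 i` are Lipschitz constants. -/
structure Standing [Fintype ι] [DecidableEq ι] (G : Game n Ξ) (δ₀ : ℝ)
    (D : ∀ i, Set (Vec (n i))) (C R Lf : ℝ≥0) (L1 L2 : ι → ℝ≥0) : Prop where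
  nonempty : ∀ i, (G.X i).Nonempty
  compact : ∀ i, IsCompact (G.X i)
  convex : ∀ i, Convex ℝ (G.X i)
  diam : ∀ i, ∀ x ∈ G.X i, ∀ x' ∈ G.X i, ‖x - x'‖ ≤ C
  norm_le : ∀ x ∈ G.profiles, ‖x‖ ≤ R
  implicit_lipschitz : ∀ i, LipschitzOnWith (L1 i) (G.implicit i) (D i)
  F_convex : ∀ i, ∃ U : Set (Vec (n i)), IsOpen U ∧ G.X i ⊆ U ∧
    ∀ x ∈ G.profiles, ∀ᵐ ξ ∂G.law,
      ConvexOn ℝ U (fun u => G.F i (deviate x i u) ξ) ∧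
      ContDiffOn ℝ 1 (fun u => G.F i (deviate x i u) ξ) U
  F_integrable : ∀ x ∈ prodSet (G.enlarged δ₀), ∀ i, ∀ᶠ u in nhds (x i),
    Integrable (G.F i (deviate x i u)) G.law
  f_differentiable : ∀ x ∈ prodSet (G.enlarged δ₀), ∀ i,
    DifferentiableAt ℝ (fun u => G.f i (deviate x i u)) (x i)
  g_measurable : ∀ i, Measurable (fun p : Vec (n i) × Vec (G.m i) => G.g i p.1 p.2)
  g_lipschitz : ∀ i, ∀ x ∈ D i, LipschitzOnWith (L2 i) (G.g i x) (G.Y i)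
  V_lipschitz : LipschitzOnWith Lf G.V (prodSet (G.enlarged δ₀))
  V_monotone : ∀ x ∈ prodSet (G.enlarged δ₀), ∀ x' ∈ prodSet (G.enlarged δ₀),
    0 ≤ inner ℝ (G.V x - G.V x') (x - x')

/-- The implicit functions are convex on the enlarged strategy sets. -/
def ImplicitConvex (G : Game n Ξ) (δ₀ : ℝ) : Prop :=
  ∀ i, ConvexOn ℝ (G.enlarged δ₀ i) (G.implicit i)

/-- The stochastic oracle is unbiased with standard deviation at most `M` on the strategy profiles,
and Lipschitz on `∏ i, D i` with a random Lipschitz constant whose second moment is at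
most `Lf ^ 2`. -/
structure Oracle [Fintype ι] [DecidableEq ι] (G : Game n Ξ)
    (D : ∀ i, Set (Vec (n i))) (Lf M : ℝ≥0) : Prop where
  measurable : Measurable (fun p : Profile n × Ξ => G.Vhat p.1 p.2)
  memLp : ∀ x ∈ G.profiles, MemLp (G.Vhat x) 2 G.law
  unbiased : ∀ x ∈ G.profiles, ∫ ξ, G.Vhat x ξ ∂G.law = G.V x
  variance : ∀ x ∈ G.profiles, ∫ ξ, ‖G.Vhat x ξ - G.V x‖ ^ 2 ∂G.law ≤ (M : ℝ) ^ 2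
  lipschitz : ∃ L : Ξ → ℝ, (∀ ξ, 0 ≤ L ξ) ∧ MemLp L 2 G.law ∧
    ∫ ξ, L ξ ^ 2 ∂G.law ≤ (Lf : ℝ) ^ 2 ∧
    ∀ᵐ ξ ∂G.law, ∀ x ∈ prodSet D, ∀ x' ∈ prodSet D,
      ‖G.Vhat x' ξ - G.Vhat x ξ‖ ≤ L ξ * ‖x' - x‖

end Game

/-- Parameters of the inexact double loop scheme: `T` outer rounds, `K` inner steps per round, and in
round `t` the batch size `b t`, step size `γ t`, Tikhonov parameter `η t`, smoothing radius `δ t` and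
lower level accuracy `ε t`. -/
structure Schedule where
  T : ℕ
  K : ℕ
  b : ℕ → ℕ
  γ : ℕ → ℝ
  η : ℕ → ℝ
  δ : ℕ → ℝ
  ε : ℕ → ℝ

/-- Everything the players receive from outside during one run of the scheme. `ξb t s i`, `Wb t s i`
are the `s`-th samples of player `i` in the mini-batch of round `t`, and `ξ t k i`, `W t k i` are the
samples used in the inner step `k` of round `t`. The remaining fields are the answers of the inexact
lower level solver of player `i`, in the notation of round `t`:
`ybBase`, `ybPert` at `x^t_i` and `x^t_i + δ_t Wb` (for the batch), and in inner step `k`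
`yzBase`, `yzPert` at `z_{k+1/2,i}` and `z_{k+1/2,i} + δ_t W`,
`yxBase`, `yxPert` at `x^t_i` and `x^t_i + δ_t W`. -/
structure Feedback {ι : Type*} (n : ι → ℕ) (m : ι → ℕ) (Ξ Ω : Type*) where
  ξb : ℕ → ℕ → ι → Ω → Ξ
  Wb : ℕ → ℕ → ∀ i, Ω → Vec (n i)
  ξ : ℕ → ℕ → ι → Ω → Ξ
  W : ℕ → ℕ → ∀ i, Ω → Vec (n i)
  ybBase : ℕ → ℕ → ∀ i, Ω → Vec (m i)
  ybPert : ℕ → ℕ → ∀ i, Ω → Vec (m i)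
  yzBase : ℕ → ℕ → ∀ i, Ω → Vec (m i)
  yzPert : ℕ → ℕ → ∀ i, Ω → Vec (m i)
  yxBase : ℕ → ℕ → ∀ i, Ω → Vec (m i)
  yxPert : ℕ → ℕ → ∀ i, Ω → Vec (m i)

section Algorithm

variable {ι : Type*} [Fintype ι] {n : ι → ℕ} {Ξ Ω : Type*} [MeasurableSpace Ξ]

/-- The rescaled finite difference `n_i w (h^ε(x + δ w) - h^ε(x)) / δ`, where the values of
`h^ε = g_i(·, y^ε(·))` are formed with the solver answers `y` at `x` and `y'` at `x + δ w`. -/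
def Game.finiteDiff (G : Game n Ξ) (i : ι) (δ : ℝ) (x w : Vec (n i)) (y y' : Vec (G.m i)) :
    Vec (n i) :=
  ((n i : ℝ) * ((G.g i (x + δ • w) y' - G.g i x y) / δ)) • w

variable (G : Game n Ξ) (S : Schedule) (B : Feedback n G.m Ξ Ω)

/-- The mini-batch estimator of `V` in round `t` at the point `x`. -/
def batchV (t : ℕ) (x : Profile n) (ω : Ω) : Profile n :=
  WithLp.toLp 2 (fun i =>
    (S.b t : ℝ)⁻¹ • ∑ s ∈ Finset.range (S.b t), (G.Vhat x (B.ξb t s i ω)) i)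

/-- The mini-batch finite difference estimator in round `t` at the point `x`. -/
def batchH (t : ℕ) (x : Profile n) (ω : Ω) : Profile n :=
  WithLp.toLp 2 (fun i =>
    (S.b t : ℝ)⁻¹ • ∑ s ∈ Finset.range (S.b t),
      G.finiteDiff i (S.δ t) (x i) (B.Wb t s i ω) (B.ybBase t s i ω) (B.ybPert t s i ω))

/-- `z_{k+1/2} = Π_X [z_k - γ (V̄ + η x + H̄)]` in round `t`, which was started at `x`. -/
def halfStep (t : ℕ) (x : Profile n) (ω : Ω) (z : Profile n) : Profile n :=
  proj G.profiles (z - S.γ t • (batchV G S B t x ω + S.η t • x + batchH G S B t x ω))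

/-- `z_{k+1}` from `p = z_{k+1/2}`, in inner step `k` of round `t`, which was started at `x`. -/
def correctionStep (t k : ℕ) (x : Profile n) (ω : Ω) (p : Profile n) : Profile n :=
  WithLp.toLp 2 (fun i =>
    p i - S.γ t •
      (((G.Vhat p (B.ξ t k i ω)) i + S.η t • p i)
        + G.finiteDiff i (S.δ t) (p i) (B.W t k i ω) (B.yzBase t k i ω) (B.yzPert t k i ω)
        - ((G.Vhat x (B.ξ t k i ω)) i + S.η t • x i)
        - G.finiteDiff i (S.δ t) (x i) (B.W t k i ω) (B.yxBase t k i ω) (B.yxPert t k i ω)))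

/-- The inner iterates `z_k` of round `t`, started at `x`. -/
def innerIter (t : ℕ) (x : Profile n) (ω : Ω) : ℕ → Profile n
  | 0 => x
  | k + 1 => correctionStep G S B t k x ω (halfStep G S B t x ω (innerIter t x ω k))

/-- The outer iterates `x^t`, with `x^{t+1} = z_K`. -/
def outer (x₀ : Profile n) (ω : Ω) : ℕ → Profile n
  | 0 => x₀
  | t + 1 => innerIter G S B t (outer x₀ ω t) ω S.K

/-- The point `z^{(t)}_{k+1/2}` of a run started at `x₀`. -/
def halfIterate (x₀ : Profile n) (t k : ℕ) (ω : Ω) : Profile n :=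
  halfStep G S B t (outer G S B x₀ ω t) ω (innerIter G S B t (outer G S B x₀ ω t) ω k)

/-- The averaged iterate `(∑ t, γ_t)⁻¹ ∑ t, γ_t ((1 / K) ∑ k, z^{(t)}_{k+1/2})`. -/
def averaged (x₀ : Profile n) (ω : Ω) : Profile n :=
  (∑ t ∈ Finset.range S.T, S.γ t)⁻¹ • ∑ t ∈ Finset.range S.T,
    S.γ t • ((S.K : ℝ)⁻¹ • ∑ k ∈ Finset.range S.K, halfIterate G S B x₀ t k ω)

variable [MeasurableSpace Ω]

/-- The answer `y` to the random query `x` is an `ε`-solution of the lower level problem of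
player `i`: it lies in `Y i` and `𝔼[‖y - y_i(x)‖ | x] ≤ ε` almost surely. -/
def IsEpsSolution (P : Measure Ω) (i : ι) (ε : ℝ) (x : Ω → Vec (n i)) (y : Ω → Vec (G.m i)) :
    Prop :=
  (∀ᵐ ω ∂P, y ω ∈ G.Y i) ∧
  Integrable (fun ω => ‖y ω - G.lowerSol i (x ω)‖) P ∧
  ∀ᵐ ω ∂P, (P[fun ω' => ‖y ω' - G.lowerSol i (x ω')‖ | MeasurableSpace.comap x inferInstance]) ω ≤ ε

/-- A run of the inexact scheme on the probability space `(Ω, P)`, started at `x₀`. The σ-algebra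
`ℱ t` is the information at the start of round `t`, and `𝒜 t k` the information before the samples
of inner step `k` of round `t` are drawn. Samples are fresh: they are independent of the past. -/
structure IsRun (D : ∀ i, Set (Vec (n i))) (P : Measure Ω) (x₀ : Profile n)
    (ℱ : ℕ → MeasurableSpace Ω) (𝒜 : ℕ → ℕ → MeasurableSpace Ω) : Prop where
  start : x₀ ∈ G.profiles
  -- the filtration
  ℱ_le : ∀ t, ℱ t ≤ ‹MeasurableSpace Ω›
  𝒜_le : ∀ t k, 𝒜 t k ≤ ‹MeasurableSpace Ω›
  ℱ_le_𝒜 : ∀ t, ℱ t ≤ 𝒜 t 0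
  𝒜_mono : ∀ t, Monotone (𝒜 t)
  𝒜_le_ℱ : ∀ t, 𝒜 t S.K ≤ ℱ (t + 1)
  -- samples and answers are observed when they are used
  ξb_adapted : ∀ t < S.T, ∀ s < S.b t, ∀ i, Measurable[𝒜 t 0] (B.ξb t s i)
  Wb_adapted : ∀ t < S.T, ∀ s < S.b t, ∀ i, Measurable[𝒜 t 0] (B.Wb t s i)
  ybBase_adapted : ∀ t < S.T, ∀ s < S.b t, ∀ i, Measurable[𝒜 t 0] (B.ybBase t s i)
  ybPert_adapted : ∀ t < S.T, ∀ s < S.b t, ∀ i, Measurable[𝒜 t 0] (B.ybPert t s i)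
  ξ_adapted : ∀ t < S.T, ∀ k < S.K, ∀ i, Measurable[𝒜 t (k + 1)] (B.ξ t k i)
  W_adapted : ∀ t < S.T, ∀ k < S.K, ∀ i, Measurable[𝒜 t (k + 1)] (B.W t k i)
  yzBase_adapted : ∀ t < S.T, ∀ k < S.K, ∀ i, Measurable[𝒜 t (k + 1)] (B.yzBase t k i)
  yzPert_adapted : ∀ t < S.T, ∀ k < S.K, ∀ i, Measurable[𝒜 t (k + 1)] (B.yzPert t k i)
  yxBase_adapted : ∀ t < S.T, ∀ k < S.K, ∀ i, Measurable[𝒜 t (k + 1)] (B.yxBase t k i)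
  yxPert_adapted : ∀ t < S.T, ∀ k < S.K, ∀ i, Measurable[𝒜 t (k + 1)] (B.yxPert t k i)
  -- laws of the samples
  ξb_law : ∀ t < S.T, ∀ s < S.b t, ∀ i, P.map (B.ξb t s i) = G.law
  Wb_law : ∀ t < S.T, ∀ s < S.b t, ∀ i, P.map (B.Wb t s i) = sphereUniform (n i)
  ξ_law : ∀ t < S.T, ∀ k < S.K, ∀ i, P.map (B.ξ t k i) = G.law
  W_law : ∀ t < S.T, ∀ k < S.K, ∀ i, P.map (B.W t k i) = sphereUniform (n i)
  -- the batches are i.i.d. samples and independent of the past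
  ξb_iid : ∀ t < S.T, ∀ i, iIndepFun (fun (s : Fin (S.b t)) ω => B.ξb t s i ω) P
  Wb_iid : ∀ t < S.T, ∀ i, iIndepFun (fun (s : Fin (S.b t)) ω => B.Wb t s i ω) P
  ξb_fresh : ∀ t < S.T, ∀ i, Indep
    (MeasurableSpace.comap (fun ω (s : Fin (S.b t)) => B.ξb t s i ω) inferInstance) (ℱ t) P
  Wb_fresh : ∀ t < S.T, ∀ i, Indep
    (MeasurableSpace.comap (fun ω (s : Fin (S.b t)) => B.Wb t s i ω) inferInstance) (ℱ t) P
  -- the one-shot samples are independent of the past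
  ξ_fresh : ∀ t < S.T, ∀ k < S.K, ∀ i,
    Indep (MeasurableSpace.comap (B.ξ t k i) inferInstance) (𝒜 t k) P
  W_fresh : ∀ t < S.T, ∀ k < S.K, ∀ i,
    Indep (MeasurableSpace.comap (B.W t k i) inferInstance) (𝒜 t k) P
  -- the oracles are queried where the data of the game are regular
  query : ∀ᵐ ω ∂P, ∀ t < S.T, ∀ i,
    Metric.closedBall (outer G S B x₀ ω t i) (S.δ t) ⊆ D i
  -- accuracy of the lower level solver at each query
  ybBase_eps : ∀ t < S.T, ∀ s < S.b t, ∀ i, IsEpsSolution G P i (S.ε t)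
    (fun ω => outer G S B x₀ ω t i) (B.ybBase t s i)
  ybPert_eps : ∀ t < S.T, ∀ s < S.b t, ∀ i, IsEpsSolution G P i (S.ε t)
    (fun ω => outer G S B x₀ ω t i + S.δ t • B.Wb t s i ω) (B.ybPert t s i)
  yzBase_eps : ∀ t < S.T, ∀ k < S.K, ∀ i, IsEpsSolution G P i (S.ε t)
    (fun ω => halfIterate G S B x₀ t k ω i) (B.yzBase t k i)
  yzPert_eps : ∀ t < S.T, ∀ k < S.K, ∀ i, IsEpsSolution G P i (S.ε t)
    (fun ω => halfIterate G S B x₀ t k ω i + S.δ t • B.W t k i ω) (B.yzPert t k i)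
  yxBase_eps : ∀ t < S.T, ∀ k < S.K, ∀ i, IsEpsSolution G P i (S.ε t)
    (fun ω => outer G S B x₀ ω t i) (B.yxBase t k i)
  yxPert_eps : ∀ t < S.T, ∀ k < S.K, ∀ i, IsEpsSolution G P i (S.ε t)
    (fun ω => outer G S B x₀ ω t i + S.δ t • B.W t k i ω) (B.yxPert t k i)

end Algorithm

/-- The noise level `σ = (2 M² + 2 ∑ i, L_{1,i}² n_i²)^{1/2}`. -/
def noiseLevel {ι : Type*} [Fintype ι] (n : ι → ℕ) (L1 : ι → ℝ≥0) (M : ℝ≥0) : ℝ :=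
  Real.sqrt (2 * (M : ℝ) ^ 2 + 2 * ∑ i, (L1 i : ℝ) ^ 2 * (n i : ℝ) ^ 2)

end HierGame

end

/-! With `γ = 1/T` and `K = T`, all rounds together form a single extragradient recursion of `T²`
steps. Let `p_j` be the half iterates in the order of the run, `g_j` the direction of the current
round and `e_j` the correction. Then `p_{j+1} = Π(p_j - γ (e_j + g_{j+1}))`, even across a round
boundary, because `x^{t+1}` is the unprojected point `p_j - γ e_j`. Telescoping the three point
inequality (`extragradient_regret`) bounds `∑ ⟨g_j + e'_j, p_j - z⟩` pathwise for every feasible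
`z`. Here `e'_j` is an idealised correction, with exact lower level solutions and with the first
order oracle queried at the projection of `x^t`, the anchor. The bound has mean of order `T`: the
initial distance is weighted by `T`, and `T²` squared norms of bounded mean are weighted by `1/T`.
Passing from `e_j` to `e'_j` costs only the first moment of `‖e_j - e'_j‖`, which matters because
the solver is accurate in mean only. Division by `T²` gives the rate.

The summand `g_j + e'_j` equals `V(p_j)`, plus the mean finite difference at `p_j`, the Tikhonov
term `η p_j`, a batch error and centered noise (`roundDir_add_exactDir_apply`). Monotonicity
replaces `V(p_j)` by `V(z)`. The mean finite difference is an approximate subgradient of `h_i`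
(`inner_integral_finiteDifference_le`), by a one-sided divergence theorem on a ball, and Jensen's
inequality then passes to the averaged iterate. The Tikhonov term and the smoothing cost `O(1/T)`
per step. So do the solver errors, being of size `ε/δ = 1/T`, and the batch noise, since `b ≥ T²`;
the latter is the only source of `M`.

The noise is paired with `z - p_j = (z - x₀) + (x₀ - p_j)`. The first part is controlled by the norm
of the summed noise, which orthogonality bounds by `O(T)` in mean; the second part has mean zero.
The resulting pathwise bound no longer contains `z`, so it passes to the supremum before
expectations are taken. Freshness is assumed separately for each player and each kind of sample, so
the noise is treated player by player, and separately for `ξ` and `W`.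

Finally, `x^t` may leave the feasible set, where the oracle need not be unbiased. Its distance from
the anchor is at most `γ` times the norm of the last correction of the previous round, whose mean is
bounded by a constant plus a multiple of the previous mean distance. This recursion keeps the mean
distance of order `1/T` (`meanLE_dist_anchor`). -/

namespace HierGame

/-! ### Flux of a Lipschitz function through a sphere -/

section Sphere

open Set Metric Filter Topology

section Cutoff

variable {E : Type*} [NormedAddCommGroup E]

/-- The Lipschitz cutoff equal to one on the ball of radius `δ - s` and to zero off the ball of
radius `δ`. -/
noncomputable def radialCutoff (δ s : ℝ) (x : E) : ℝ := max 0 (min 1 ((δ - ‖x‖) / s))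

theorem radialCutoff_nonneg (δ s : ℝ) (x : E) : 0 ≤ radialCutoff δ s x := le_max_left _ _

theorem radialCutoff_le_one (δ s : ℝ) (x : E) : radialCutoff δ s x ≤ 1 :=
  max_le zero_le_one (min_le_left _ _)

theorem radialCutoff_eq_zero {δ s : ℝ} (hs : 0 < s) {x : E} (hx : δ ≤ ‖x‖) :
    radialCutoff δ s x = 0 := by
  have : (δ - ‖x‖) / s ≤ 0 := div_nonpos_of_nonpos_of_nonneg (by linarith) hs.le
  exact max_eq_left ((min_le_right _ _).trans this)

theorem radialCutoff_eq_one {δ s : ℝ} (hs : 0 < s) {x : E} (hx : ‖x‖ ≤ δ - s) :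
    radialCutoff δ s x = 1 := by
  have : 1 ≤ (δ - ‖x‖) / s := by rw [le_div_iff₀ hs]; linarith
  rw [radialCutoff, min_eq_left this]
  simp

theorem radialCutoff_eq_div {δ s : ℝ} (hs : 0 < s) {x : E} (h1 : δ - s ≤ ‖x‖) (h2 : ‖x‖ ≤ δ) :
    radialCutoff δ s x = (δ - ‖x‖) / s := by
  have h3 : (δ - ‖x‖) / s ≤ 1 := by rw [div_le_iff₀ hs]; linarith
  have h4 : 0 ≤ (δ - ‖x‖) / s := div_nonneg (by linarith) hs.le
  rw [radialCutoff, min_eq_right h3, max_eq_right h4]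

theorem lipschitzWith_radialCutoff (δ : ℝ) {s : ℝ} (hs : 0 < s) :
    LipschitzWith (Real.toNNReal s⁻¹) (radialCutoff δ s : E → ℝ) := by
  have h : LipschitzWith (Real.toNNReal s⁻¹) (fun x : E => (δ - ‖x‖) / s) := by
    refine LipschitzWith.of_dist_le_mul fun x y => ?_
    rw [Real.coe_toNNReal _ (by positivity), Real.dist_eq, ← sub_div, abs_div, abs_of_pos hs,
      div_eq_inv_mul]
    gcongr
    rw [dist_eq_norm, show δ - ‖x‖ - (δ - ‖y‖) = -(‖x‖ - ‖y‖) by ring, abs_neg]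
    exact abs_norm_sub_norm_le x y
  exact (h.const_min 1).const_max 0

theorem hasCompactSupport_radialCutoff [ProperSpace E] (δ : ℝ) {s : ℝ} (hs : 0 < s) :
    HasCompactSupport (radialCutoff δ s : E → ℝ) := by
  refine HasCompactSupport.intro (isCompact_closedBall (0 : E) δ) fun x hx => ?_
  refine radialCutoff_eq_zero hs ?_
  simpa using (lt_of_not_ge (by simpa using hx)).le

variable [InnerProductSpace ℝ E]

theorem hasLineDerivAt_norm {x : E} (hx : x ≠ 0) (u : E) :
    HasLineDerivAt ℝ (fun y : E => ‖y‖) (inner ℝ x u / ‖x‖) x u := by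
  have hx' : 0 < ‖x‖ := norm_pos_iff.2 hx
  have h1 : HasDerivAt (fun t : ℝ => ‖x‖ ^ 2 + 2 * (t * inner ℝ x u) + t ^ 2 * ‖u‖ ^ 2)
      (2 * inner ℝ x u) 0 := by
    have := ((((hasDerivAt_id (0 : ℝ)).mul_const (inner ℝ x u)).const_mul 2).const_add
      (‖x‖ ^ 2)).add ((hasDerivAt_pow 2 (0 : ℝ)).mul_const (‖u‖ ^ 2))
    simpa [Pi.add_def] using this
  have h2 := h1.sqrt (by simp [hx])
  have h3 : (fun t : ℝ => ‖x + t • u‖)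
      = fun t => √(‖x‖ ^ 2 + 2 * (t * inner ℝ x u) + t ^ 2 * ‖u‖ ^ 2) := by
    ext t
    rw [← Real.sqrt_sq (norm_nonneg (x + t • u)), norm_add_sq_real, norm_smul, inner_smul_right,
      mul_pow, Real.norm_eq_abs, sq_abs]
  rw [HasLineDerivAt, h3]
  refine h2.congr_deriv ?_
  simp [Real.sqrt_sq hx'.le]
  field_simp

/-- The cutoff is locally `1`, `(δ - ‖x‖) / s` or `0`, and the two spheres where these pieces meet
are null sets. The derivative lives on the annulus and carries the factor `1 / s`, so it is a
smeared out surface measure. -/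
theorem lineDeriv_radialCutoff {δ s : ℝ} (hs : 0 < s) (hsδ : s < δ) {x : E} (u : E)
    (h1 : ‖x‖ ≠ δ - s) (h2 : ‖x‖ ≠ δ) :
    lineDeriv ℝ (radialCutoff δ s) x u =
      (Ioo (δ - s) δ).indicator 1 ‖x‖ * (-(inner ℝ (‖x‖⁻¹ • x) u) / s) := by
  by_cases hx : ‖x‖ ∈ Ioo (δ - s) δ
  · have hx0 : x ≠ 0 := by
      rintro rfl
      have := hx.1
      simp at this
      linarith
    have hev : radialCutoff δ s =ᶠ[𝓝 x] fun y : E => (δ - ‖y‖) / s := by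
      filter_upwards [continuous_norm.continuousAt.preimage_mem_nhds (Ioo_mem_nhds hx.1 hx.2)]
        with y hy
      exact radialCutoff_eq_div hs hy.1.le hy.2.le
    rw [hev.lineDeriv_eq, indicator_of_mem hx]
    have h : HasLineDerivAt ℝ (fun y : E => (δ - ‖y‖) / s) (-(inner ℝ x u / ‖x‖) / s) x u := by
      have := hasLineDerivAt_norm hx0 u
      exact (HasDerivAt.const_sub δ this).div_const s
    rw [h.lineDeriv, inner_smul_left]
    simp
    ring
  · rw [indicator_of_notMem hx, zero_mul]
    rcases lt_or_gt_of_ne h1 with h | h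
    · have hev : radialCutoff δ s =ᶠ[𝓝 x] fun _ : E => (1 : ℝ) := by
        filter_upwards [continuous_norm.continuousAt.preimage_mem_nhds (Iio_mem_nhds h)]
          with y hy
        exact radialCutoff_eq_one hs (le_of_lt hy)
      rw [hev.lineDeriv_eq, lineDeriv]
      simp
    · have h' : δ < ‖x‖ := lt_of_le_of_ne (not_lt.1 fun h3 => hx ⟨h, h3⟩) (Ne.symm h2)
      have hev : radialCutoff δ s =ᶠ[𝓝 x] fun _ : E => (0 : ℝ) := by
        filter_upwards [continuous_norm.continuousAt.preimage_mem_nhds (Ioi_mem_nhds h')]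
          with y hy
        exact radialCutoff_eq_zero hs (le_of_lt hy)
      rw [hev.lineDeriv_eq, lineDeriv]
      simp

end Cutoff

variable {E : Type*} [NormedAddCommGroup E] [InnerProductSpace ℝ E] [FiniteDimensional ℝ E]
  [MeasurableSpace E] [BorelSpace E] [Nontrivial E]

/-- Polar coordinates for a product of an angular and a radial factor. Integrability is not needed,
because `integral_prod_mul` holds unconditionally. -/
theorem integral_direction_mul_norm (μ : Measure E) [μ.IsAddHaarMeasure] (F : E → ℝ) (ρ : ℝ → ℝ) :
    ∫ x, F (‖x‖⁻¹ • x) * ρ ‖x‖ ∂μ =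
      (∫ w : sphere (0 : E) 1, F w ∂μ.toSphere) *
        ∫ r in Ioi (0 : ℝ), r ^ (Module.finrank ℝ E - 1) * ρ r := by
  calc
    ∫ x, F (‖x‖⁻¹ • x) * ρ ‖x‖ ∂μ
        = ∫ x : ({(0)}ᶜ : Set E), F (‖x.1‖⁻¹ • x.1) * ρ ‖x.1‖ ∂(μ.comap (↑)) := by
      rw [integral_subtype_comap (measurableSet_singleton _).compl
        fun x : E ↦ F (‖x‖⁻¹ • x) * ρ ‖x‖, restrict_compl_singleton]
    _ = ∫ x, F x.1 * ρ x.2 ∂μ.toSphere.prod (.volumeIoiPow (Module.finrank ℝ E - 1)) := by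
      simpa using μ.measurePreserving_homeomorphUnitSphereProd.integral_comp
        (Homeomorph.measurableEmbedding _)
        (fun x : sphere (0 : E) 1 × Ioi (0 : ℝ) => F x.1 * ρ x.2)
    _ = (∫ w : sphere (0 : E) 1, F w ∂μ.toSphere) *
          ∫ r : Ioi (0 : ℝ), ρ r ∂.volumeIoiPow (Module.finrank ℝ E - 1) :=
      integral_prod_mul (fun w : sphere (0 : E) 1 => F w) (fun r : Ioi (0 : ℝ) => ρ r)
    _ = _ := by
      congr 1
      simp only [Measure.volumeIoiPow, ENNReal.ofReal]
      rw [integral_withDensity_eq_integral_smul,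
        integral_subtype_comap measurableSet_Ioi
          fun a ↦ Real.toNNReal (a ^ (Module.finrank ℝ E - 1)) • ρ a,
        setIntegral_congr_fun measurableSet_Ioi fun x hx ↦ ?_]
      · simp only [NNReal.smul_def, smul_eq_mul]
        rw [Real.coe_toNNReal _ (pow_nonneg (le_of_lt hx) _)]
      · exact (measurable_subtype_coe.pow_const _).real_toNNReal

theorem integral_direction_annulus (μ : Measure E) [μ.IsAddHaarMeasure] (F : E → ℝ)
    {a b : ℝ} (ha : 0 ≤ a) (hab : a ≤ b) :
    ∫ x, F (‖x‖⁻¹ • x) * (Ioo a b).indicator 1 ‖x‖ ∂μ =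
      (∫ w : sphere (0 : E) 1, F w ∂μ.toSphere) *
        ((b ^ Module.finrank ℝ E - a ^ Module.finrank ℝ E) / Module.finrank ℝ E) := by
  have hd : 0 < Module.finrank ℝ E := Module.finrank_pos
  rw [integral_direction_mul_norm]
  congr 1
  have h1 : ∀ r : ℝ, r ^ (Module.finrank ℝ E - 1) * (Ioo a b).indicator (1 : ℝ → ℝ) r
      = (Ioo a b).indicator (fun r => r ^ (Module.finrank ℝ E - 1)) r := by
    intro r
    by_cases h : r ∈ Ioo a b <;> simp [h]
  simp_rw [h1]
  rw [setIntegral_indicator measurableSet_Ioo,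
    inter_eq_right.2 (fun r hr => mem_Ioi.2 (lt_of_le_of_lt ha hr.1)), ← integral_Ioc_eq_integral_Ioo,
    ← intervalIntegral.integral_of_le hab, integral_pow]
  rw [Nat.sub_add_cancel hd, Nat.cast_sub hd]
  simp

/-- One-sided divergence inequality on a ball: if `f` grows at most at rate `M` in direction `v`
from every point of the ball of radius `δ`, then so does its flux through the sphere. -/
theorem flux_le_of_growth (μ : Measure E) [μ.IsAddHaarMeasure] {f : E → ℝ} {L : ℝ≥0}
    (hf : LipschitzWith L f) {δ M : ℝ} (hδ : 0 < δ) (v : E)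
    (hM : ∀ x, ‖x‖ < δ → ∀ s ∈ Ioc (0 : ℝ) 1, f (x + s • v) - f x ≤ s * M) :
    δ ^ (Module.finrank ℝ E - 1) * ∫ w : sphere (0 : E) 1, inner ℝ (w : E) v * f (δ • (w : E))
      ∂μ.toSphere ≤
    M * μ.real (ball 0 δ) := by
  set d := Module.finrank ℝ E with hd
  have hdpos : 0 < d := Module.finrank_pos
  set F : E → ℝ := fun w => inner ℝ w v * f (δ • w) with hF
  set Φ₀ : ℝ := ∫ w : sphere (0 : E) 1, F w ∂μ.toSphere with hΦ
  set τ : ℝ := μ.toSphere.real univ with hτ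
  set A : ℝ → ℝ := fun s => (δ ^ d - (δ - s) ^ d) / d with hA
  have hfc := hf.continuous
  -- Integration by parts against the cutoff of width `s` gives the flux inequality up to errors
  -- proportional to the annulus mass `τ * A s`. These vanish as `s → 0`, while `s⁻¹ * A s` tends to
  -- `δ ^ (d - 1)`.
  have key : ∀ s ∈ Ioo 0 δ, s⁻¹ * A s * Φ₀ ≤
      M * μ.real (ball 0 δ) + (|M| + L * ‖v‖) * (τ * A s) := by
    intro s ⟨hs, hsδ⟩
    set J : E → ℝ := fun x => (Ioo (δ - s) δ).indicator 1 ‖x‖ with hJ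
    have hJm : Measurable J := (measurable_one.indicator measurableSet_Ioo).comp measurable_norm
    have hJ01 : ∀ x, J x = 0 ∧ ¬ (‖x‖ ∈ Ioo (δ - s) δ) ∨ J x = 1 ∧ ‖x‖ ∈ Ioo (δ - s) δ := by
      intro x
      by_cases h : ‖x‖ ∈ Ioo (δ - s) δ
      · exact Or.inr ⟨by simp [hJ, h], h⟩
      · exact Or.inl ⟨by simp only [hJ]; exact indicator_of_notMem h _, h⟩
    have hJi : ∫ x, J x ∂μ = τ * A s := by
      have := integral_direction_annulus μ (fun _ => 1) (a := δ - s) (b := δ)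
        (by linarith) (by linarith)
      simpa [hJ, hτ, hA] using this
    have hball : Integrable ((closedBall (0 : E) δ).indicator (1 : E → ℝ)) μ :=
      (integrable_indicator_iff measurableSet_closedBall).2
        (integrableOn_const (measure_closedBall_lt_top).ne)
    have hbd : ∀ (u : E → ℝ) (c : ℝ), AEStronglyMeasurable u μ →
        (∀ᵐ x ∂μ, |u x| ≤ c * (closedBall (0 : E) δ).indicator 1 x) → Integrable u μ :=
      fun u c hu h => (hball.const_mul c).mono' hu h
    have hJint : Integrable J μ := by
      refine hbd J 1 hJm.aestronglyMeasurable (Eventually.of_forall fun x => ?_)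
      rcases hJ01 x with ⟨h, -⟩ | ⟨h, h'⟩
      · rw [h]
        simp [indicator_nonneg]
      · rw [h, indicator_of_mem (by simpa using h'.2.le)]
        simp
    set m : ℝ := |f 0| + L * δ with hm
    have hfm : ∀ x, ‖x‖ ≤ δ → |f x| ≤ m := by
      intro x hx
      have h1 : |f x - f 0| ≤ L * ‖x‖ := by simpa [Real.dist_eq] using hf.dist_le_mul x 0
      have h2 : |f x| ≤ |f x - f 0| + |f 0| := by
        have := abs_add_le (f x - f 0) (f 0)
        simpa using this
      have h3 : (L : ℝ) * ‖x‖ ≤ L * δ := by gcongr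
      rw [hm]
      linarith
    have hm0 : 0 ≤ m := by positivity
    have hdir : ∀ x : E, ‖(‖x‖⁻¹ • x)‖ ≤ 1 := by
      intro x
      rw [norm_smul, norm_inv, norm_norm]
      exact inv_mul_le_one
    have hFm : ∀ x : E, |F (‖x‖⁻¹ • x)| ≤ ‖v‖ * m := by
      intro x
      rw [hF]
      simp only
      rw [abs_mul]
      gcongr
      · refine (abs_real_inner_le_norm _ _).trans ?_
        have := mul_le_mul_of_nonneg_right (hdir x) (norm_nonneg v)
        linarith
      · refine hfm _ ?_
        rw [norm_smul, Real.norm_of_nonneg hδ.le]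
        have := mul_le_mul_of_nonneg_left (hdir x) hδ.le
        linarith
    have hFint : Integrable (fun x => F (‖x‖⁻¹ • x) * J x) μ := by
      refine (hJint.const_mul (‖v‖ * m)).mono' ?_ (Eventually.of_forall fun x => ?_)
      · have : Measurable F := by
          have : Continuous F := by fun_prop
          exact this.measurable
        exact ((this.comp (by fun_prop)).mul hJm).aestronglyMeasurable
      · rw [Real.norm_eq_abs, abs_mul]
        rcases hJ01 x with ⟨h, -⟩ | ⟨h, -⟩ <;> simp [h, hFm x]
    have hFi : ∫ x, F (‖x‖⁻¹ • x) * J x ∂μ = Φ₀ * A s :=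
      integral_direction_annulus μ F (by linarith) (by linarith)
    have hsph : ∀ᵐ x ∂μ, ‖x‖ ≠ δ - s ∧ ‖x‖ ≠ δ := by
      have h1 : ∀ r : ℝ, ∀ᵐ x ∂μ, ‖x‖ ≠ r := by
        intro r
        have := Measure.addHaar_sphere μ (0 : E) r
        rw [ae_iff]
        convert this using 2
        ext x
        simp
      filter_upwards [h1 (δ - s), h1 δ] with x h2 h3 using ⟨h2, h3⟩
    set g : E → ℝ := radialCutoff δ s with hg
    have hglip : LipschitzWith (Real.toNNReal s⁻¹) g := lipschitzWith_radialCutoff δ hs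
    have hgsupp : HasCompactSupport g := hasCompactSupport_radialCutoff δ hs
    have hgint : Integrable g μ := hglip.continuous.integrable_of_hasCompactSupport hgsupp
    have hparts := hf.integral_lineDeriv_mul_eq (μ := μ) hglip hgsupp v
    -- Inside the ball the growth hypothesis bounds the derivative along `v` by `M` wherever it
    -- exists, which is almost everywhere since `f` is Lipschitz; outside, the cutoff vanishes.
    have hupper : ∫ x, lineDeriv ℝ f x v * g x ∂μ ≤ ∫ x, M * g x ∂μ := by
      refine integral_mono_ae ?_ (hgint.const_mul M) ?_
      · refine hgint.bdd_mul (c := L * ‖v‖) (aestronglyMeasurable_lineDeriv hfc μ) ?_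
        exact Eventually.of_forall fun x => norm_lineDeriv_le_of_lipschitz ℝ hf
      · filter_upwards [hf.ae_lineDifferentiableAt (μ := μ) v] with x hx
        rcases lt_or_ge ‖x‖ δ with h | h
        · refine mul_le_mul_of_nonneg_right ?_ (radialCutoff_nonneg _ _ _)
          have hlim := hx.hasLineDerivAt.tendsto_slope_zero_right
          refine le_of_tendsto hlim ?_
          filter_upwards [Ioc_mem_nhdsGT (zero_lt_one' ℝ)] with r hr
          rw [smul_eq_mul, inv_mul_le_iff₀ hr.1]
          exact hM x h r hr
        · simp [hg, radialCutoff_eq_zero hs h]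
    -- On the annulus `f x` is within `L * s` of the value of `f` at the radial projection onto the
    -- sphere of radius `δ`. The factor `s⁻¹` turns this error into the constant `L * ‖v‖`.
    have hlower : ∫ x, (s⁻¹ * (F (‖x‖⁻¹ • x) * J x) - L * ‖v‖ * J x) ∂μ ≤
        ∫ x, lineDeriv ℝ g x (-v) * f x ∂μ := by
      refine integral_mono_ae ((hFint.const_mul _).sub (hJint.const_mul _)) ?_ ?_
      · refine hbd _ (s⁻¹ * ‖v‖ * m) ?_ ?_
        · exact (aestronglyMeasurable_lineDeriv hglip.continuous μ).mul hfc.aestronglyMeasurable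
        · filter_upwards [hsph] with x hx
          rw [lineDeriv_radialCutoff hs hsδ _ hx.1 hx.2, abs_mul]
          change |J x * _| * _ ≤ _
          rcases hJ01 x with ⟨h, -⟩ | ⟨h, h'⟩
          · rw [h]
            simp only [zero_mul, abs_zero]
            exact mul_nonneg (by positivity) (indicator_nonneg (by simp) _)
          · rw [h, indicator_of_mem (by simpa using h'.2.le), one_mul, abs_div, abs_neg,
              abs_of_pos hs, Pi.one_apply, mul_one, div_eq_inv_mul]
            gcongr
            · refine (abs_real_inner_le_norm _ _).trans ?_
              rw [norm_neg]
              have := mul_le_mul_of_nonneg_right (hdir x) (norm_nonneg v)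
              linarith
            · exact hfm x h'.2.le
      · filter_upwards [hsph] with x hx
        rw [lineDeriv_radialCutoff hs hsδ _ hx.1 hx.2]
        change _ ≤ J x * _ * _
        rcases hJ01 x with ⟨h, -⟩ | ⟨h, h'⟩
        · simp [h]
        · rw [h]
          have hx0 : 0 < ‖x‖ := by linarith [h'.1]
          set w := ‖x‖⁻¹ • x with hw
          have hxw : x = ‖x‖ • w := by rw [hw, smul_smul, mul_inv_cancel₀ hx0.ne', one_smul]
          have h1 : |f (δ • w) - f x| ≤ L * s := by
            have h2 := hf.dist_le_mul (δ • w) x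
            rw [Real.dist_eq] at h2
            refine h2.trans ?_
            gcongr
            have h3 : δ • w - x = (δ - ‖x‖) • w := by
              nth_rewrite 1 [hxw]
              rw [sub_smul]
            rw [dist_eq_norm, h3, norm_smul, Real.norm_of_nonneg (by linarith [h'.2])]
            have := mul_le_mul_of_nonneg_left (hdir x) (show 0 ≤ δ - ‖x‖ by linarith [h'.2])
            linarith [h'.1]
          have h4 : |inner ℝ w v| ≤ ‖v‖ := by
            refine (abs_real_inner_le_norm _ _).trans ?_
            have := mul_le_mul_of_nonneg_right (hdir x) (norm_nonneg v)
            linarith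
          have h5 : inner ℝ w v * (f (δ • w) - f x) ≤ ‖v‖ * (L * s) := by
            refine (le_abs_self _).trans ?_
            rw [abs_mul]
            gcongr
          simp only [hF, inner_neg_right, neg_neg, mul_one, one_mul]
          have h6 : s⁻¹ * (inner ℝ w v * (f (δ • w) - f x)) ≤ s⁻¹ * (‖v‖ * (L * s)) := by gcongr
          have h7 : s⁻¹ * (‖v‖ * (L * s)) = L * ‖v‖ := by field_simp
          rw [h7] at h6
          have h8 : inner ℝ w v / s * f x = s⁻¹ * (inner ℝ w v * f x) := by ring
          rw [h8]
          linarith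
    rw [integral_sub (hFint.const_mul _) (hJint.const_mul _), integral_const_mul, hFi,
      integral_const_mul, hJi] at hlower
    -- Off a null set, the cutoff differs from the indicator of the ball only on the annulus, and
    -- there by at most one.
    have hg2 : ∫ x, M * g x ∂μ ≤ M * μ.real (ball 0 δ) + |M| * (τ * A s) := by
      have hb : ∫ x, (ball (0 : E) δ).indicator (1 : E → ℝ) x ∂μ = μ.real (ball 0 δ) :=
        integral_indicator_one measurableSet_ball
      have hbi : Integrable ((ball (0 : E) δ).indicator (1 : E → ℝ)) μ :=
        (integrable_indicator_iff measurableSet_ball).2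
          (integrableOn_const (measure_ball_lt_top).ne)
      rw [← hb, ← integral_const_mul, ← hJi, ← integral_const_mul |M|,
        ← integral_add (hbi.const_mul _) (hJint.const_mul _)]
      refine integral_mono_ae (hgint.const_mul M) ((hbi.const_mul _).add (hJint.const_mul _)) ?_
      filter_upwards [hsph] with x hx
      rcases hJ01 x with ⟨h, hn⟩ | ⟨h, h'⟩
      · rw [h]
        rcases lt_or_gt_of_ne hx.1 with h1 | h1
        · rw [indicator_of_mem (by simpa using by linarith), hg, radialCutoff_eq_one hs h1.le]
          simp
        · have h2 : δ ≤ ‖x‖ := not_lt.1 fun h3 => hn ⟨h1, h3⟩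
          rw [indicator_of_notMem (by simpa using h2), hg, radialCutoff_eq_zero hs h2]
          simp
      · rw [h, indicator_of_mem (by simpa using h'.2)]
        have h1 : (0 : ℝ) ≤ g x := radialCutoff_nonneg _ _ _
        have h2 : g x ≤ 1 := radialCutoff_le_one _ _ _
        have h3 : M * (g x - 1) ≤ |M| * 1 := by
          refine (le_abs_self _).trans ?_
          rw [abs_mul]
          gcongr
          rw [abs_le]
          constructor <;> linarith
        simp only [Pi.one_apply]
        linarith
    have e1 : s⁻¹ * (Φ₀ * A s) = s⁻¹ * A s * Φ₀ := by ring
    have e2 : (|M| + L * ‖v‖) * (τ * A s) = |M| * (τ * A s) + L * ‖v‖ * (τ * A s) := by ring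
    rw [e1] at hlower
    rw [e2]
    linarith
  have hder : HasDerivAt A (δ ^ (d - 1)) 0 := by
    have h1 : HasDerivAt (fun s : ℝ => (δ - s) ^ d) (d * (δ - 0) ^ (d - 1) * (-1)) 0 :=
      ((hasDerivAt_id (0 : ℝ)).const_sub δ).pow d
    have h2 := (h1.const_sub (δ ^ d)).div_const (d : ℝ)
    refine h2.congr_deriv ?_
    have : (d : ℝ) ≠ 0 := by exact_mod_cast hdpos.ne'
    field_simp
    simp
  have hA0 : A 0 = 0 := by simp [hA]
  have hlim1 : Tendsto (fun s => s⁻¹ * A s * Φ₀) (𝓝[>] 0) (𝓝 (δ ^ (d - 1) * Φ₀)) := by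
    have := hder.tendsto_slope_zero_right
    simp only [zero_add, hA0, sub_zero, smul_eq_mul] at this
    exact this.mul_const _
  have hlim2 : Tendsto (fun s => M * μ.real (ball 0 δ) + (|M| + L * ‖v‖) * (τ * A s)) (𝓝[>] 0)
      (𝓝 (M * μ.real (ball 0 δ) + (|M| + L * ‖v‖) * (τ * 0))) := by
    have h1 : Tendsto A (𝓝[>] 0) (𝓝 0) := by
      have := hder.continuousAt.tendsto
      rw [hA0] at this
      exact this.mono_left nhdsWithin_le_nhds
    exact ((h1.const_mul τ).const_mul _).const_add _
  rw [mul_zero, mul_zero, add_zero] at hlim2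
  refine le_of_tendsto_of_tendsto hlim1 hlim2 ?_
  filter_upwards [Ioo_mem_nhdsGT hδ] with s hs using key s hs

end Sphere

/-! ### The uniform law on the sphere and the spherical finite difference -/

section SphereUniform

open Set Metric Filter Topology

theorem nontrivial_vec {d : ℕ} (hd : 0 < d) : Nontrivial (Vec d) := by
  have : Nonempty (Fin d) := ⟨⟨0, hd⟩⟩
  infer_instance

theorem toSphere_univ_ne_zero {d : ℕ} (hd : 0 < d) :
    (volume : Measure (Vec d)).toSphere univ ≠ 0 := by
  have := nontrivial_vec hd
  simpa using ⟨hd.ne', (measure_ball_pos (volume : Measure (Vec d)) 0 one_pos).ne'⟩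

theorem isProbabilityMeasure_sphereUniform {d : ℕ} (hd : 0 < d) :
    IsProbabilityMeasure (sphereUniform d) := by
  refine ⟨?_⟩
  rw [sphereUniform, Measure.map_apply measurable_subtype_coe MeasurableSet.univ, preimage_univ,
    Measure.smul_apply, smul_eq_mul]
  exact ENNReal.inv_mul_cancel (toSphere_univ_ne_zero hd) (measure_ne_top _ _)

/-- In dimension zero the sphere is empty, so the prescribed law of the directions cannot be a
probability measure. This is what yields `0 < n i` for every run. -/
theorem sphereUniform_zero : sphereUniform 0 = 0 := by
  have : (volume : Measure (Vec 0)).toSphere = 0 := by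
    rw [Measure.toSphere_eq_zero_iff]
    infer_instance
  rw [sphereUniform, this]
  simp

theorem ae_norm_sphereUniform (d : ℕ) : ∀ᵐ w ∂sphereUniform d, ‖w‖ = 1 := by
  rw [sphereUniform, ae_map_iff measurable_subtype_coe.aemeasurable
    (measurableSet_eq_fun measurable_norm measurable_const)]
  exact Eventually.of_forall fun w => by simp

theorem integral_sphereUniform (d : ℕ) (F : Vec d → ℝ) :
    ∫ w, F w ∂sphereUniform d =
      ((volume : Measure (Vec d)).toSphere.real univ)⁻¹ *
        ∫ w : sphere (0 : Vec d) 1, F w ∂(volume : Measure (Vec d)).toSphere := by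
  have hme : MeasurableEmbedding (Subtype.val : sphere (0 : Vec d) 1 → Vec d) :=
    MeasurableEmbedding.subtype_coe isClosed_sphere.measurableSet
  rw [sphereUniform, hme.integral_map, integral_smul_measure, smul_eq_mul, ENNReal.toReal_inv]
  rfl

theorem integrable_finiteDifference {d : ℕ} (hd : 0 < d) {f : Vec d → ℝ} {L : ℝ≥0}
    (hf : LipschitzWith L f) {δ : ℝ} (p : Vec d) :
    Integrable (fun w : Vec d => ((d : ℝ) * ((f (p + δ • w) - f p) / δ)) • w)
      (sphereUniform d) := by
  have := isProbabilityMeasure_sphereUniform hd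
  have hfc := hf.continuous
  refine Integrable.mono' (integrable_const ((d : ℝ) * (L * |δ| / |δ|))) ?_ ?_
  · have : Continuous (fun w : Vec d => ((d : ℝ) * ((f (p + δ • w) - f p) / δ)) • w) := by
      fun_prop
    exact this.aestronglyMeasurable
  · filter_upwards [ae_norm_sphereUniform d] with w hw
    rw [norm_smul, hw, mul_one, Real.norm_eq_abs, abs_mul, abs_div, Nat.abs_cast]
    gcongr
    have := hf.dist_le_mul (p + δ • w) p
    rw [Real.dist_eq, dist_eq_norm, add_sub_cancel_left, norm_smul, hw, mul_one] at this
    exact this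

/-- The mean of the spherical finite difference estimator is an approximate subgradient of a convex
Lipschitz function. -/
theorem inner_integral_finiteDifference_le {d : ℕ} (hd : 0 < d) {f : Vec d → ℝ} {L : ℝ≥0}
    (hf : LipschitzWith L f) {S : Set (Vec d)} (hconv : ConvexOn ℝ S f) {δ : ℝ} (hδ : 0 < δ)
    {p z : Vec d} (hp : closedBall p δ ⊆ S) (hz : closedBall z δ ⊆ S) :
    inner ℝ (∫ w, ((d : ℝ) * ((f (p + δ • w) - f p) / δ)) • w ∂sphereUniform d) (z - p) ≤
      f z - f p + 2 * L * δ := by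
  have := nontrivial_vec hd
  set v := z - p with hv
  set M := f z - f p + 2 * L * δ with hM
  set f₀ : Vec d → ℝ := fun x => f (p + x) - f p with hf₀
  have hf₀L : LipschitzWith L f₀ := by
    refine LipschitzWith.of_dist_le_mul fun x y => ?_
    have := hf.dist_le_mul (p + x) (p + y)
    simpa [hf₀, Real.dist_eq] using this
  -- The growth hypothesis is convexity along the segment from `p + x` to `z + x`; moving both ends
  -- back to `p` and `z` costs `L * δ` each.
  have hflux := flux_le_of_growth (volume : Measure (Vec d)) hf₀L (M := M) hδ v (by
    intro x hx s hs
    have h1 : p + (x + s • v) = (1 - s) • (p + x) + s • (z + x) := by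
      rw [hv]
      module
    have h2 := hconv.2 (hp (show p + x ∈ closedBall p δ by simpa using hx.le))
      (hz (show z + x ∈ closedBall z δ by simpa using hx.le))
      (show 0 ≤ 1 - s by linarith [hs.2]) hs.1.le (by ring)
    have h3 : ∀ q : Vec d, |f (q + x) - f q| ≤ L * δ := by
      intro q
      have := hf.dist_le_mul (q + x) q
      rw [Real.dist_eq, dist_eq_norm, add_sub_cancel_left] at this
      refine this.trans ?_
      gcongr
    have h4 := abs_le.1 (h3 p)
    have h5 := abs_le.1 (h3 z)
    have h6 : f (z + x) - f (p + x) ≤ M := by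
      rw [hM]
      linarith [h4.1, h4.2, h5.1, h5.2]
    have h7 := mul_le_mul_of_nonneg_left h6 hs.1.le
    simp only [hf₀]
    rw [h1]
    simp only [smul_eq_mul] at h2
    linarith)
  have hball : volume.real (ball (0 : Vec d) δ) = δ ^ d * volume.real (ball (0 : Vec d) 1) := by
    rw [Measure.real, Measure.addHaar_ball_of_pos _ _ hδ, ENNReal.toReal_mul,
      ENNReal.toReal_ofReal (by positivity), finrank_euclideanSpace_fin]
    rfl
  rw [finrank_euclideanSpace_fin, hball] at hflux
  have hB : 0 < volume.real (ball (0 : Vec d) 1) :=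
    ENNReal.toReal_pos (measure_ball_pos _ _ one_pos).ne' measure_ball_lt_top.ne
  rw [real_inner_comm, ← integral_inner (integrable_finiteDifference hd hf p)]
  have hint : ∀ w : Vec d, inner ℝ v (((d : ℝ) * ((f (p + δ • w) - f p) / δ)) • w) =
      d / δ * (inner ℝ w v * f₀ (δ • w)) := by
    intro w
    rw [inner_smul_right, real_inner_comm]
    ring
  simp_rw [hint]
  -- With `B` the volume of the unit ball, the unit sphere has area `d * B` and the ball of radius
  -- `δ` has volume `δ ^ d * B`. The factor `d / δ` of the estimator therefore normalises the flux
  -- bound to exactly `M`.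
  rw [integral_const_mul, integral_sphereUniform d (fun w => inner ℝ w v * f₀ (δ • w)),
    Measure.toSphere_real_apply_univ, finrank_euclideanSpace_fin]
  set I := ∫ w : sphere (0 : Vec d) 1, inner ℝ (w : Vec d) v * f₀ (δ • (w : Vec d))
    ∂(volume : Measure (Vec d)).toSphere
  set B := volume.real (ball (0 : Vec d) 1)
  have hd' : (0 : ℝ) < d := by exact_mod_cast hd
  have hpow : δ ^ d = δ ^ (d - 1) * δ := by
    rw [← pow_succ, Nat.sub_add_cancel hd]
  rw [hpow] at hflux
  have h8 : I ≤ M * (δ * B) := by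
    have h9 : 0 < δ ^ (d - 1) := by positivity
    refine le_of_mul_le_mul_left ?_ h9
    linarith
  have h9 : (d : ℝ) / δ * ((d * B)⁻¹ * I) = I / (δ * B) := by
    field_simp
  rw [h9, div_le_iff₀ (by positivity)]
  exact h8

end SphereUniform

/-! ### Metric projection and solvability of the lower level -/

section Projection

variable {E : Type*} [NormedAddCommGroup E] [InnerProductSpace ℝ E] [CompleteSpace E]
  {K : Set E}

theorem isNearest_proj (hne : K.Nonempty) (hcl : IsClosed K) (hcv : Convex ℝ K) (w : E) :
    IsNearest K w (proj K w) := by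
  obtain ⟨p, hp, h⟩ := exists_norm_eq_iInf_of_complete_convex hne hcl.isComplete hcv w
  have : ∃ p, IsNearest K w p := by
    refine ⟨p, hp, fun q hq => ?_⟩
    rw [h]
    exact ciInf_le ⟨0, by rintro _ ⟨x, rfl⟩; exact norm_nonneg _⟩ (⟨q, hq⟩ : K)
  exact Classical.epsilon_spec this

theorem proj_mem (hne : K.Nonempty) (hcl : IsClosed K) (hcv : Convex ℝ K) (w : E) :
    proj K w ∈ K := (isNearest_proj hne hcl hcv w).1

theorem norm_sub_proj_le (hne : K.Nonempty) (hcl : IsClosed K) (hcv : Convex ℝ K) (w : E) {q : E}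
    (hq : q ∈ K) : ‖w - proj K w‖ ≤ ‖w - q‖ := (isNearest_proj hne hcl hcv w).2 q hq

theorem inner_sub_proj_le (hne : K.Nonempty) (hcl : IsClosed K) (hcv : Convex ℝ K) (w : E) {q : E}
    (hq : q ∈ K) : inner ℝ (w - proj K w) (q - proj K w) ≤ 0 := by
  have h := isNearest_proj hne hcl hcv w
  refine (norm_eq_iInf_iff_real_inner_le_zero hcv h.1).1 ?_ q hq
  have : Nonempty K := ⟨⟨_, h.1⟩⟩
  refine le_antisymm (le_ciInf fun q => h.2 q q.2) ?_
  exact ciInf_le ⟨0, by rintro _ ⟨x, rfl⟩; exact norm_nonneg _⟩ (⟨_, h.1⟩ : K)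

theorem lipschitzWith_proj (hne : K.Nonempty) (hcl : IsClosed K) (hcv : Convex ℝ K) :
    LipschitzWith 1 (proj K) := by
  refine LipschitzWith.of_dist_le_mul fun u w => ?_
  rw [NNReal.coe_one, one_mul, dist_eq_norm, dist_eq_norm]
  have h1 := inner_sub_proj_le hne hcl hcv u (proj_mem hne hcl hcv w)
  have h2 := inner_sub_proj_le hne hcl hcv w (proj_mem hne hcl hcv u)
  set a := proj K u
  set b := proj K w
  have h3 : ‖a - b‖ ^ 2 ≤ inner ℝ (u - w) (a - b) := by
    have e1 : inner ℝ (u - a) (b - a) = - inner ℝ (u - a) (a - b) := by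
      rw [← inner_neg_right, neg_sub]
    have e2 : inner ℝ (u - w) (a - b) - ‖a - b‖ ^ 2 =
        inner ℝ (u - a) (a - b) - inner ℝ (w - b) (a - b) := by
      rw [← real_inner_self_eq_norm_sq, ← inner_sub_left, ← inner_sub_left]
      congr 1
      abel
    linarith
  have h4 := real_inner_le_norm (u - w) (a - b)
  rcases eq_or_lt_of_le (norm_nonneg (a - b)) with h | h
  · rw [← h]
    exact norm_nonneg _
  · refine le_of_mul_le_mul_right ?_ h
    nlinarith

/-- The map `y ↦ Π(y - r φ(y))` contracts `K` for small `r`, and its fixed points solve the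
inequality. Existence is needed because `lowerSol` is a chosen value, which is known to lie in `Y i`
only if a solution exists. -/
theorem exists_isVISolution {d : ℕ} {φ : Vec d → Vec d} {K : Set (Vec d)} (hne : K.Nonempty)
    (hcl : IsClosed K) (hcv : Convex ℝ K) {μ : ℝ} (hμ : 0 < μ)
    (hmono : ∀ y ∈ K, ∀ y' ∈ K, μ * ‖y - y'‖ ^ 2 ≤ inner ℝ (φ y - φ y') (y - y'))
    {L : ℝ≥0} (hL : LipschitzOnWith L φ K) : ∃ y, IsVISolution φ K y := by
  -- Adding `μ` keeps `l` positive even if `L = 0`. With `r = μ / l ^ 2` one has `r ^ 2 * l ^ 2 = r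
  -- * μ`, so the squared contraction factor `1 - 2 * r * μ + r ^ 2 * l ^ 2` becomes `1 - r * μ`.
  set l : ℝ := L + μ with hl
  have hlpos : 0 < l := by positivity
  set r : ℝ := μ / l ^ 2 with hr
  have hrpos : 0 < r := by positivity
  have hrl : r ^ 2 * l ^ 2 = r * μ := by
    rw [hr]
    field_simp
  have hq : 1 - r * μ < 1 := by
    have : 0 < r * μ := by positivity
    linarith
  set S : K → K := fun y => ⟨proj K (y.1 - r • φ y.1), proj_mem hne hcl hcv _⟩ with hS
  have hcontr : ContractingWith (Real.toNNReal √(1 - r * μ)) S := by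
    refine ⟨?_, LipschitzWith.of_dist_le_mul fun y y' => ?_⟩
    · rw [Real.toNNReal_lt_one, Real.sqrt_lt' one_pos]
      linarith
    · rw [Real.coe_toNNReal _ (Real.sqrt_nonneg _), Subtype.dist_eq, Subtype.dist_eq]
      refine ((lipschitzWith_proj hne hcl hcv).dist_le_mul _ _).trans ?_
      rw [NNReal.coe_one, one_mul, dist_eq_norm, dist_eq_norm]
      have e : y.1 - r • φ y.1 - (y'.1 - r • φ y'.1) = (y.1 - y'.1) - r • (φ y.1 - φ y'.1) := by
        module
      have h1 := hmono y y.2 y' y'.2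
      have h2 : ‖φ y.1 - φ y'.1‖ ≤ l * ‖y.1 - y'.1‖ := by
        have := hL.dist_le_mul y y.2 y' y'.2
        rw [dist_eq_norm, dist_eq_norm] at this
        refine this.trans ?_
        gcongr
        rw [hl]
        linarith
      rw [e]
      have h3 : ‖(y.1 - y'.1) - r • (φ y.1 - φ y'.1)‖ ^ 2 ≤ (1 - r * μ) * ‖y.1 - y'.1‖ ^ 2 := by
        rw [norm_sub_sq_real, inner_smul_right, real_inner_comm, norm_smul,
          Real.norm_of_nonneg hrpos.le, mul_pow]
        have h4 : r ^ 2 * ‖φ y.1 - φ y'.1‖ ^ 2 ≤ r ^ 2 * (l * ‖y.1 - y'.1‖) ^ 2 := by gcongr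
        have h5 : r ^ 2 * (l * ‖y.1 - y'.1‖) ^ 2 = r * μ * ‖y.1 - y'.1‖ ^ 2 := by
          rw [mul_pow, ← mul_assoc, hrl]
        have h6 := mul_le_mul_of_nonneg_left h1 hrpos.le
        linarith
      rw [← Real.sqrt_sq (norm_nonneg (y.1 - y'.1)), ← Real.sqrt_mul' _ (sq_nonneg _)]
      exact Real.le_sqrt_of_sq_le h3
  have : CompleteSpace K := hcl.isComplete.completeSpace_coe
  have : Nonempty K := hne.to_subtype
  obtain ⟨y, hy⟩ : ∃ y, S y = y := ⟨_, hcontr.fixedPoint_isFixedPt⟩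
  refine ⟨y, y.2, fun q hq => ?_⟩
  have h1 := inner_sub_proj_le hne hcl hcv (y.1 - r • φ y.1) hq
  have h2 : proj K (y.1 - r • φ y.1) = y.1 := congrArg Subtype.val hy
  rw [h2, sub_sub_cancel_left, inner_neg_left, inner_smul_left] at h1
  simp only [conj_trivial] at h1
  by_contra h3
  have := mul_pos_of_neg_of_neg (not_le.1 h3) (neg_lt_zero.2 hrpos)
  linarith

end Projection

/-! ### Calculus of mean bounds -/

section MeanBound

variable {Ω : Type*} [MeasurableSpace Ω] {P : Measure Ω}

/-- `f` is integrable with mean at most `c`. -/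
def MeanLE (P : Measure Ω) (f : Ω → ℝ) (c : ℝ) : Prop := Integrable f P ∧ ∫ ω, f ω ∂P ≤ c

namespace MeanLE

variable {f g : Ω → ℝ} {a b c : ℝ}

theorem add (hf : MeanLE P f a) (hg : MeanLE P g b) : MeanLE P (fun ω => f ω + g ω) (a + b) :=
  ⟨hf.1.add hg.1, by
    rw [integral_add hf.1 hg.1]
    exact add_le_add hf.2 hg.2⟩

theorem const_mul (hf : MeanLE P f a) (hc : 0 ≤ c) : MeanLE P (fun ω => c * f ω) (c * a) :=
  ⟨hf.1.const_mul c, by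
    rw [integral_const_mul]
    exact mul_le_mul_of_nonneg_left hf.2 hc⟩

theorem const [IsProbabilityMeasure P] (c : ℝ) : MeanLE P (fun _ => c) c :=
  ⟨integrable_const c, by simp⟩

theorem trans (hf : MeanLE P f a) (h : a ≤ b) : MeanLE P f b := ⟨hf.1, hf.2.trans h⟩

theorem sum {κ : Type*} {s : Finset κ} {f : κ → Ω → ℝ} {a : κ → ℝ}
    (h : ∀ j ∈ s, MeanLE P (f j) (a j)) :
    MeanLE P (fun ω => ∑ j ∈ s, f j ω) (∑ j ∈ s, a j) :=
  ⟨integrable_finsetSum _ fun j hj => (h j hj).1, by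
    rw [integral_finsetSum _ fun j hj => (h j hj).1]
    exact Finset.sum_le_sum fun j hj => (h j hj).2⟩

theorem mono (hg : MeanLE P g a) (hf : AEStronglyMeasurable f P) (h0 : ∀ᵐ ω ∂P, 0 ≤ f ω)
    (h : ∀ᵐ ω ∂P, f ω ≤ g ω) : MeanLE P f a := by
  have hfi : Integrable f P := by
    refine hg.1.mono' hf ?_
    filter_upwards [h0, h] with ω h1 h2
    rwa [Real.norm_of_nonneg h1]
  exact ⟨hfi, (integral_mono_ae hfi hg.1 h).trans hg.2⟩

/-- Jensen's inequality, from nonnegativity of the variance. -/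
theorem of_sq [IsProbabilityMeasure P] (hf : AEStronglyMeasurable f P)
    (h : MeanLE P (fun ω => f ω ^ 2) a) : MeanLE P f (√a) := by
  have h2 : MemLp f 2 P := (memLp_two_iff_integrable_sq hf).2 h.1
  have hi : Integrable f P := h2.integrable one_le_two
  refine ⟨hi, Real.le_sqrt_of_sq_le ?_⟩
  set m := ∫ ω, f ω ∂P with hm
  have h3 : 0 ≤ ∫ ω, (f ω - m) ^ 2 ∂P := integral_nonneg fun ω => sq_nonneg _
  have h4 : ∀ ω, (f ω - m) ^ 2 = f ω ^ 2 - (2 * m) * f ω + m ^ 2 := fun ω => by ring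
  simp_rw [h4] at h3
  have hi1 : Integrable (fun ω => f ω ^ 2 - 2 * m * f ω) P := h.1.sub (hi.const_mul _)
  rw [integral_add hi1 (integrable_const _),
    integral_sub h.1 (hi.const_mul _), integral_const_mul, ← hm] at h3
  simp only [integral_const, probReal_univ, smul_eq_mul, one_mul] at h3
  nlinarith [h.2]

end MeanLE

end MeanBound

/-! ### Orthogonal sums in `L²` -/

section Orthogonal

variable {Ω : Type*} [MeasurableSpace Ω] {P : Measure Ω}
  {E : Type*} [NormedAddCommGroup E] [InnerProductSpace ℝ E]

theorem integrable_inner_of_memLp {f g : Ω → E} (hf : MemLp f 2 P) (hg : MemLp g 2 P) :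
    Integrable (fun ω => inner ℝ (f ω) (g ω)) P := by
  have h1 := (memLp_two_iff_integrable_sq_norm hf.1).1 hf
  have h2 := (memLp_two_iff_integrable_sq_norm hg.1).1 hg
  refine (h1.add h2).mono' (hf.1.inner hg.1) (Filter.Eventually.of_forall fun ω => ?_)
  refine (norm_inner_le_norm _ _).trans ?_
  simp only [Pi.add_apply]
  nlinarith [sq_nonneg (‖f ω‖ - ‖g ω‖), sq_nonneg (‖f ω‖), sq_nonneg (‖g ω‖)]

/-- Pythagoras: the cross terms vanish, so second moments add. For this reason `T²` noise terms
contribute only order `T`. -/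
theorem meanLE_norm_sum_sq {κ : Type*} (s : Finset κ) {N : κ → Ω → E} {B : ℝ}
    (hN : ∀ j ∈ s, MemLp (N j) 2 P)
    (hB : ∀ j ∈ s, ∫ ω, ‖N j ω‖ ^ 2 ∂P ≤ B)
    (horth : ∀ j ∈ s, ∀ l ∈ s, j ≠ l → ∫ ω, inner ℝ (N j ω) (N l ω) ∂P = 0) :
    MeanLE P (fun ω => ‖∑ j ∈ s, N j ω‖ ^ 2) (s.card * B) := by
  classical
  have hsum : ∀ t ⊆ s, MemLp (fun ω => ∑ j ∈ t, N j ω) 2 P := fun t ht =>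
    memLp_finsetSum t fun j hj => hN j (ht hj)
  refine ⟨(memLp_two_iff_integrable_sq_norm (hsum s subset_rfl).1).1 (hsum s subset_rfl), ?_⟩
  suffices h : ∀ t ⊆ s, ∫ ω, ‖∑ j ∈ t, N j ω‖ ^ 2 ∂P ≤ t.card * B from h s subset_rfl
  intro t
  induction t using Finset.induction_on with
  | empty => simp
  | insert a t ha ih =>
    intro hs
    have hat : t ⊆ s := (Finset.subset_insert a t).trans hs
    have has : a ∈ s := hs (Finset.mem_insert_self a t)
    have h1 := (memLp_two_iff_integrable_sq_norm (hsum t hat).1).1 (hsum t hat)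
    have h2 := (memLp_two_iff_integrable_sq_norm (hN a has).1).1 (hN a has)
    have h3 := integrable_inner_of_memLp (hN a has) (hsum t hat)
    have h4 : ∫ ω, inner ℝ (N a ω) (∑ j ∈ t, N j ω) ∂P = 0 := by
      simp_rw [inner_sum]
      rw [integral_finsetSum _ fun j hj => integrable_inner_of_memLp (hN a has) (hN j (hat hj))]
      refine Finset.sum_eq_zero fun j hj => horth a has j (hat hj) ?_
      rintro rfl
      exact ha hj
    simp_rw [Finset.sum_insert ha, norm_add_sq_real]
    have h5 : Integrable (fun ω => ‖N a ω‖ ^ 2 + 2 * inner ℝ (N a ω) (∑ j ∈ t, N j ω)) P :=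
      h2.add (h3.const_mul 2)
    rw [integral_add h5 h1, integral_add h2 (h3.const_mul 2),
      integral_const_mul, h4, Finset.card_insert_of_notMem ha]
    push_cast
    linarith [ih hat, hB a has]

end Orthogonal

/-! ### Conditioning on the past, and mini-batches -/

section Fresh

variable {Ω A Z E : Type*} {𝒢 mΩ : MeasurableSpace Ω} [MeasurableSpace A] [MeasurableSpace Z]
  {P : Measure Ω} [IsProbabilityMeasure P]
  {X : Ω → A} {ζ : Ω → Z} {ν : Measure Z}

/-- `ζ` is a sample from `ν` that is independent of the information `𝒢`. -/
structure FreshSample {mΩ : MeasurableSpace Ω} (P : Measure Ω) (𝒢 : MeasurableSpace Ω) (ζ : Ω → Z) (ν : Measure Z) :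
    Prop where
  le : 𝒢 ≤ mΩ
  measurable : Measurable[mΩ] ζ
  law : @Measure.map Ω Z mΩ _ ζ P = ν
  indep : Indep (MeasurableSpace.comap ζ inferInstance) 𝒢 P

namespace FreshSample

theorem isProbabilityMeasure (h : FreshSample P 𝒢 ζ ν) : IsProbabilityMeasure ν := by
  rw [← h.law]
  exact Measure.isProbabilityMeasure_map h.measurable.aemeasurable

/-- Independence makes the joint law a product, so conditioning on the past becomes Fubini's theorem
with the past variable frozen. -/
theorem map_prod (h : FreshSample P 𝒢 ζ ν) (hX : Measurable[𝒢] X) :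
    P.map (fun ω => (X ω, ζ ω)) = (P.map X).prod ν := by
  have hX' : Measurable X := hX.mono h.le le_rfl
  have hind : IndepFun X ζ P := by
    rw [IndepFun_iff_Indep]
    exact (indep_of_indep_of_le_right h.indep hX.comap_le).symm
  rw [← h.law]
  exact (indepFun_iff_map_prod_eq_prod_map_map hX'.aemeasurable h.measurable.aemeasurable).1 hind

omit [IsProbabilityMeasure P] in
theorem ae (h : FreshSample P 𝒢 ζ ν) {p : Z → Prop} (hp : ∀ᵐ z ∂ν, p z) :
    ∀ᵐ ω ∂P, p (ζ ω) := by
  rw [← h.law] at hp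
  exact ae_of_ae_map h.measurable.aemeasurable hp

theorem lintegral (h : FreshSample P 𝒢 ζ ν) (hX : Measurable[𝒢] X) {Φ : A × Z → ℝ≥0∞}
    (hΦ : Measurable Φ) :
    ∫⁻ ω, Φ (X ω, ζ ω) ∂P = ∫⁻ ω, ∫⁻ z, Φ (X ω, z) ∂ν ∂P := by
  have := h.isProbabilityMeasure
  have hX' : Measurable X := hX.mono h.le le_rfl
  rw [← lintegral_map (f := Φ) hΦ (hX'.prodMk h.measurable), h.map_prod hX,
    lintegral_prod _ hΦ.aemeasurable, lintegral_map hΦ.lintegral_prod_right' hX']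

theorem integral [NormedAddCommGroup E] [NormedSpace ℝ E] (h : FreshSample P 𝒢 ζ ν)
    (hX : Measurable[𝒢] X) {Φ : A × Z → E} (hΦ : StronglyMeasurable Φ)
    (hi : Integrable (fun ω => Φ (X ω, ζ ω)) P) :
    ∫ ω, Φ (X ω, ζ ω) ∂P = ∫ ω, ∫ z, Φ (X ω, z) ∂ν ∂P := by
  have := h.isProbabilityMeasure
  have hX' : Measurable X := hX.mono h.le le_rfl
  have := Measure.isProbabilityMeasure_map (μ := P) hX'.aemeasurable
  have hm : Measurable fun ω => (X ω, ζ ω) := hX'.prodMk h.measurable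
  have hi' : Integrable Φ ((P.map X).prod ν) := by
    rw [← h.map_prod hX]
    exact (integrable_map_measure hΦ.aestronglyMeasurable hm.aemeasurable).2 hi
  rw [← integral_map (f := Φ) hm.aemeasurable hΦ.aestronglyMeasurable, h.map_prod hX,
    integral_prod _ hi',
    integral_map hX'.aemeasurable hΦ.integral_prod_right'.aestronglyMeasurable]

/-- The bound `G` on the conditional mean may itself be random. The argument goes through
`lintegral`, so that integrability of the composition is a conclusion and not a hypothesis. -/
theorem meanLE (h : FreshSample P 𝒢 ζ ν) (hX : Measurable[𝒢] X) {Φ : A × Z → ℝ}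
    (hΦ : Measurable Φ) (h0 : ∀ q, 0 ≤ Φ q) {G : Ω → ℝ} {c : ℝ} (hG : MeanLE P G c)
    (hΦG : ∀ᵐ ω ∂P, MeanLE ν (fun z => Φ (X ω, z)) (G ω)) :
    MeanLE P (fun ω => Φ (X ω, ζ ω)) c := by
  have hX' : Measurable X := hX.mono h.le le_rfl
  have hm : Measurable fun ω => Φ (X ω, ζ ω) := hΦ.comp (hX'.prodMk h.measurable)
  have hG0 : ∀ᵐ ω ∂P, 0 ≤ G ω := by
    filter_upwards [hΦG] with ω hω using (integral_nonneg fun z => h0 _).trans hω.2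
  have key : ∫⁻ ω, ENNReal.ofReal (Φ (X ω, ζ ω)) ∂P ≤ ENNReal.ofReal (∫ ω, G ω ∂P) := by
    rw [h.lintegral (Φ := fun q => ENNReal.ofReal (Φ q)) hX hΦ.ennreal_ofReal,
      ofReal_integral_eq_lintegral_ofReal hG.1 hG0]
    refine lintegral_mono_ae ?_
    filter_upwards [hΦG] with ω hω
    rw [← ofReal_integral_eq_lintegral_ofReal hω.1 (Filter.Eventually.of_forall fun z => h0 _)]
    exact ENNReal.ofReal_le_ofReal hω.2
  have hi : Integrable (fun ω => Φ (X ω, ζ ω)) P := by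
    refine ⟨hm.aestronglyMeasurable, ?_⟩
    rw [hasFiniteIntegral_iff_ofReal (Filter.Eventually.of_forall fun ω => h0 _)]
    exact key.trans_lt ENNReal.ofReal_lt_top
  refine ⟨hi, le_trans ?_ hG.2⟩
  rw [integral_eq_lintegral_of_nonneg_ae (Filter.Eventually.of_forall fun ω => h0 _)
    hm.aestronglyMeasurable]
  exact ENNReal.toReal_le_of_le_ofReal (integral_nonneg_of_ae hG0) key

variable [NormedAddCommGroup E] [InnerProductSpace ℝ E] [CompleteSpace E] [MeasurableSpace E]
  [BorelSpace E] [SecondCountableTopology E]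

omit [InnerProductSpace ℝ E] [CompleteSpace E] in
theorem memLp_two (h : FreshSample P 𝒢 ζ ν) (hX : Measurable[𝒢] X) {Ψ : A × Z → E}
    (hΨ : Measurable Ψ) {B : ℝ}
    (hB : ∀ᵐ ω ∂P, MeanLE ν (fun z => ‖Ψ (X ω, z)‖ ^ 2) B) :
    MemLp (fun ω => Ψ (X ω, ζ ω)) 2 P ∧ ∫ ω, ‖Ψ (X ω, ζ ω)‖ ^ 2 ∂P ≤ B := by
  have h1 := h.meanLE (Φ := fun q => ‖Ψ q‖ ^ 2) hX (hΨ.norm.pow_const 2) (fun q => by positivity)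
    (MeanLE.const B) hB
  have hX' : Measurable X := hX.mono h.le le_rfl
  exact ⟨(memLp_two_iff_integrable_sq_norm
    (hΨ.comp (hX'.prodMk h.measurable)).aestronglyMeasurable).2 h1.1, h1.2⟩

/-- A centered function of a fresh sample is orthogonal to everything known before. Enlarging the
past variable to the pair of `X` and `Q` leaves, once it is frozen, a linear functional of `Ψ`. -/
theorem integral_inner_eq_zero (h : FreshSample P 𝒢 ζ ν) (hX : Measurable[𝒢] X) {Ψ : A × Z → E}
    (hΨ : Measurable Ψ) (hN : MemLp (fun ω => Ψ (X ω, ζ ω)) 2 P)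
    (hint : ∀ᵐ ω ∂P, Integrable (fun z => Ψ (X ω, z)) ν)
    (hzero : ∀ᵐ ω ∂P, ∫ z, Ψ (X ω, z) ∂ν = 0)
    {Q : Ω → E} (hQ : Measurable[𝒢] Q) (hQ2 : MemLp Q 2 P) :
    ∫ ω, inner ℝ (Ψ (X ω, ζ ω)) (Q ω) ∂P = 0 := by
  have hm : Measurable (fun q : (A × E) × Z => (inner ℝ (Ψ (q.1.1, q.2)) q.1.2 : ℝ)) := by
    fun_prop
  have h1 := h.integral (X := fun ω => (X ω, Q ω)) (hX.prodMk hQ)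
    (Φ := fun q : (A × E) × Z => (inner ℝ (Ψ (q.1.1, q.2)) q.1.2 : ℝ)) hm.stronglyMeasurable
    (integrable_inner_of_memLp hN hQ2)
  rw [h1]
  refine integral_eq_zero_of_ae ?_
  filter_upwards [hint, hzero] with ω h2 h3
  have h4 : ∀ z, inner ℝ (Ψ (X ω, z)) (Q ω) = (inner ℝ (Q ω) (Ψ (X ω, z)) : ℝ) :=
    fun z => real_inner_comm _ _
  simp_rw [h4]
  rw [integral_inner h2, h3, inner_zero_right]
  rfl

end FreshSample

/-- Square integrable centered functions of i.i.d. samples are orthogonal. -/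
theorem meanLE_norm_iid_sum_sq [NormedAddCommGroup E] [InnerProductSpace ℝ E] [CompleteSpace E]
    [MeasurableSpace E] [BorelSpace E] [SecondCountableTopology E] {b : ℕ} {ξ : Fin b → Ω → Z}
    (hξ : ∀ s, Measurable (ξ s)) (hlaw : ∀ s, P.map (ξ s) = ν) (hiid : iIndepFun ξ P)
    {ψ : Z → E} (hψ : Measurable ψ) (hψ2 : MemLp ψ 2 ν) (hzero : ∫ z, ψ z ∂ν = 0) {B : ℝ}
    (hB : ∫ z, ‖ψ z‖ ^ 2 ∂ν ≤ B) :
    MeanLE P (fun ω => ‖∑ s, ψ (ξ s ω)‖ ^ 2) (b * B) := by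
  have hmem : ∀ s, MemLp (fun ω => ψ (ξ s ω)) 2 P := fun s => by
    refine (memLp_map_measure_iff (g := ψ) ?_ (hξ s).aemeasurable).1 ?_
    · exact hψ.aestronglyMeasurable
    · rwa [hlaw s]
  have hmean : ∀ s, ∫ ω, ψ (ξ s ω) ∂P = 0 := fun s => by
    rw [← integral_map (f := ψ) (hξ s).aemeasurable hψ.aestronglyMeasurable, hlaw s, hzero]
  have := meanLE_norm_sum_sq (Finset.univ : Finset (Fin b)) (N := fun s ω => ψ (ξ s ω)) (B := B)
    (fun s _ => hmem s) (fun s _ => ?_) (fun s _ s' _ hss' => ?_)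
  · simpa using this
  · rw [← integral_map (f := fun z => ‖ψ z‖ ^ 2) (hξ s).aemeasurable
      (hψ.norm.pow_const 2).aestronglyMeasurable, hlaw s]
    exact hB
  · have hind : IndepFun (fun ω => ψ (ξ s ω)) (fun ω => ψ (ξ s' ω)) P :=
      (hiid.indepFun hss').comp hψ hψ
    have := hind.integral_bilin ((hmem s).integrable one_le_two) ((hmem s').integrable one_le_two)
      (innerSL ℝ)
    rw [hmean, hmean] at this
    simp only [map_zero] at this
    exact this

/-- The mean of a mini-batch of centered functions of fresh i.i.d. samples. -/
theorem meanLE_norm_batch [NormedAddCommGroup E] [InnerProductSpace ℝ E] [CompleteSpace E]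
    [MeasurableSpace E] [BorelSpace E] [SecondCountableTopology E] [SFinite ν] {b : ℕ}
    (hb : 0 < b) {ξ : Fin b → Ω → Z} (h𝒢 : 𝒢 ≤ mΩ)
    (hξ : ∀ s, Measurable (ξ s)) (hlaw : ∀ s, P.map (ξ s) = ν) (hiid : iIndepFun ξ P)
    (hfresh : Indep (MeasurableSpace.comap (fun ω s => ξ s ω) inferInstance) 𝒢 P)
    (hX : Measurable[𝒢] X) {Ψ : A × Z → E} (hΨ : Measurable Ψ)
    (hΨ2 : ∀ᵐ ω ∂P, MemLp (fun z => Ψ (X ω, z)) 2 ν)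
    (hzero : ∀ᵐ ω ∂P, ∫ z, Ψ (X ω, z) ∂ν = 0) {B : ℝ} (hB0 : 0 ≤ B)
    (hB : ∀ᵐ ω ∂P, ∫ z, ‖Ψ (X ω, z)‖ ^ 2 ∂ν ≤ B ^ 2) :
    MeanLE P (fun ω => ‖(b : ℝ)⁻¹ • ∑ s, Ψ (X ω, ξ s ω)‖) (B / √b) := by
  have hvec : Measurable fun ω s => ξ s ω := measurable_pi_lambda _ hξ
  -- The whole batch is treated as one fresh sample with values in `Fin b → Z`. With `X` frozen, the
  -- summands are i.i.d. and centered, so the sum has second moment at most `b * B ^ 2` and the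
  -- average at most `B ^ 2 / b`.
  have hF : FreshSample P 𝒢 (fun ω s => ξ s ω) (P.map fun ω s => ξ s ω) := ⟨h𝒢, hvec, rfl, hfresh⟩
  have hΦ : Measurable fun q : A × (Fin b → Z) => ‖(b : ℝ)⁻¹ • ∑ s, Ψ (q.1, q.2 s)‖ ^ 2 := by
    refine Measurable.pow_const (Measurable.norm ?_) 2
    refine Measurable.const_smul (Finset.measurable_sum _ fun s _ => ?_) _
    exact hΨ.comp (measurable_fst.prodMk ((measurable_pi_apply s).comp measurable_snd))
  have hb' : (0 : ℝ) < b := by exact_mod_cast hb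
  have hsq := hF.meanLE hX hΦ (fun q => by positivity) (MeanLE.const (B ^ 2 / b)) (by
    filter_upwards [hΨ2, hzero, hB] with ω h1 h2 h3
    have h4 := meanLE_norm_iid_sum_sq hξ hlaw hiid
      (hΨ.comp (measurable_const.prodMk measurable_id)) h1 h2 h3
    have hmm : Measurable fun zz : Fin b → Z => ‖∑ s, Ψ (X ω, zz s)‖ ^ 2 := by
      refine Measurable.pow_const (Measurable.norm ?_) 2
      refine Finset.measurable_sum _ fun s _ => ?_
      exact hΨ.comp (measurable_const.prodMk (measurable_pi_apply s))
    have h5 : MeanLE (P.map fun ω s => ξ s ω)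
        (fun zz : Fin b → Z => ‖∑ s, Ψ (X ω, zz s)‖ ^ 2) (b * B ^ 2) := by
      refine ⟨(integrable_map_measure hmm.aestronglyMeasurable hvec.aemeasurable).2 h4.1, ?_⟩
      rw [integral_map hvec.aemeasurable hmm.aestronglyMeasurable]
      exact h4.2
    have h6 := h5.const_mul (c := (b : ℝ)⁻¹ ^ 2) (by positivity)
    simp only [norm_smul, mul_pow, Real.norm_of_nonneg (inv_nonneg.2 hb'.le)]
    refine h6.trans (le_of_eq ?_)
    field_simp)
  have hX' : Measurable X := hX.mono h𝒢 le_rfl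
  have hmeas : Measurable fun ω => ‖(b : ℝ)⁻¹ • ∑ s, Ψ (X ω, ξ s ω)‖ := by
    refine Measurable.norm ?_
    refine Measurable.const_smul (Finset.measurable_sum _ fun s _ => ?_) _
    exact hΨ.comp (hX'.prodMk (hξ s))
  refine (MeanLE.of_sq hmeas.aestronglyMeasurable hsq).trans (le_of_eq ?_)
  rw [Real.sqrt_div' _ hb'.le, Real.sqrt_sq hB0]

end Fresh

/-! ### Pathwise regret of the extragradient recursion -/

section PathBound

variable {E : Type*} [NormedAddCommGroup E] [InnerProductSpace ℝ E] [CompleteSpace E] {K : Set E}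

/-- The three point inequality for a projected step. -/
theorem norm_proj_sub_sq_le (hne : K.Nonempty) (hcl : IsClosed K) (hcv : Convex ℝ K)
    (p a : E) {z : E} (hz : z ∈ K) :
    ‖proj K (p - a) - z‖ ^ 2 ≤
      ‖p - z‖ ^ 2 - ‖proj K (p - a) - p‖ ^ 2 - 2 * inner ℝ a (proj K (p - a) - z) := by
  have h := inner_sub_proj_le hne hcl hcv (p - a) hz
  set q := proj K (p - a)
  have e1 : inner ℝ (p - a - q) (z - q) =
      - inner ℝ (p - q) (q - z) + inner ℝ a (q - z) := by
    rw [← inner_neg_left, ← inner_add_left, ← neg_sub q z, inner_neg_right, ← inner_neg_left]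
    congr 1
    abel
  have e2 : ‖p - z‖ ^ 2 = ‖p - q‖ ^ 2 + 2 * inner ℝ (p - q) (q - z) + ‖q - z‖ ^ 2 := by
    rw [← norm_add_sq_real]
    congr 2
    abel
  rw [norm_sub_rev q p]
  linarith

/-- Regret of the extragradient recursion `p (j + 1) = Π (p j - γ (e j + g (j + 1)))`, where the
corrections `e` are perturbations of `e'`. -/
theorem extragradient_regret (hne : K.Nonempty) (hcl : IsClosed K) (hcv : Convex ℝ K)
    {γ : ℝ} (hγ : 0 < γ) {J : ℕ} {p g e e' : ℕ → E} {r : ℕ → ℝ} {x₀ z : E}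
    (hz : z ∈ K) (hp0 : p 0 = proj K (x₀ - γ • g 0))
    (hp : ∀ j, j + 1 < J → p (j + 1) = proj K (p j - γ • (e j + g (j + 1))))
    (hr : ∀ j < J, ∀ q ∈ K, |inner ℝ (e j - e' j) (q - z)| ≤ r j) (hJ : 0 < J) :
    2 * γ * ∑ j ∈ Finset.range J, inner ℝ (g j + e' j) (p j - z) ≤
      ‖x₀ - z‖ ^ 2 + γ ^ 2 * ∑ j ∈ Finset.range J, ‖e' j‖ ^ 2
        + 2 * γ * ∑ j ∈ Finset.range J, r j := by
  have hmem : ∀ j < J, p j ∈ K := by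
    intro j hj
    cases j with
    | zero => rw [hp0]; exact proj_mem hne hcl hcv _
    | succ j => rw [hp j hj]; exact proj_mem hne hcl hcv _
  -- The inner product with `g j` is paid for by the projection that produces `p j`, the one with
  -- `e' j` only by the next projection. The invariant therefore carries the term of `g j` outside
  -- the sum.
  have key : ∀ j < J, ‖p j - z‖ ^ 2 + 2 * γ * inner ℝ (g j) (p j - z) +
      2 * γ * ∑ l ∈ Finset.range j, inner ℝ (g l + e' l) (p l - z) ≤
      ‖x₀ - z‖ ^ 2 + γ ^ 2 * ∑ l ∈ Finset.range j, ‖e' l‖ ^ 2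
        + 2 * γ * ∑ l ∈ Finset.range j, r l := by
    intro j
    induction j with
    | zero =>
      intro _
      have h := norm_proj_sub_sq_le hne hcl hcv x₀ (γ • g 0) hz
      rw [← hp0, inner_smul_left] at h
      simp only [conj_trivial] at h
      simp only [Finset.range_zero, Finset.sum_empty, mul_zero, add_zero]
      nlinarith [sq_nonneg ‖p 0 - x₀‖]
    | succ j ih =>
      intro hj
      have ih := ih (by omega)
      have h := norm_proj_sub_sq_le hne hcl hcv (p j) (γ • (e j + g (j + 1))) hz
      rw [← hp j hj, inner_smul_left] at h
      simp only [conj_trivial] at h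
      have h1 := hr j (by omega) _ (hmem (j + 1) hj)
      have h2 : inner ℝ (e j + g (j + 1)) (p (j + 1) - z) =
          inner ℝ (e j - e' j) (p (j + 1) - z) + inner ℝ (e' j) (p (j + 1) - p j) +
            inner ℝ (e' j) (p j - z) + inner ℝ (g (j + 1)) (p (j + 1) - z) := by
        simp only [inner_add_left, inner_sub_left, inner_sub_right]
        ring
      -- Completing the square: the squared displacement in the three point inequality absorbs the
      -- inner product of `e' j` with `p (j + 1) - p j`, at the price `γ ^ 2 * ‖e' j‖ ^ 2`.
      have h3 : 0 ≤ ‖(p (j + 1) - p j) + γ • e' j‖ ^ 2 := sq_nonneg _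
      rw [norm_add_sq_real, inner_smul_right, real_inner_comm, norm_smul,
        Real.norm_of_nonneg hγ.le, mul_pow] at h3
      rw [Finset.sum_range_succ, Finset.sum_range_succ, Finset.sum_range_succ, inner_add_left]
      rw [h2] at h
      have h4 := (abs_le.1 h1).1
      nlinarith
  obtain ⟨j, rfl⟩ : ∃ j, J = j + 1 := ⟨J - 1, by omega⟩
  have h := key j (by omega)
  have h1 := hr j (by omega) _ (hmem j (by omega))
  have h2 : 0 ≤ r j := (abs_nonneg _).trans h1
  -- No projection follows the last step, so the leftover `‖p j - z‖ ^ 2` of the invariant pays for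
  -- the last `e' j`.
  have h3 : 0 ≤ ‖(p j - z) - γ • e' j‖ ^ 2 := sq_nonneg _
  rw [norm_sub_sq_real, inner_smul_right, real_inner_comm, norm_smul, Real.norm_of_nonneg hγ.le,
    mul_pow] at h3
  rw [Finset.sum_range_succ, Finset.sum_range_succ, Finset.sum_range_succ, inner_add_left]
  have h4 := mul_nonneg hγ.le h2
  nlinarith

end PathBound

/-- A double sum over rounds and steps as a sum over one index. -/
theorem sum_range_mul_div_mod {A : Type*} [AddCommMonoid A] (T K : ℕ) (f : ℕ → ℕ → A) (hK : 0 < K) :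
    ∑ j ∈ Finset.range (T * K), f (j / K) (j % K) =
      ∑ t ∈ Finset.range T, ∑ k ∈ Finset.range K, f t k := by
  induction T with
  | zero => simp
  | succ T ih =>
    rw [Nat.succ_mul, Finset.sum_range_add, ih, Finset.sum_range_succ]
    congr 1
    refine Finset.sum_congr rfl fun k hk => ?_
    have hk' := Finset.mem_range.1 hk
    rw [Nat.mul_comm T K, Nat.mul_add_div hK, Nat.div_eq_of_lt hk', Nat.mul_add_mod,
      Nat.mod_eq_of_lt hk', Nat.add_zero]

/-! ### Product structure of the space of profiles -/

section Profiles

variable {ι : Type*} {n : ι → ℕ}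

theorem measurable_profile {Ω : Type*} {m : MeasurableSpace Ω} {f : Ω → Profile n}
    (hf : ∀ i, Measurable fun ω => f ω i) : Measurable f := by
  have h1 : Measurable fun ω => (WithLp.ofLp (f ω)) := measurable_pi_lambda _ hf
  exact (WithLp.measurable_toLp 2 _).comp h1

theorem isClosed_prodSet {A : ∀ i, Set (Vec (n i))} (hA : ∀ i, IsClosed (A i)) :
    IsClosed (Game.prodSet A) := by
  have : Game.prodSet A = ⋂ i, (fun x : Profile n => x i) ⁻¹' A i := by
    ext x
    simp [Game.prodSet]
  rw [this]
  exact isClosed_iInter fun i => (hA i).preimage (PiLp.continuous_apply 2 _ i)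

theorem convex_prodSet {A : ∀ i, Set (Vec (n i))} (hA : ∀ i, Convex ℝ (A i)) :
    Convex ℝ (Game.prodSet A) := fun _ hx _ hy _ _ ha hb hab i =>
  hA i (hx i) (hy i) ha hb hab

theorem nonempty_prodSet {A : ∀ i, Set (Vec (n i))} (hA : ∀ i, (A i).Nonempty) :
    (Game.prodSet A).Nonempty :=
  ⟨WithLp.toLp 2 fun i => (hA i).some, fun i => (hA i).some_mem⟩

variable [Fintype ι]

theorem norm_apply_le (x : Profile n) (i : ι) : ‖x i‖ ≤ ‖x‖ := PiLp.norm_apply_le x i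

theorem norm_sq_eq_sum (x : Profile n) : ‖x‖ ^ 2 = ∑ i, ‖x i‖ ^ 2 :=
  PiLp.norm_sq_eq_of_L2 _ x

theorem norm_le_sum (x : Profile n) : ‖x‖ ≤ ∑ i, ‖x i‖ := by
  refine abs_le_of_sq_le_sq' ?_ (Finset.sum_nonneg fun i _ => norm_nonneg _) |>.2
  rw [norm_sq_eq_sum]
  exact Finset.sum_sq_le_sq_sum_of_nonneg fun i _ => norm_nonneg _

theorem inner_eq_sum (x y : Profile n) : inner ℝ x y = ∑ i, inner ℝ (x i) (y i) :=
  PiLp.inner_apply x y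

theorem measurable_profile_apply (i : ι) : Measurable fun x : Profile n => x i :=
  (PiLp.continuous_apply 2 _ i).measurable

end Profiles

/-! ### Bounds for the exact finite difference -/

section FiniteDifference

variable {d : ℕ}

/-- The exact finite difference `n w (h(x + δ w) - h(x)) / δ`. -/
noncomputable def sphDiff (h : Vec d → ℝ) (δ : ℝ) (x w : Vec d) : Vec d :=
  ((d : ℝ) * ((h (x + δ • w) - h x) / δ)) • w

/-- The mean of the exact finite difference over uniform directions. -/
noncomputable def sphDiffMean (h : Vec d → ℝ) (δ : ℝ) (x : Vec d) : Vec d :=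
  ∫ w, sphDiff h δ x w ∂sphereUniform d

theorem continuous_sphDiff {h : Vec d → ℝ} (hh : Continuous h) (δ : ℝ) :
    Continuous fun q : Vec d × Vec d => sphDiff h δ q.1 q.2 := by
  unfold sphDiff
  fun_prop

theorem norm_sphDiff_le {h : Vec d → ℝ} {L : ℝ≥0} (hh : LipschitzWith L h) {δ : ℝ} (hδ : 0 < δ)
    (x : Vec d) {w : Vec d} (hw : ‖w‖ = 1) : ‖sphDiff h δ x w‖ ≤ d * L := by
  rw [sphDiff, norm_smul, hw, mul_one, Real.norm_eq_abs, abs_mul, abs_div, Nat.abs_cast,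
    abs_of_pos hδ]
  gcongr
  rw [div_le_iff₀ hδ]
  have := hh.dist_le_mul (x + δ • w) x
  rwa [Real.dist_eq, dist_eq_norm, add_sub_cancel_left, norm_smul, hw, mul_one,
    Real.norm_of_nonneg hδ.le] at this

theorem measurable_sphDiffMean {h : Vec d → ℝ} (hh : Continuous h) (δ : ℝ) (hd : 0 < d) :
    Measurable (sphDiffMean h δ) := by
  have := isProbabilityMeasure_sphereUniform hd
  exact ((continuous_sphDiff hh δ).stronglyMeasurable.integral_prod_right').measurable

theorem norm_sphDiffMean_le {h : Vec d → ℝ} {L : ℝ≥0} (hh : LipschitzWith L h) {δ : ℝ} (hδ : 0 < δ)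
    (hd : 0 < d) (x : Vec d) : ‖sphDiffMean h δ x‖ ≤ d * L := by
  have := isProbabilityMeasure_sphereUniform hd
  have h1 := norm_integral_le_of_norm_le_const (μ := sphereUniform d) (f := sphDiff h δ x)
    (C := d * L) (by
      filter_upwards [ae_norm_sphereUniform d] with w hw using norm_sphDiff_le hh hδ x hw)
  simpa [sphDiffMean] using h1

end FiniteDifference

/-! ### Consequences of the assumptions on the game -/

section LeaderSets

variable {ι : Type*} {n : ι → ℕ} {Ξ : Type*} [MeasurableSpace Ξ] {G : Game n Ξ} {δ₀ : ℝ}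
  {D : ∀ i, Set (Vec (n i))}

theorem Game.LowerLevel.lowerSol_mem (hG : G.LowerLevel D) {i : ι} {x : Vec (n i)} (hx : x ∈ D i) :
    G.lowerSol i x ∈ G.Y i := by
  obtain ⟨μ, hμ, hmono⟩ := hG.stronglyMonotone i x hx
  obtain ⟨L, hL⟩ := hG.lipschitz i x hx
  have h := exists_isVISolution (hG.nonempty i) (hG.closed i) (hG.convex i) hμ hmono hL
  exact (Classical.epsilon_spec h).1

theorem Game.closedBall_subset_enlarged {i : ι} {x : Vec (n i)} (hx : x ∈ G.X i) {δ : ℝ}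
    (hδ : δ ≤ δ₀) : Metric.closedBall x δ ⊆ G.enlarged δ₀ i := by
  intro y hy
  refine ⟨x, hx, y - x, ?_, by simp⟩
  rw [mem_closedBall_zero_iff, ← dist_eq_norm]
  exact (Metric.mem_closedBall.1 hy).trans hδ

theorem Game.subset_enlarged (hδ : 0 ≤ δ₀) (i : ι) : G.X i ⊆ G.enlarged δ₀ i := fun _ hx =>
  Game.closedBall_subset_enlarged hx le_rfl (Metric.mem_closedBall_self hδ)

theorem Game.profiles_subset (hδ : 0 ≤ δ₀) : G.profiles ⊆ Game.prodSet (G.enlarged δ₀) :=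
  fun _ hx i => Game.subset_enlarged hδ i (hx i)

theorem measurable_finiteDiff {Ω : Type*} [MeasurableSpace Ω] {i : ι}
    (hg : Measurable (fun p : Vec (n i) × Vec (G.m i) => G.g i p.1 p.2)) (δ : ℝ)
    {x w : Ω → Vec (n i)} {y y' : Ω → Vec (G.m i)} (hx : Measurable x) (hw : Measurable w)
    (hy : Measurable y) (hy' : Measurable y') :
    Measurable fun ω => G.finiteDiff i δ (x ω) (w ω) (y ω) (y' ω) := by
  have h1 : Measurable fun ω => G.g i (x ω + δ • w ω) (y' ω) :=
    hg.comp ((hx.add (hw.const_smul δ)).prodMk hy')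
  have h2 : Measurable fun ω => G.g i (x ω) (y ω) := hg.comp (hx.prodMk hy)
  exact (((h1.sub h2).div_const δ).const_mul _).smul hw

end LeaderSets

section GameFacts

variable {ι : Type*} [Fintype ι] [DecidableEq ι] {n : ι → ℕ} {Ξ : Type*} [MeasurableSpace Ξ]
  {G : Game n Ξ} {δ₀ : ℝ} {D : ∀ i, Set (Vec (n i))} {C R Lf M : ℝ≥0} {L1 L2 : ι → ℝ≥0}

namespace Game.Standing

variable (hG : G.Standing δ₀ D C R Lf L1 L2)
include hG

theorem nonempty_profiles : G.profiles.Nonempty := nonempty_prodSet hG.nonempty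

theorem isClosed_profiles : IsClosed G.profiles :=
  isClosed_prodSet fun i => (hG.compact i).isClosed

theorem convex_profiles : Convex ℝ G.profiles := convex_prodSet hG.convex

theorem norm_sub_sq_le {x y : Profile n} (hx : x ∈ G.profiles) (hy : y ∈ G.profiles) :
    ‖x - y‖ ^ 2 ≤ Fintype.card ι * (C : ℝ) ^ 2 := by
  rw [norm_sq_eq_sum]
  refine (Finset.sum_le_card_nsmul Finset.univ _ ((C : ℝ) ^ 2) fun i _ => ?_).trans (by simp)
  have := hG.diam i _ (hx i) _ (hy i)
  exact pow_le_pow_left₀ (norm_nonneg _) this 2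

theorem norm_V_sub_le (hδ : 0 ≤ δ₀) {x y : Profile n} (hx : x ∈ G.profiles) (hy : y ∈ G.profiles) :
    ‖G.V x - G.V y‖ ≤ Lf * ‖x - y‖ := by
  have := hG.V_lipschitz.dist_le_mul x (profiles_subset hδ hx) y (profiles_subset hδ hy)
  rwa [dist_eq_norm, dist_eq_norm] at this

end Game.Standing

/-- The mean of the stochastic oracle, which equals `V` on the strategy profiles. -/
noncomputable def Game.meanOracle (G : Game n Ξ) (x : Profile n) : Profile n :=
  ∫ ξ, G.Vhat x ξ ∂G.law

namespace Game.Oracle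

variable (hO : G.Oracle D Lf M)
include hO

theorem meanOracle_eq {x : Profile n} (hx : x ∈ G.profiles) : G.meanOracle x = G.V x :=
  hO.unbiased x hx

theorem measurable_meanOracle [SFinite G.law] : Measurable G.meanOracle :=
  hO.measurable.stronglyMeasurable.integral_prod_right'.measurable

theorem integral_apply [IsFiniteMeasure G.law] {x : Profile n} (hx : x ∈ G.profiles) (i : ι) :
    ∫ ξ, (G.Vhat x ξ) i ∂G.law = (G.meanOracle x) i :=
  ContinuousLinearMap.integral_comp_comm (PiLp.proj 2 (fun i => Vec (n i)) i : _ →L[ℝ] _)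
    ((hO.memLp x hx).integrable one_le_two)

theorem memLp_apply {x : Profile n} (hx : x ∈ G.profiles) (i : ι) :
    MemLp (fun ξ => (G.Vhat x ξ) i) 2 G.law :=
  (hO.memLp x hx).mono ((measurable_profile_apply i).comp
    (hO.measurable.comp measurable_prodMk_left)).aestronglyMeasurable
    (Filter.Eventually.of_forall fun _ => norm_apply_le _ i)

theorem meanLE_variance_apply [IsProbabilityMeasure G.law] {x : Profile n} (hx : x ∈ G.profiles)
    (i : ι) :
    MeanLE G.law (fun ξ => ‖(G.Vhat x ξ) i - (G.meanOracle x) i‖ ^ 2) ((M : ℝ) ^ 2) := by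
  have h1 : MemLp (fun ξ => G.Vhat x ξ - G.V x) 2 G.law := (hO.memLp x hx).sub (memLp_const _)
  have h2 : MeanLE G.law (fun ξ => ‖G.Vhat x ξ - G.V x‖ ^ 2) ((M : ℝ) ^ 2) :=
    ⟨(memLp_two_iff_integrable_sq_norm h1.1).1 h1, hO.variance x hx⟩
  refine h2.mono ?_ (Filter.Eventually.of_forall fun _ => by positivity)
    (Filter.Eventually.of_forall fun ξ => ?_)
  · exact (((hO.memLp_apply hx i).sub (memLp_const _)).1.norm.pow 2)
  · rw [hO.meanOracle_eq hx]
    exact pow_le_pow_left₀ (norm_nonneg _) (norm_apply_le (G.Vhat x ξ - G.V x) i) 2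

/-- A measurable version of the random Lipschitz constant. -/
theorem exists_measurable_lipschitz [IsProbabilityMeasure G.law] :
    ∃ Λ : Ξ → ℝ, Measurable Λ ∧ (∀ ξ, 0 ≤ Λ ξ) ∧
      MeanLE G.law (fun ξ => Λ ξ ^ 2) ((Lf : ℝ) ^ 2) ∧
      ∀ᵐ ξ ∂G.law, ∀ x ∈ prodSet D, ∀ x' ∈ prodSet D,
        ‖G.Vhat x' ξ - G.Vhat x ξ‖ ≤ Λ ξ * ‖x' - x‖ := by
  obtain ⟨L, hL0, hL2, hLf, hlip⟩ := hO.lipschitz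
  have hae : L =ᵐ[G.law] fun ξ => |hL2.1.mk L ξ| := by
    filter_upwards [hL2.1.ae_eq_mk] with ξ hξ
    rw [← hξ, abs_of_nonneg (hL0 ξ)]
  refine ⟨fun ξ => |hL2.1.mk L ξ|, ?_, fun ξ => abs_nonneg _, ⟨?_, ?_⟩, ?_⟩
  · exact hL2.1.stronglyMeasurable_mk.measurable.abs
  · refine ((memLp_two_iff_integrable_sq hL2.1).1 hL2).congr ?_
    filter_upwards [hae] with ξ hξ
    rw [hξ]
  · refine le_trans (le_of_eq (integral_congr_ae ?_)) hLf
    filter_upwards [hae] with ξ hξ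
    rw [hξ]
  · filter_upwards [hae, hlip] with ξ hξ h x hx x' hx'
    rw [← hξ]
    exact h x hx x' hx'

end Game.Oracle

end GameFacts

/-! ### Measurability of the maps of the algorithm -/

section Measurability

variable {ι : Type*} [Fintype ι] {n : ι → ℕ} {Ξ Ω : Type*} [MeasurableSpace Ξ]
  {G : Game n Ξ} {S : Schedule} {B : Feedback n G.m Ξ Ω} [MeasurableSpace Ω] {X p : Ω → Profile n}

theorem measurable_batchV (hV : Measurable (fun p : Profile n × Ξ => G.Vhat p.1 p.2)) {t : ℕ}
    (hX : Measurable X) (hξ : ∀ s < S.b t, ∀ i, Measurable (B.ξb t s i)) :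
    Measurable fun ω => batchV G S B t (X ω) ω := by
  refine measurable_profile fun i => ?_
  have : Measurable fun ω => ∑ s ∈ Finset.range (S.b t), (G.Vhat (X ω) (B.ξb t s i ω)) i := by
    refine Finset.measurable_sum _ fun s hs => ?_
    exact (measurable_profile_apply i).comp
      (hV.comp (hX.prodMk (hξ s (Finset.mem_range.1 hs) i)))
  exact this.const_smul ((S.b t : ℝ)⁻¹)

theorem measurable_batchH
    (hg : ∀ i, Measurable (fun p : Vec (n i) × Vec (G.m i) => G.g i p.1 p.2)) {t : ℕ}
    (hX : Measurable X) (hW : ∀ s < S.b t, ∀ i, Measurable (B.Wb t s i))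
    (hy : ∀ s < S.b t, ∀ i, Measurable (B.ybBase t s i))
    (hy' : ∀ s < S.b t, ∀ i, Measurable (B.ybPert t s i)) :
    Measurable fun ω => batchH G S B t (X ω) ω := by
  refine measurable_profile fun i => ?_
  have : Measurable fun ω => ∑ s ∈ Finset.range (S.b t), G.finiteDiff i (S.δ t) (X ω i)
      (B.Wb t s i ω) (B.ybBase t s i ω) (B.ybPert t s i ω) := by
    refine Finset.measurable_sum _ fun s hs => ?_
    have hs' := Finset.mem_range.1 hs
    exact measurable_finiteDiff (hg i) _ ((measurable_profile_apply i).comp hX) (hW s hs' i)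
      (hy s hs' i) (hy' s hs' i)
  exact this.const_smul ((S.b t : ℝ)⁻¹)

theorem measurable_correctionStep (hV : Measurable (fun p : Profile n × Ξ => G.Vhat p.1 p.2))
    (hg : ∀ i, Measurable (fun p : Vec (n i) × Vec (G.m i) => G.g i p.1 p.2)) {t k : ℕ}
    (hX : Measurable X) (hp : Measurable p) (hξ : ∀ i, Measurable (B.ξ t k i))
    (hW : ∀ i, Measurable (B.W t k i)) (hz : ∀ i, Measurable (B.yzBase t k i))
    (hz' : ∀ i, Measurable (B.yzPert t k i)) (hx : ∀ i, Measurable (B.yxBase t k i))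
    (hx' : ∀ i, Measurable (B.yxPert t k i)) :
    Measurable fun ω => correctionStep G S B t k (X ω) ω (p ω) := by
  refine measurable_profile fun i => ?_
  have hXi := (measurable_profile_apply i).comp hX
  have hpi := (measurable_profile_apply i).comp hp
  have h1 : Measurable fun ω => (G.Vhat (p ω) (B.ξ t k i ω)) i :=
    (measurable_profile_apply i).comp (hV.comp (hp.prodMk (hξ i)))
  have h2 : Measurable fun ω => (G.Vhat (X ω) (B.ξ t k i ω)) i :=
    (measurable_profile_apply i).comp (hV.comp (hX.prodMk (hξ i)))
  have h3 := measurable_finiteDiff (hg i) (S.δ t) hpi (hW i) (hz i) (hz' i)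
  have h4 := measurable_finiteDiff (hg i) (S.δ t) hXi (hW i) (hx i) (hx' i)
  exact hpi.sub (((((h1.add (hpi.const_smul (S.η t))).add h3).sub
    (h2.add (hXi.const_smul (S.η t)))).sub h4).const_smul (S.γ t))

end Measurability

/-- A run with the prescribed parameters of a game that satisfies all assumptions. The functions
`h i` are globally Lipschitz extensions of the implicit functions, and `Λ` is a measurable Lipschitz
constant of the oracle. -/
structure Setting {ι : Type*} [Fintype ι] [DecidableEq ι] {n : ι → ℕ} {Ξ Ω : Type*}
    [MeasurableSpace Ξ] [MeasurableSpace Ω] (G : Game n Ξ) (S : Schedule) (B : Feedback n G.m Ξ Ω)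
    (D : ∀ i, Set (Vec (n i))) (P : Measure Ω) (x₀ : Profile n) (ℱ : ℕ → MeasurableSpace Ω)
    (𝒜 : ℕ → ℕ → MeasurableSpace Ω) (C R Lf M : ℝ≥0) (L1 L2 : ι → ℝ≥0) (δ₀ : ℝ)
    (h : ∀ i, Vec (n i) → ℝ) (Λ : Ξ → ℝ) : Prop where
  δ₀_pos : 0 < δ₀
  enlarged_subset : ∀ i, G.enlarged δ₀ i ⊆ D i
  lower : G.LowerLevel D
  standing : G.Standing δ₀ D C R Lf L1 L2
  implicitConvex : G.ImplicitConvex δ₀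
  oracle : G.Oracle D Lf M
  T_pos : 0 < S.T
  inv_T_le : 1 / (S.T : ℝ) ≤ δ₀
  K_eq : S.K = S.T
  params : ∀ t < S.T, S.γ t = 1 / (S.T : ℝ) ∧ S.η t = 1 / (S.T : ℝ) ∧ S.δ t = 1 / (S.T : ℝ) ∧
    S.ε t = 1 / (S.T : ℝ) ^ 2 ∧ S.T ^ 2 ≤ S.b t
  run : IsRun G S B D P x₀ ℱ 𝒜
  h_lipschitz : ∀ i, LipschitzWith (L1 i) (h i)
  h_eq : ∀ i, Set.EqOn (G.implicit i) (h i) (D i)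
  Λ_measurable : Measurable Λ
  Λ_nonneg : ∀ ξ, 0 ≤ Λ ξ
  Λ_sq : MeanLE G.law (fun ξ => Λ ξ ^ 2) ((Lf : ℝ) ^ 2)
  Λ_lipschitz : ∀ᵐ ξ ∂G.law, ∀ x ∈ Game.prodSet D, ∀ x' ∈ Game.prodSet D,
    ‖G.Vhat x' ξ - G.Vhat x ξ‖ ≤ Λ ξ * ‖x' - x‖

/-! ### Decomposition of the update directions -/

section Directions

variable {ι : Type*} [Fintype ι] {n : ι → ℕ} {Ξ Ω : Type*}
  [MeasurableSpace Ξ] (G : Game n Ξ) (S : Schedule) (B : Feedback n G.m Ξ Ω) (x₀ : Profile n)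
  (h : ∀ i, Vec (n i) → ℝ)

/-- The projection of the start of round `t` onto the strategy profiles. -/
noncomputable def anchor (t : ℕ) (ω : Ω) : Profile n := proj G.profiles (outer G S B x₀ ω t)

/-- The direction of the projected half steps of round `t`. -/
noncomputable def roundDir (t : ℕ) (ω : Ω) : Profile n :=
  batchV G S B t (outer G S B x₀ ω t) ω + S.η t • outer G S B x₀ ω t
    + batchH G S B t (outer G S B x₀ ω t) ω

/-- The direction of the correction step `k` of round `t`. -/
noncomputable def corrDir (t k : ℕ) (ω : Ω) : Profile n :=
  WithLp.toLp 2 fun i =>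
    ((G.Vhat (halfIterate G S B x₀ t k ω) (B.ξ t k i ω)) i
        + S.η t • halfIterate G S B x₀ t k ω i)
      + G.finiteDiff i (S.δ t) (halfIterate G S B x₀ t k ω i) (B.W t k i ω) (B.yzBase t k i ω)
        (B.yzPert t k i ω)
      - ((G.Vhat (outer G S B x₀ ω t) (B.ξ t k i ω)) i + S.η t • outer G S B x₀ ω t i)
      - G.finiteDiff i (S.δ t) (outer G S B x₀ ω t i) (B.W t k i ω) (B.yxBase t k i ω)
        (B.yxPert t k i ω)

/-- The correction direction with exact lower level solutions, and with the first order oracle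
queried at the anchor. -/
noncomputable def exactDir (t k : ℕ) (ω : Ω) : Profile n :=
  WithLp.toLp 2 fun i =>
    ((G.Vhat (halfIterate G S B x₀ t k ω) (B.ξ t k i ω)) i
        - (G.Vhat (anchor G S B x₀ t ω) (B.ξ t k i ω)) i)
      + S.η t • (halfIterate G S B x₀ t k ω i - anchor G S B x₀ t ω i)
      + (sphDiff (h i) (S.δ t) (halfIterate G S B x₀ t k ω i) (B.W t k i ω)
        - sphDiff (h i) (S.δ t) (outer G S B x₀ ω t i) (B.W t k i ω))

/-- The error of the direction of round `t`. -/
noncomputable def batchErr (t : ℕ) (i : ι) (ω : Ω) : Vec (n i) :=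
  roundDir G S B x₀ t ω i - S.η t • anchor G S B x₀ t ω i
    - G.meanOracle (anchor G S B x₀ t ω) i
    - sphDiffMean (h i) (S.δ t) (outer G S B x₀ ω t i)

/-- The centered noise of the first order oracle. -/
noncomputable def noiseV (t k : ℕ) (i : ι) (ω : Ω) : Vec (n i) :=
  ((G.Vhat (halfIterate G S B x₀ t k ω) (B.ξ t k i ω)) i
      - (G.Vhat (anchor G S B x₀ t ω) (B.ξ t k i ω)) i)
    - (G.meanOracle (halfIterate G S B x₀ t k ω) i - G.meanOracle (anchor G S B x₀ t ω) i)

/-- The centered noise of the finite differences. -/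
noncomputable def noiseH (t k : ℕ) (i : ι) (ω : Ω) : Vec (n i) :=
  (sphDiff (h i) (S.δ t) (halfIterate G S B x₀ t k ω i) (B.W t k i ω)
      - sphDiff (h i) (S.δ t) (outer G S B x₀ ω t i) (B.W t k i ω))
    - (sphDiffMean (h i) (S.δ t) (halfIterate G S B x₀ t k ω i)
      - sphDiffMean (h i) (S.δ t) (outer G S B x₀ ω t i))

theorem innerIter_succ_eq (t k : ℕ) (ω : Ω) :
    innerIter G S B t (outer G S B x₀ ω t) ω (k + 1) =
      halfIterate G S B x₀ t k ω - S.γ t • corrDir G S B x₀ t k ω := rfl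

theorem halfIterate_zero_zero (ω : Ω) :
    halfIterate G S B x₀ 0 0 ω =
      proj G.profiles (x₀ - S.γ 0 • roundDir G S B x₀ 0 ω) := rfl

theorem halfIterate_succ (t k : ℕ) (ω : Ω) :
    halfIterate G S B x₀ t (k + 1) ω =
      proj G.profiles (halfIterate G S B x₀ t k ω - S.γ t • corrDir G S B x₀ t k ω
        - S.γ t • roundDir G S B x₀ t ω) := rfl

/-- The last inner iterate of a round is not projected before it starts the next round. The boundary
step therefore has the form of an inner step, with the new direction in place of the old one. -/
theorem halfIterate_round_succ (t k : ℕ) (hk : S.K = k + 1) (ω : Ω) :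
    halfIterate G S B x₀ (t + 1) 0 ω =
      proj G.profiles (halfIterate G S B x₀ t k ω - S.γ t • corrDir G S B x₀ t k ω
        - S.γ (t + 1) • roundDir G S B x₀ (t + 1) ω) := by
  have : outer G S B x₀ ω (t + 1) = innerIter G S B t (outer G S B x₀ ω t) ω (k + 1) := by
    rw [outer, hk]
  rw [← innerIter_succ_eq, ← this]
  rfl

theorem outer_succ_eq (t k : ℕ) (hk : S.K = k + 1) (ω : Ω) :
    outer G S B x₀ ω (t + 1) =
      halfIterate G S B x₀ t k ω - S.γ t • corrDir G S B x₀ t k ω := by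
  rw [outer, hk, innerIter_succ_eq]

/-- Variance reduction as an identity: the reference values at the start of the round cancel. The
oracle is centered at the anchor, since unbiasedness is given on the profiles only; the finite
differences of the extension `h i` make sense at `x^t` itself. -/
theorem roundDir_add_exactDir_apply (t k : ℕ) (i : ι) (ω : Ω) :
    (roundDir G S B x₀ t ω + exactDir G S B x₀ h t k ω) i =
      batchErr G S B x₀ h t i ω + S.η t • halfIterate G S B x₀ t k ω i
        + (G.meanOracle (halfIterate G S B x₀ t k ω) i
          + sphDiffMean (h i) (S.δ t) (halfIterate G S B x₀ t k ω i))
        + (noiseV G S B x₀ t k i ω + noiseH G S B x₀ h t k i ω) := by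
  rw [PiLp.add_apply]
  simp only [exactDir, batchErr, noiseV, noiseH]
  module

end Directions

/-! ### Errors of the inexact lower level solver -/

section EpsSolution

variable {ι : Type*} {n : ι → ℕ} {Ξ Ω : Type*} [MeasurableSpace Ξ]
  [MeasurableSpace Ω] {G : Game n Ξ} {P : Measure Ω}

/-- Tower property. Of the conditional accuracy, the rate uses only this unconditional first moment.
-/
theorem IsEpsSolution.meanLE [IsProbabilityMeasure P] {i : ι} {ε : ℝ} {x : Ω → Vec (n i)}
    {y : Ω → Vec (G.m i)} (h : IsEpsSolution G P i ε x y) (hx : Measurable x) :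
    MeanLE P (fun ω => ‖y ω - G.lowerSol i (x ω)‖) ε := by
  refine ⟨h.2.1, ?_⟩
  rw [← integral_condExp hx.comap_le]
  refine (integral_mono_ae integrable_condExp (integrable_const ε) h.2.2).trans ?_
  simp

/-- Errors in the function values are amplified by `1 / δ`. With `ε = 1 / T ^ 2` and `δ = 1 / T`
their mean stays of order `1 / T`. -/
theorem norm_finiteDiff_sub_sphDiff_le {D : ∀ i, Set (Vec (n i))} {L2 : ι → ℝ≥0}
    {h : ∀ i, Vec (n i) → ℝ} (hlow : G.LowerLevel D)
    (hg : ∀ i, ∀ x ∈ D i, LipschitzOnWith (L2 i) (G.g i x) (G.Y i))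
    (heq : ∀ i, Set.EqOn (G.implicit i) (h i) (D i)) {i : ι} {δ : ℝ} (hδ : 0 < δ)
    {x w : Vec (n i)} {y y' : Vec (G.m i)} (hx : x ∈ D i) (hx' : x + δ • w ∈ D i)
    (hw : ‖w‖ = 1) (hy : y ∈ G.Y i) (hy' : y' ∈ G.Y i) :
    ‖G.finiteDiff i δ x w y y' - sphDiff (h i) δ x w‖ ≤
      n i * L2 i / δ * (‖y - G.lowerSol i x‖ + ‖y' - G.lowerSol i (x + δ • w)‖) := by
  have h1 : |G.g i x y - h i x| ≤ L2 i * ‖y - G.lowerSol i x‖ := by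
    have := (hg i x hx).dist_le_mul y hy _ (hlow.lowerSol_mem hx)
    rwa [Real.dist_eq, dist_eq_norm, show G.g i x (G.lowerSol i x) = h i x from heq i hx] at this
  have h2 : |G.g i (x + δ • w) y' - h i (x + δ • w)| ≤
      L2 i * ‖y' - G.lowerSol i (x + δ • w)‖ := by
    have := (hg i _ hx').dist_le_mul y' hy' _ (hlow.lowerSol_mem hx')
    rwa [Real.dist_eq, dist_eq_norm,
      show G.g i (x + δ • w) (G.lowerSol i (x + δ • w)) = h i (x + δ • w) from heq i hx'] at this
  rw [Game.finiteDiff, sphDiff, ← sub_smul, norm_smul, hw, mul_one, ← mul_sub, ← sub_div,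
    Real.norm_eq_abs, abs_mul, abs_div, abs_of_pos hδ, Nat.abs_cast]
  have h3 : |G.g i (x + δ • w) y' - G.g i x y - (h i (x + δ • w) - h i x)| ≤
      L2 i * (‖y - G.lowerSol i x‖ + ‖y' - G.lowerSol i (x + δ • w)‖) := by
    have e : G.g i (x + δ • w) y' - G.g i x y - (h i (x + δ • w) - h i x) =
        (G.g i (x + δ • w) y' - h i (x + δ • w)) - (G.g i x y - h i x) := by ring
    rw [e]
    refine (abs_sub _ _).trans ?_
    linarith
  calc (n i : ℝ) * (|G.g i (x + δ • w) y' - G.g i x y - (h i (x + δ • w) - h i x)| / δ)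
      ≤ n i * (L2 i * (‖y - G.lowerSol i x‖ + ‖y' - G.lowerSol i (x + δ • w)‖) / δ) := by gcongr
    _ = _ := by ring

end EpsSolution

/-! ### Adaptedness and almost sure facts of a run -/

namespace Setting

variable {ι : Type*} [Fintype ι] [DecidableEq ι] {n : ι → ℕ} {Ξ Ω : Type*}
    [MeasurableSpace Ξ] [MeasurableSpace Ω] {G : Game n Ξ} {S : Schedule} {B : Feedback n G.m Ξ Ω}
    {D : ∀ i, Set (Vec (n i))} {P : Measure Ω} {x₀ : Profile n} {ℱ : ℕ → MeasurableSpace Ω}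
    {𝒜 : ℕ → ℕ → MeasurableSpace Ω} {C R Lf M : ℝ≥0} {L1 L2 : ι → ℝ≥0} {δ₀ : ℝ}
    {h : ∀ i, Vec (n i) → ℝ} {Λ : Ξ → ℝ}

section Structure

variable (H : Setting G S B D P x₀ ℱ 𝒜 C R Lf M L1 L2 δ₀ h Λ)
include H

theorem cast_T_pos : 0 < (S.T : ℝ) := by exact_mod_cast H.T_pos

theorem one_le_T : 1 ≤ (S.T : ℝ) := by exact_mod_cast H.T_pos

theorem γ_eq {t : ℕ} (ht : t < S.T) : S.γ t = 1 / (S.T : ℝ) := (H.params t ht).1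

theorem η_eq {t : ℕ} (ht : t < S.T) : S.η t = 1 / (S.T : ℝ) := (H.params t ht).2.1

theorem δ_eq {t : ℕ} (ht : t < S.T) : S.δ t = 1 / (S.T : ℝ) := (H.params t ht).2.2.1

theorem ε_eq {t : ℕ} (ht : t < S.T) : S.ε t = 1 / (S.T : ℝ) ^ 2 := (H.params t ht).2.2.2.1

theorem δ_pos {t : ℕ} (ht : t < S.T) : 0 < S.δ t := by
  rw [H.δ_eq ht]
  exact one_div_pos.2 H.cast_T_pos

theorem T_sq_le {t : ℕ} (ht : t < S.T) : (S.T : ℝ) ^ 2 ≤ S.b t := by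
  exact_mod_cast (H.params t ht).2.2.2.2

theorem b_pos {t : ℕ} (ht : t < S.T) : 0 < S.b t :=
  lt_of_lt_of_le (pow_pos H.T_pos 2) (H.params t ht).2.2.2.2

theorem T_le_sqrt {t : ℕ} (ht : t < S.T) : (S.T : ℝ) ≤ √(S.b t) :=
  Real.le_sqrt_of_sq_le (H.T_sq_le ht)

theorem K_pos : 0 < S.K := H.K_eq ▸ H.T_pos

theorem profiles_subset : G.profiles ⊆ Game.prodSet D := fun _ hx i =>
  H.enlarged_subset i (Game.subset_enlarged H.δ₀_pos.le i (hx i))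

theorem add_smul_mem {t : ℕ} (ht : t < S.T) {i : ι} {x w : Vec (n i)} (hx : x ∈ G.X i)
    (hw : ‖w‖ = 1) : x + S.δ t • w ∈ D i := by
  refine H.enlarged_subset i (Game.closedBall_subset_enlarged hx (δ := S.δ t) ?_ ?_)
  · rw [H.δ_eq ht]
    exact H.inv_T_le
  · rw [Metric.mem_closedBall, dist_eq_norm, add_sub_cancel_left, norm_smul, hw, mul_one,
      Real.norm_of_nonneg (H.δ_pos ht).le]

theorem halfIterate_mem (t k : ℕ) (ω : Ω) : halfIterate G S B x₀ t k ω ∈ G.profiles :=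
  proj_mem H.standing.nonempty_profiles H.standing.isClosed_profiles H.standing.convex_profiles _

theorem anchor_mem (t : ℕ) (ω : Ω) : anchor G S B x₀ t ω ∈ G.profiles :=
  proj_mem H.standing.nonempty_profiles H.standing.isClosed_profiles H.standing.convex_profiles _

theorem measurable_proj : Measurable (proj G.profiles) :=
  (lipschitzWith_proj H.standing.nonempty_profiles H.standing.isClosed_profiles
    H.standing.convex_profiles).continuous.measurable

theorem ℱ_le_𝒜' (t k : ℕ) : ℱ t ≤ 𝒜 t k := (H.run.ℱ_le_𝒜 t).trans (H.run.𝒜_mono t (Nat.zero_le k))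

theorem measurable_roundDir_of_outer {t : ℕ} (ht : t < S.T)
    (hX : Measurable[ℱ t] fun ω => outer G S B x₀ ω t) :
    Measurable[𝒜 t 0] (roundDir G S B x₀ t) := by
  have hX' := hX.mono (H.ℱ_le_𝒜' t 0) le_rfl
  have h1 := @measurable_batchV _ _ _ _ _ _ G S B (𝒜 t 0) _ H.oracle.measurable t hX'
    (H.run.ξb_adapted t ht)
  have h2 := @measurable_batchH _ _ _ _ _ _ G S B (𝒜 t 0) _ H.standing.g_measurable t hX'
    (H.run.Wb_adapted t ht) (H.run.ybBase_adapted t ht) (H.run.ybPert_adapted t ht)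
  exact (h1.add (hX'.const_smul (S.η t))).add h2

theorem measurable_innerIter_of_outer {t : ℕ} (ht : t < S.T)
    (hX : Measurable[ℱ t] fun ω => outer G S B x₀ ω t) (k : ℕ) (hk : k ≤ S.K) :
    Measurable[𝒜 t k] fun ω => innerIter G S B t (outer G S B x₀ ω t) ω k := by
  induction k with
  | zero => exact hX.mono (H.ℱ_le_𝒜' t 0) le_rfl
  | succ k ih =>
    have hk' : k < S.K := hk
    have ih := (ih hk'.le).mono (H.run.𝒜_mono t (Nat.le_succ k)) le_rfl
    have hr := (H.measurable_roundDir_of_outer ht hX).mono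
      (H.run.𝒜_mono t (Nat.zero_le (k + 1))) le_rfl
    have hp : Measurable[𝒜 t (k + 1)] fun ω =>
        proj G.profiles (innerIter G S B t (outer G S B x₀ ω t) ω k
          - S.γ t • roundDir G S B x₀ t ω) :=
      H.measurable_proj.comp (ih.sub (hr.const_smul (S.γ t)))
    exact @measurable_correctionStep _ _ _ _ _ _ G S B (𝒜 t (k + 1)) _ _ H.oracle.measurable
      H.standing.g_measurable t k (hX.mono (H.ℱ_le_𝒜' t _) le_rfl) hp
      (H.run.ξ_adapted t ht k hk') (H.run.W_adapted t ht k hk') (H.run.yzBase_adapted t ht k hk')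
      (H.run.yzPert_adapted t ht k hk') (H.run.yxBase_adapted t ht k hk')
      (H.run.yxPert_adapted t ht k hk')

theorem measurable_outer {t : ℕ} (ht : t < S.T) :
    Measurable[ℱ t] fun ω => outer G S B x₀ ω t := by
  induction t with
  | zero => exact measurable_const
  | succ t ih =>
    have ht' : t < S.T := by omega
    exact (H.measurable_innerIter_of_outer ht' (ih ht') S.K le_rfl).mono (H.run.𝒜_le_ℱ t) le_rfl

theorem measurable_roundDir {t : ℕ} (ht : t < S.T) :
    Measurable[𝒜 t 0] (roundDir G S B x₀ t) :=
  H.measurable_roundDir_of_outer ht (H.measurable_outer ht)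

/-- The half iterate is known before the samples of its own inner step are drawn; the centering of
the noise rests on this. -/
theorem measurable_halfIterate {t k : ℕ} (ht : t < S.T) (hk : k < S.K) :
    Measurable[𝒜 t k] (halfIterate G S B x₀ t k) := by
  have h1 := H.measurable_innerIter_of_outer ht (H.measurable_outer ht) k hk.le
  have h2 := (H.measurable_roundDir ht).mono (H.run.𝒜_mono t (Nat.zero_le k)) le_rfl
  exact H.measurable_proj.comp (h1.sub (h2.const_smul (S.γ t)))

theorem measurable_anchor {t : ℕ} (ht : t < S.T) : Measurable[ℱ t] (anchor G S B x₀ t) :=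
  H.measurable_proj.comp (H.measurable_outer ht)

theorem measurable_outer' {t : ℕ} (ht : t < S.T) : Measurable fun ω => outer G S B x₀ ω t :=
  (H.measurable_outer ht).mono (H.run.ℱ_le t) le_rfl

theorem measurable_anchor' {t : ℕ} (ht : t < S.T) : Measurable (anchor G S B x₀ t) :=
  (H.measurable_anchor ht).mono (H.run.ℱ_le t) le_rfl

theorem measurable_halfIterate' {t k : ℕ} (ht : t < S.T) (hk : k < S.K) :
    Measurable (halfIterate G S B x₀ t k) :=
  (H.measurable_halfIterate ht hk).mono (H.run.𝒜_le t k) le_rfl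

theorem measurable_ξ {t k : ℕ} (ht : t < S.T) (hk : k < S.K) (i : ι) : Measurable (B.ξ t k i) :=
  (H.run.ξ_adapted t ht k hk i).mono (H.run.𝒜_le t _) le_rfl

theorem measurable_W {t k : ℕ} (ht : t < S.T) (hk : k < S.K) (i : ι) : Measurable (B.W t k i) :=
  (H.run.W_adapted t ht k hk i).mono (H.run.𝒜_le t _) le_rfl

theorem measurable_ξb {t s : ℕ} (ht : t < S.T) (hs : s < S.b t) (i : ι) :
    Measurable (B.ξb t s i) :=
  (H.run.ξb_adapted t ht s hs i).mono (H.run.𝒜_le t _) le_rfl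

theorem measurable_Wb {t s : ℕ} (ht : t < S.T) (hs : s < S.b t) (i : ι) :
    Measurable (B.Wb t s i) :=
  (H.run.Wb_adapted t ht s hs i).mono (H.run.𝒜_le t _) le_rfl

theorem fresh_ξ [IsProbabilityMeasure P] {t k : ℕ} (ht : t < S.T) (hk : k < S.K) (i : ι) :
    FreshSample P (𝒜 t k) (B.ξ t k i) G.law :=
  ⟨H.run.𝒜_le t k, H.measurable_ξ ht hk i, H.run.ξ_law t ht k hk i, H.run.ξ_fresh t ht k hk i⟩

theorem fresh_W [IsProbabilityMeasure P] {t k : ℕ} (ht : t < S.T) (hk : k < S.K) (i : ι) :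
    FreshSample P (𝒜 t k) (B.W t k i) (sphereUniform (n i)) :=
  ⟨H.run.𝒜_le t k, H.measurable_W ht hk i, H.run.W_law t ht k hk i, H.run.W_fresh t ht k hk i⟩

theorem fresh_ξb [IsProbabilityMeasure P] {t s : ℕ} (ht : t < S.T) (hs : s < S.b t) (i : ι) :
    FreshSample P (ℱ t) (B.ξb t s i) G.law := by
  refine ⟨H.run.ℱ_le t, H.measurable_ξb ht hs i, H.run.ξb_law t ht s hs i, ?_⟩
  refine indep_of_indep_of_le_left (H.run.ξb_fresh t ht i) ?_
  have : B.ξb t s i = (fun v : Fin (S.b t) → Ξ => v ⟨s, hs⟩) ∘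
      fun ω (s : Fin (S.b t)) => B.ξb t s i ω := rfl
  rw [this, ← MeasurableSpace.comap_comp]
  exact MeasurableSpace.comap_mono (measurable_pi_apply _).comap_le

theorem n_pos [IsProbabilityMeasure P] (i : ι) : 0 < n i := by
  have h1 := (H.fresh_W H.T_pos H.K_pos i).isProbabilityMeasure
  by_contra h2
  have h3 : n i = 0 := by omega
  have h4 : sphereUniform (n i) = 0 := by
    rw [h3]
    exact sphereUniform_zero
  rw [h4] at h1
  exact zero_ne_one (h1.measure_univ)

theorem ae_norm_W [IsProbabilityMeasure P] {t k : ℕ} (ht : t < S.T) (hk : k < S.K) (i : ι) :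
    ∀ᵐ ω ∂P, ‖B.W t k i ω‖ = 1 :=
  (H.fresh_W ht hk i).ae (ae_norm_sphereUniform _)

theorem ae_norm_Wb {t s : ℕ} (ht : t < S.T) (hs : s < S.b t) (i : ι) :
    ∀ᵐ ω ∂P, ‖B.Wb t s i ω‖ = 1 := by
  have h1 := ae_norm_sphereUniform (n i)
  rw [← H.run.Wb_law t ht s hs i] at h1
  exact ae_of_ae_map (H.measurable_Wb ht hs i).aemeasurable h1

theorem ae_outer_mem : ∀ᵐ ω ∂P, ∀ t < S.T, outer G S B x₀ ω t ∈ Game.prodSet D := by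
  filter_upwards [H.run.query] with ω hω t ht i
  exact hω t ht i (Metric.mem_closedBall_self (H.δ_pos ht).le)

theorem ae_outer_add_mem : ∀ᵐ ω ∂P, ∀ t < S.T, ∀ i, ∀ w : Vec (n i), ‖w‖ = 1 →
    outer G S B x₀ ω t i + S.δ t • w ∈ D i := by
  filter_upwards [H.run.query] with ω hω t ht i w hw
  refine hω t ht i ?_
  rw [Metric.mem_closedBall, dist_eq_norm, add_sub_cancel_left, norm_smul, hw, mul_one,
    Real.norm_of_nonneg (H.δ_pos ht).le]

theorem meanLE_Λ [IsProbabilityMeasure G.law] : MeanLE G.law Λ Lf := by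
  have := MeanLE.of_sq H.Λ_measurable.aestronglyMeasurable H.Λ_sq
  rwa [Real.sqrt_sq Lf.coe_nonneg] at this

end Structure

end Setting

theorem FreshSample.meanLE_comp {Ω Z : Type*} {𝒢 mΩ : MeasurableSpace Ω} [MeasurableSpace Z]
    {P : Measure Ω} {ζ : Ω → Z} {ν : Measure Z} (h : FreshSample P 𝒢 ζ ν) {f : Z → ℝ}
    (hf : Measurable f) {c : ℝ} (hc : MeanLE ν f c) : MeanLE P (fun ω => f (ζ ω)) c := by
  rw [← h.law] at hc
  refine ⟨(integrable_map_measure hf.aestronglyMeasurable h.measurable.aemeasurable).1 hc.1, ?_⟩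
  rw [← integral_map (f := f) h.measurable.aemeasurable hf.aestronglyMeasurable]
  exact hc.2

/-- The product of a past quantity with a nonnegative function of a fresh sample. -/
theorem FreshSample.meanLE_mul {Ω Z : Type*} {𝒢 mΩ : MeasurableSpace Ω} [MeasurableSpace Z]
    {P : Measure Ω} [IsProbabilityMeasure P] {ζ : Ω → Z} {ν : Measure Z}
    (h : FreshSample P 𝒢 ζ ν) {f : Z → ℝ}
    (hf : Measurable f) (hf0 : ∀ z, 0 ≤ f z) {c : ℝ} (hc : MeanLE ν f c) (hc0 : 0 ≤ c)
    {q : Ω → ℝ} (hq : Measurable[𝒢] q) (hq0 : ∀ ω, 0 ≤ q ω) {d : ℝ} (hd : MeanLE P q d) :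
    MeanLE P (fun ω => q ω * f (ζ ω)) (c * d) := by
  have h1 := h.meanLE (Φ := fun p : ℝ × Z => |p.1| * f p.2) hq
    ((measurable_fst.abs).mul (hf.comp measurable_snd))
    (fun p => mul_nonneg (abs_nonneg _) (hf0 _)) (hd.const_mul hc0)
    (Filter.Eventually.of_forall fun ω => by
      have := hc.const_mul (c := |q ω|) (abs_nonneg _)
      rw [abs_of_nonneg (hq0 ω), mul_comm (q ω) c] at this
      simpa only [abs_of_nonneg (hq0 ω)] using this)
  simpa only [abs_of_nonneg (hq0 _)] using h1

theorem measurable_sphDiff {Ω : Type*} [MeasurableSpace Ω] {d : ℕ} {h : Vec d → ℝ}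
    (hh : Continuous h) (δ : ℝ) {x w : Ω → Vec d} (hx : Measurable x) (hw : Measurable w) :
    Measurable fun ω => sphDiff h δ (x ω) (w ω) := by
  have h1 : Measurable fun ω => h (x ω + δ • w ω) := hh.measurable.comp (hx.add (hw.const_smul δ))
  have h2 : Measurable fun ω => h (x ω) := hh.measurable.comp hx
  exact (((h1.sub h2).div_const δ).const_mul _).smul hw

theorem norm_add_three_sq_le {E : Type*} [SeminormedAddCommGroup E] (a b c : E) :
    ‖a + b + c‖ ^ 2 ≤ 3 * (‖a‖ ^ 2 + ‖b‖ ^ 2 + ‖c‖ ^ 2) := by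
  have h1 : ‖a + b + c‖ ≤ ‖a‖ + ‖b‖ + ‖c‖ := norm_add₃_le
  have h2 := pow_le_pow_left₀ (norm_nonneg _) h1 2
  nlinarith [sq_nonneg (‖a‖ - ‖b‖), sq_nonneg (‖a‖ - ‖c‖), sq_nonneg (‖b‖ - ‖c‖)]

theorem norm_sub_sq_le_two {E : Type*} [SeminormedAddCommGroup E] (a b : E) :
    ‖a - b‖ ^ 2 ≤ 2 * (‖a‖ ^ 2 + ‖b‖ ^ 2) := by
  have h2 := pow_le_pow_left₀ (norm_nonneg _) (norm_sub_le a b) 2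
  nlinarith [sq_nonneg (‖a‖ - ‖b‖)]

namespace Setting

variable {ι : Type*} [Fintype ι] [DecidableEq ι] {n : ι → ℕ} {Ξ Ω : Type*}
    [MeasurableSpace Ξ] [MeasurableSpace Ω] {G : Game n Ξ} {S : Schedule} {B : Feedback n G.m Ξ Ω}
    {D : ∀ i, Set (Vec (n i))} {P : Measure Ω} {x₀ : Profile n} {ℱ : ℕ → MeasurableSpace Ω}
    {𝒜 : ℕ → ℕ → MeasurableSpace Ω} {C R Lf M : ℝ≥0} {L1 L2 : ι → ℝ≥0} {δ₀ : ℝ}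
    {h : ∀ i, Vec (n i) → ℝ} {Λ : Ξ → ℝ}

/-! ### The correction and its idealisation -/

section Correction

variable (H : Setting G S B D P x₀ ℱ 𝒜 C R Lf M L1 L2 δ₀ h Λ)
  {t k : ℕ} (ht : t < S.T) (hk : k < S.K)
include H ht

theorem ηγ_le_one : S.η t ≤ 1 := by
  rw [H.η_eq ht, div_le_one H.cast_T_pos]
  exact H.one_le_T

theorem η_nonneg : 0 ≤ S.η t := by
  rw [H.η_eq ht]
  exact (one_div_pos.2 H.cast_T_pos).le

theorem measurable_dist_anchor :
    Measurable[ℱ t] fun ω => ‖outer G S B x₀ ω t - anchor G S B x₀ t ω‖ :=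
  measurable_norm.comp ((H.measurable_outer ht).sub (H.measurable_anchor ht))

include hk

theorem measurable_Vhat_half (i : ι) :
    Measurable[𝒜 t (k + 1)] fun ω => (G.Vhat (halfIterate G S B x₀ t k ω) (B.ξ t k i ω)) i :=
  (measurable_profile_apply i).comp (H.oracle.measurable.comp
    (((H.measurable_halfIterate ht hk).mono (H.run.𝒜_mono t (Nat.le_succ k)) le_rfl).prodMk
      (H.run.ξ_adapted t ht k hk i)))

theorem measurable_Vhat_anchor (i : ι) :
    Measurable[𝒜 t (k + 1)] fun ω => (G.Vhat (anchor G S B x₀ t ω) (B.ξ t k i ω)) i :=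
  (measurable_profile_apply i).comp (H.oracle.measurable.comp
    (((H.measurable_anchor ht).mono (H.ℱ_le_𝒜' t _) le_rfl).prodMk
      (H.run.ξ_adapted t ht k hk i)))

theorem measurable_sphDiff_half (i : ι) :
    Measurable[𝒜 t (k + 1)] fun ω =>
      sphDiff (h i) (S.δ t) (halfIterate G S B x₀ t k ω i) (B.W t k i ω) :=
  @measurable_sphDiff _ (𝒜 t (k + 1)) _ _ (H.h_lipschitz i).continuous _ _ _
    ((measurable_profile_apply i).comp ((H.measurable_halfIterate ht hk).mono
      (H.run.𝒜_mono t (Nat.le_succ k)) le_rfl)) (H.run.W_adapted t ht k hk i)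

theorem measurable_sphDiff_outer (i : ι) :
    Measurable[𝒜 t (k + 1)] fun ω =>
      sphDiff (h i) (S.δ t) (outer G S B x₀ ω t i) (B.W t k i ω) :=
  @measurable_sphDiff _ (𝒜 t (k + 1)) _ _ (H.h_lipschitz i).continuous _ _ _
    ((measurable_profile_apply i).comp ((H.measurable_outer ht).mono
      (H.ℱ_le_𝒜' t _) le_rfl)) (H.run.W_adapted t ht k hk i)

theorem measurable_exactDir_apply (i : ι) :
    Measurable fun ω => exactDir G S B x₀ h t k ω i := by
  have hle := H.run.𝒜_le t (k + 1)
  have h1 := (H.measurable_Vhat_half ht hk i).mono hle le_rfl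
  have h2 := (H.measurable_Vhat_anchor ht hk i).mono hle le_rfl
  have h3 := (H.measurable_sphDiff_half ht hk i).mono hle le_rfl
  have h4 := (H.measurable_sphDiff_outer ht hk i).mono hle le_rfl
  have h5 := (measurable_profile_apply i).comp (H.measurable_halfIterate' ht hk)
  have h6 := (measurable_profile_apply i).comp (H.measurable_anchor' ht)
  exact ((h1.sub h2).add ((h5.sub h6).const_smul (S.η t))).add (h3.sub h4)

theorem measurable_corrDir : Measurable (corrDir G S B x₀ t k) := by
  have h1 := (H.measurable_innerIter_of_outer ht (H.measurable_outer ht) (k + 1) hk).mono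
    (H.run.𝒜_le t _) le_rfl
  have h2 := ((H.measurable_halfIterate' ht hk).sub h1).const_smul (S.γ t)⁻¹
  have hγ : S.γ t ≠ 0 := by
    rw [H.γ_eq ht]
    exact (one_div_pos.2 H.cast_T_pos).ne'
  convert h2 using 1
  ext1 ω
  simp only [Pi.smul_apply, Pi.sub_apply]
  rw [innerIter_succ_eq, sub_sub_cancel, smul_smul, inv_mul_cancel₀ hγ, one_smul]

variable [IsProbabilityMeasure P]

theorem meanLE_Λ_sq (i : ι) : MeanLE P (fun ω => Λ (B.ξ t k i ω) ^ 2) ((Lf : ℝ) ^ 2) :=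
  (H.fresh_ξ ht hk i).meanLE_comp (H.Λ_measurable.pow_const 2) H.Λ_sq

theorem ae_norm_Vhat_sub_le (i : ι) : ∀ᵐ ω ∂P, ∀ x ∈ Game.prodSet D, ∀ x' ∈ Game.prodSet D,
    ‖(G.Vhat x' (B.ξ t k i ω)) i - (G.Vhat x (B.ξ t k i ω)) i‖ ≤ Λ (B.ξ t k i ω) * ‖x' - x‖ := by
  filter_upwards [(H.fresh_ξ ht hk i).ae H.Λ_lipschitz] with ω hω x hx x' hx'
  exact (norm_apply_le (G.Vhat x' (B.ξ t k i ω) - G.Vhat x (B.ξ t k i ω)) i).trans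
    (hω x hx x' hx')

/-- Both points where the oracle is evaluated are feasible, so `Λ` times the diameter bounds its
increment, and the finite differences are bounded by the Lipschitz constants. No decay in `T` is
needed, since the step size supplies it. -/
theorem meanLE_exactDir_sq (i : ι) :
    MeanLE P (fun ω => ‖exactDir G S B x₀ h t k ω i‖ ^ 2)
      (3 * (Fintype.card ι * (C : ℝ) ^ 2 * (Lf : ℝ) ^ 2 + (C : ℝ) ^ 2
        + (2 * (n i * (L1 i : ℝ))) ^ 2)) := by
  have h1 := ((H.meanLE_Λ_sq ht hk i).const_mul
    (c := Fintype.card ι * (C : ℝ) ^ 2) (by positivity)).add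
    (MeanLE.const (P := P) ((C : ℝ) ^ 2 + (2 * (n i * (L1 i : ℝ))) ^ 2))
  refine ((h1.const_mul (c := 3) (by norm_num)).mono
    ((H.measurable_exactDir_apply ht hk i).norm.pow_const 2).aestronglyMeasurable
    (Filter.Eventually.of_forall fun ω => by positivity) ?_).trans (le_of_eq (by ring))
  filter_upwards [H.ae_norm_Vhat_sub_le ht hk i, H.ae_norm_W ht hk i] with ω hω hW
  have hp := H.halfIterate_mem t k ω
  have hx := H.anchor_mem t ω
  refine (norm_add_three_sq_le _ _ _).trans ?_
  have e1 : ‖(G.Vhat (halfIterate G S B x₀ t k ω) (B.ξ t k i ω)) i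
        - (G.Vhat (anchor G S B x₀ t ω) (B.ξ t k i ω)) i‖ ^ 2 ≤
      Fintype.card ι * (C : ℝ) ^ 2 * Λ (B.ξ t k i ω) ^ 2 := by
    have h2 := pow_le_pow_left₀ (norm_nonneg _)
      (hω _ (H.profiles_subset hx) _ (H.profiles_subset hp)) 2
    refine h2.trans ?_
    rw [mul_pow, mul_comm]
    exact mul_le_mul_of_nonneg_right (H.standing.norm_sub_sq_le hp hx) (sq_nonneg _)
  have e2 : ‖S.η t • (halfIterate G S B x₀ t k ω i - anchor G S B x₀ t ω i)‖ ^ 2 ≤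
      (C : ℝ) ^ 2 := by
    refine pow_le_pow_left₀ (norm_nonneg _) ?_ 2
    rw [norm_smul, Real.norm_of_nonneg (H.η_nonneg ht)]
    refine (mul_le_mul (H.ηγ_le_one ht) (H.standing.diam i _ (hp i) _ (hx i)) (norm_nonneg _)
      zero_le_one).trans (by simp)
  have e3 : ‖sphDiff (h i) (S.δ t) (halfIterate G S B x₀ t k ω i) (B.W t k i ω)
      - sphDiff (h i) (S.δ t) (outer G S B x₀ ω t i) (B.W t k i ω)‖ ^ 2 ≤
      (2 * (n i * (L1 i : ℝ))) ^ 2 := by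
    refine pow_le_pow_left₀ (norm_nonneg _) ((norm_sub_le _ _).trans ?_) 2
    have a1 := norm_sphDiff_le (H.h_lipschitz i) (H.δ_pos ht) (halfIterate G S B x₀ t k ω i) hW
    have a2 := norm_sphDiff_le (H.h_lipschitz i) (H.δ_pos ht) (outer G S B x₀ ω t i) hW
    linarith
  linarith

variable [IsProbabilityMeasure G.law]

/-- The difference consists of the solver errors at four queries and of the oracle and Tikhonov
increments between `x^t` and the anchor. Since `Λ` is evaluated at a fresh sample, its product with
the distance has mean at most `Lf * d`; no second moment of the distance is required. -/
theorem meanLE_corrDir_sub_exactDir (i : ι) {d : ℝ}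
    (hd : MeanLE P (fun ω => ‖outer G S B x₀ ω t - anchor G S B x₀ t ω‖) d) :
    MeanLE P (fun ω => ‖corrDir G S B x₀ t k ω i - exactDir G S B x₀ h t k ω i‖)
      ((Lf + 1) * d + 4 * (n i * L2 i) / S.T) := by
  have hmp : Measurable fun ω => halfIterate G S B x₀ t k ω i :=
    (measurable_profile_apply i).comp (H.measurable_halfIterate' ht hk)
  have hmx : Measurable fun ω => outer G S B x₀ ω t i :=
    (measurable_profile_apply i).comp (H.measurable_outer' ht)
  have hmW := (H.measurable_W ht hk i).const_smul (S.δ t)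
  have s1 := (H.run.yzBase_eps t ht k hk i).meanLE hmp
  have s2 := (H.run.yzPert_eps t ht k hk i).meanLE (hmp.add hmW)
  have s3 := (H.run.yxBase_eps t ht k hk i).meanLE hmx
  have s4 := (H.run.yxPert_eps t ht k hk i).meanLE (hmx.add hmW)
  have hδ := H.δ_pos ht
  have hc : 0 ≤ n i * (L2 i : ℝ) / S.δ t := by positivity
  have hΛ := (H.fresh_ξ ht hk i).meanLE_mul H.Λ_measurable H.Λ_nonneg H.meanLE_Λ Lf.coe_nonneg
    ((H.measurable_dist_anchor ht).mono (H.ℱ_le_𝒜' t k) le_rfl) (fun ω => norm_nonneg _) hd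
  have hsum := (((s1.add s2).add (s3.add s4)).const_mul hc).add (hΛ.add hd)
  refine (hsum.mono ?_ (Filter.Eventually.of_forall fun ω => norm_nonneg _) ?_).trans ?_
  · exact ((((measurable_profile_apply i).comp (H.measurable_corrDir ht hk)).sub
      (H.measurable_exactDir_apply ht hk i)).norm).aestronglyMeasurable
  · filter_upwards [H.ae_norm_Vhat_sub_le ht hk i, H.ae_norm_W ht hk i, H.ae_outer_mem,
      H.ae_outer_add_mem, (H.run.yzBase_eps t ht k hk i).1, (H.run.yzPert_eps t ht k hk i).1,
      (H.run.yxBase_eps t ht k hk i).1, (H.run.yxPert_eps t ht k hk i).1]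
      with ω hω hW hX hX' m1 m2 m3 m4
    have hp := H.halfIterate_mem t k ω
    have hx := H.anchor_mem t ω
    set p := halfIterate G S B x₀ t k ω with hpdef
    set x := outer G S B x₀ ω t with hxdef
    set a := anchor G S B x₀ t ω with hadef
    have a1 := norm_finiteDiff_sub_sphDiff_le H.lower H.standing.g_lipschitz H.h_eq hδ
      (H.profiles_subset hp i) (H.add_smul_mem ht (hp i) hW) hW m1 m2
    have a2 := norm_finiteDiff_sub_sphDiff_le H.lower H.standing.g_lipschitz H.h_eq hδ
      (hX t ht i) (hX' t ht i _ hW) hW m3 m4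
    have a3 := hω a (H.profiles_subset hx) x (hX t ht)
    have a4 : ‖S.η t • (x i - a i)‖ ≤ ‖x - a‖ := by
      rw [norm_smul, Real.norm_of_nonneg (H.η_nonneg ht)]
      refine (mul_le_mul (H.ηγ_le_one ht) (norm_apply_le (x - a) i) (norm_nonneg _)
        zero_le_one).trans (by simp)
    have e : corrDir G S B x₀ t k ω i - exactDir G S B x₀ h t k ω i =
        (G.finiteDiff i (S.δ t) (p i) (B.W t k i ω) (B.yzBase t k i ω) (B.yzPert t k i ω)
          - sphDiff (h i) (S.δ t) (p i) (B.W t k i ω))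
        - (G.finiteDiff i (S.δ t) (x i) (B.W t k i ω) (B.yxBase t k i ω) (B.yxPert t k i ω)
          - sphDiff (h i) (S.δ t) (x i) (B.W t k i ω))
        - ((G.Vhat x (B.ξ t k i ω)) i - (G.Vhat a (B.ξ t k i ω)) i)
        - S.η t • (x i - a i) := by
      simp only [corrDir, exactDir, ← hpdef, ← hxdef, ← hadef]
      module
    rw [e]
    refine ((norm_sub_le _ _).trans (add_le_add ((norm_sub_le _ _).trans
      (add_le_add (norm_sub_le _ _) le_rfl)) le_rfl)).trans ?_
    rw [mul_comm ‖x - a‖]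
    linarith
  · rw [H.ε_eq ht, H.δ_eq ht]
    have := H.cast_T_pos
    refine le_of_eq ?_
    field_simp
    ring

end Correction

end Setting

theorem MeanLE.average {Ω : Type*} [MeasurableSpace Ω] {P : Measure Ω} {b : ℕ} (hb : 0 < b)
    {f : ℕ → Ω → ℝ} {c : ℝ} (h : ∀ s < b, MeanLE P (f s) c) :
    MeanLE P (fun ω => (b : ℝ)⁻¹ * ∑ s ∈ Finset.range b, f s ω) c := by
  have hb' : (0 : ℝ) < b := by exact_mod_cast hb
  refine ((MeanLE.sum fun s hs => h s (Finset.mem_range.1 hs)).const_mul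
    (inv_nonneg.2 hb'.le)).trans (le_of_eq ?_)
  simp only [Finset.sum_const, Finset.card_range, nsmul_eq_mul]
  field_simp

namespace Setting

variable {ι : Type*} [Fintype ι] [DecidableEq ι] {n : ι → ℕ} {Ξ Ω : Type*}
    [MeasurableSpace Ξ] [MeasurableSpace Ω] {G : Game n Ξ} {S : Schedule} {B : Feedback n G.m Ξ Ω}
    {D : ∀ i, Set (Vec (n i))} {P : Measure Ω} {x₀ : Profile n} {ℱ : ℕ → MeasurableSpace Ω}
    {𝒜 : ℕ → ℕ → MeasurableSpace Ω} {C R Lf M : ℝ≥0} {L1 L2 : ι → ℝ≥0} {δ₀ : ℝ}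
    {h : ∀ i, Vec (n i) → ℝ} {Λ : Ξ → ℝ}

/-! ### Centered noise of the inner steps -/

section Noise

variable (H : Setting G S B D P x₀ ℱ 𝒜 C R Lf M L1 L2 δ₀ h Λ)
  [IsProbabilityMeasure G.law] [IsProbabilityMeasure P]
  {t k : ℕ} (ht : t < S.T) (hk : k < S.K) (i : ι)
include H

omit [IsProbabilityMeasure P] in
theorem measurable_centeredV : Measurable fun q : (Profile n × Profile n) × Ξ =>
    ((G.Vhat q.1.1 q.2) i - (G.Vhat q.1.2 q.2) i)
      - (G.meanOracle q.1.1 i - G.meanOracle q.1.2 i) := by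
  have hV := H.oracle.measurable
  have hm := H.oracle.measurable_meanOracle
  have h0 := measurable_profile_apply (n := n) i
  have h1 : Measurable fun q : (Profile n × Profile n) × Ξ => (G.Vhat q.1.1 q.2) i :=
    h0.comp (hV.comp ((measurable_fst.comp measurable_fst).prodMk measurable_snd))
  have h2 : Measurable fun q : (Profile n × Profile n) × Ξ => (G.Vhat q.1.2 q.2) i :=
    h0.comp (hV.comp ((measurable_snd.comp measurable_fst).prodMk measurable_snd))
  have h3 : Measurable fun q : (Profile n × Profile n) × Ξ => G.meanOracle q.1.1 i :=
    h0.comp (hm.comp (measurable_fst.comp measurable_fst))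
  have h4 : Measurable fun q : (Profile n × Profile n) × Ξ => G.meanOracle q.1.2 i :=
    h0.comp (hm.comp (measurable_snd.comp measurable_fst))
  exact (h1.sub h2).sub (h3.sub h4)

omit [IsProbabilityMeasure P] in
-- The Lipschitz constants and the diameter are used in place of the variance bound, so `M` does not
-- enter the noise of the inner steps.
theorem meanLE_centeredV_sq {x y : Profile n} (hx : x ∈ G.profiles) (hy : y ∈ G.profiles) :
    MeanLE G.law (fun ξ => ‖((G.Vhat x ξ) i - (G.Vhat y ξ) i)
      - (G.meanOracle x i - G.meanOracle y i)‖ ^ 2)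
      (4 * (Fintype.card ι * (C : ℝ) ^ 2 * (Lf : ℝ) ^ 2)) := by
  have h1 := ((H.Λ_sq.const_mul (c := Fintype.card ι * (C : ℝ) ^ 2) (by positivity)).add
    (MeanLE.const (P := G.law) (Fintype.card ι * (C : ℝ) ^ 2 * (Lf : ℝ) ^ 2))).const_mul
    (c := 2) (by norm_num)
  refine (h1.mono ?_ (Filter.Eventually.of_forall fun ω => by positivity) ?_).trans
    (le_of_eq (by ring))
  · have hm := (H.measurable_centeredV i).comp (measurable_prodMk_left (x := (x, y)))
    exact (hm.norm.pow_const 2).aestronglyMeasurable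
  · filter_upwards [H.Λ_lipschitz] with ξ hξ
    refine (norm_sub_sq_le_two _ _).trans ?_
    have hsq := H.standing.norm_sub_sq_le hx hy
    have e1 : ‖(G.Vhat x ξ) i - (G.Vhat y ξ) i‖ ^ 2 ≤
        Fintype.card ι * (C : ℝ) ^ 2 * Λ ξ ^ 2 := by
      have h2 := pow_le_pow_left₀ (norm_nonneg _)
        ((norm_apply_le (G.Vhat x ξ - G.Vhat y ξ) i).trans
          (hξ y (H.profiles_subset hy) x (H.profiles_subset hx))) 2
      refine h2.trans ?_
      rw [mul_pow, mul_comm]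
      exact mul_le_mul_of_nonneg_right hsq (sq_nonneg _)
    have e2 : ‖G.meanOracle x i - G.meanOracle y i‖ ^ 2 ≤
        Fintype.card ι * (C : ℝ) ^ 2 * (Lf : ℝ) ^ 2 := by
      rw [H.oracle.meanOracle_eq hx, H.oracle.meanOracle_eq hy]
      have h2 := pow_le_pow_left₀ (norm_nonneg _)
        ((norm_apply_le (G.V x - G.V y) i).trans
          (H.standing.norm_V_sub_le H.δ₀_pos.le hx hy)) 2
      refine h2.trans ?_
      rw [mul_pow, mul_comm]
      exact mul_le_mul_of_nonneg_right hsq (sq_nonneg _)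
    linarith

omit [IsProbabilityMeasure P] in
theorem integral_centeredV {x y : Profile n} (hx : x ∈ G.profiles) (hy : y ∈ G.profiles) :
    Integrable (fun ξ => ((G.Vhat x ξ) i - (G.Vhat y ξ) i)
      - (G.meanOracle x i - G.meanOracle y i)) G.law ∧
    ∫ ξ, (((G.Vhat x ξ) i - (G.Vhat y ξ) i)
      - (G.meanOracle x i - G.meanOracle y i)) ∂G.law = 0 := by
  have h1 := (H.oracle.memLp_apply hx i).integrable one_le_two
  have h2 := (H.oracle.memLp_apply hy i).integrable one_le_two
  have h12 : Integrable (fun ξ => (G.Vhat x ξ) i - (G.Vhat y ξ) i) G.law := h1.sub h2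
  refine ⟨h12.sub (integrable_const _), ?_⟩
  rw [integral_sub h12 (integrable_const _), integral_sub h1 h2, H.oracle.integral_apply hx i,
    H.oracle.integral_apply hy i]
  simp

include ht hk

theorem noiseV_memLp : MemLp (noiseV G S B x₀ t k i) 2 P ∧
    ∫ ω, ‖noiseV G S B x₀ t k i ω‖ ^ 2 ∂P ≤
      4 * (Fintype.card ι * (C : ℝ) ^ 2 * (Lf : ℝ) ^ 2) :=
  (H.fresh_ξ ht hk i).memLp_two
    (X := fun ω => (halfIterate G S B x₀ t k ω, anchor G S B x₀ t ω))
    ((H.measurable_halfIterate ht hk).prodMk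
      ((H.measurable_anchor ht).mono (H.ℱ_le_𝒜' t k) le_rfl))
    (H.measurable_centeredV i)
    (Filter.Eventually.of_forall fun ω =>
      H.meanLE_centeredV_sq i (H.halfIterate_mem t k ω) (H.anchor_mem t ω))

theorem integral_inner_noiseV {Q : Ω → Vec (n i)} (hQ : Measurable[𝒜 t k] Q) (hQ2 : MemLp Q 2 P) :
    ∫ ω, inner ℝ (noiseV G S B x₀ t k i ω) (Q ω) ∂P = 0 :=
  (H.fresh_ξ ht hk i).integral_inner_eq_zero
    (X := fun ω => (halfIterate G S B x₀ t k ω, anchor G S B x₀ t ω))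
    ((H.measurable_halfIterate ht hk).prodMk
      ((H.measurable_anchor ht).mono (H.ℱ_le_𝒜' t k) le_rfl))
    (H.measurable_centeredV i) (H.noiseV_memLp ht hk i).1
    (Filter.Eventually.of_forall fun ω =>
      (H.integral_centeredV i (H.halfIterate_mem t k ω) (H.anchor_mem t ω)).1)
    (Filter.Eventually.of_forall fun ω =>
      (H.integral_centeredV i (H.halfIterate_mem t k ω) (H.anchor_mem t ω)).2) hQ hQ2

omit [IsProbabilityMeasure P] in
theorem measurable_noiseV : Measurable[𝒜 t (k + 1)] (noiseV G S B x₀ t k i) := by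
  have hm := H.oracle.measurable_meanOracle
  have h0 := measurable_profile_apply (n := n) i
  have h3 : Measurable[𝒜 t (k + 1)] fun ω => G.meanOracle (halfIterate G S B x₀ t k ω) i :=
    h0.comp (hm.comp ((H.measurable_halfIterate ht hk).mono
      (H.run.𝒜_mono t (Nat.le_succ k)) le_rfl))
  have h4 : Measurable[𝒜 t (k + 1)] fun ω => G.meanOracle (anchor G S B x₀ t ω) i :=
    h0.comp (hm.comp ((H.measurable_anchor ht).mono (H.ℱ_le_𝒜' t _) le_rfl))
  exact ((H.measurable_Vhat_half ht hk i).sub (H.measurable_Vhat_anchor ht hk i)).sub (h3.sub h4)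

omit [IsProbabilityMeasure G.law] ht hk in
theorem measurable_centeredH : Measurable fun q : (Vec (n i) × Vec (n i)) × Vec (n i) =>
    (sphDiff (h i) (S.δ t) q.1.1 q.2 - sphDiff (h i) (S.δ t) q.1.2 q.2)
      - (sphDiffMean (h i) (S.δ t) q.1.1 - sphDiffMean (h i) (S.δ t) q.1.2) := by
  have hc := (H.h_lipschitz i).continuous
  have hm := measurable_sphDiffMean hc (S.δ t) (H.n_pos i)
  have h1 := measurable_sphDiff (Ω := (Vec (n i) × Vec (n i)) × Vec (n i)) hc (S.δ t)
    (measurable_fst.comp measurable_fst) measurable_snd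
  have h2 := measurable_sphDiff (Ω := (Vec (n i) × Vec (n i)) × Vec (n i)) hc (S.δ t)
    (measurable_snd.comp measurable_fst) measurable_snd
  exact (h1.sub h2).sub ((hm.comp (measurable_fst.comp measurable_fst)).sub
    (hm.comp (measurable_snd.comp measurable_fst)))

omit [IsProbabilityMeasure G.law] hk in
theorem meanLE_centeredH_sq (x y : Vec (n i)) :
    MeanLE (sphereUniform (n i)) (fun w =>
      ‖(sphDiff (h i) (S.δ t) x w - sphDiff (h i) (S.δ t) y w)
        - (sphDiffMean (h i) (S.δ t) x - sphDiffMean (h i) (S.δ t) y)‖ ^ 2)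
      ((4 * (n i * (L1 i : ℝ))) ^ 2) := by
  have := isProbabilityMeasure_sphereUniform (H.n_pos i)
  refine (MeanLE.const (P := sphereUniform (n i)) _).mono ?_
    (Filter.Eventually.of_forall fun ω => by positivity) ?_
  · have hm := (H.measurable_centeredH (t := t) i).comp (measurable_prodMk_left (x := (x, y)))
    exact (hm.norm.pow_const 2).aestronglyMeasurable
  · filter_upwards [ae_norm_sphereUniform (n i)] with w hw
    refine pow_le_pow_left₀ (norm_nonneg _) ?_ 2
    have a1 := norm_sphDiff_le (H.h_lipschitz i) (H.δ_pos ht) x hw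
    have a2 := norm_sphDiff_le (H.h_lipschitz i) (H.δ_pos ht) y hw
    have a3 := norm_sphDiffMean_le (H.h_lipschitz i) (H.δ_pos ht) (H.n_pos i) x
    have a4 := norm_sphDiffMean_le (H.h_lipschitz i) (H.δ_pos ht) (H.n_pos i) y
    refine (norm_sub_le _ _).trans ((add_le_add (norm_sub_le _ _) (norm_sub_le _ _)).trans ?_)
    linarith

omit [IsProbabilityMeasure G.law] ht hk in
theorem integrable_sphDiff (δ : ℝ) (x : Vec (n i)) :
    Integrable (sphDiff (h i) δ x) (sphereUniform (n i)) :=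
  integrable_finiteDifference (H.n_pos i) (H.h_lipschitz i) x

omit [IsProbabilityMeasure G.law] ht hk in
theorem integral_centeredH (δ : ℝ) (x y : Vec (n i)) :
    Integrable (fun w => (sphDiff (h i) δ x w - sphDiff (h i) δ y w)
        - (sphDiffMean (h i) δ x - sphDiffMean (h i) δ y)) (sphereUniform (n i)) ∧
    ∫ w, ((sphDiff (h i) δ x w - sphDiff (h i) δ y w)
        - (sphDiffMean (h i) δ x - sphDiffMean (h i) δ y)) ∂sphereUniform (n i) = 0 := by
  have := isProbabilityMeasure_sphereUniform (H.n_pos i)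
  have h1 := H.integrable_sphDiff i δ x
  have h2 := H.integrable_sphDiff i δ y
  have h12 : Integrable (fun w => sphDiff (h i) δ x w - sphDiff (h i) δ y w)
    (sphereUniform (n i)) := h1.sub h2
  refine ⟨h12.sub (integrable_const _), ?_⟩
  rw [integral_sub h12 (integrable_const _), integral_sub h1 h2]
  simp [sphDiffMean]

omit [IsProbabilityMeasure G.law] in
theorem noiseH_memLp : MemLp (noiseH G S B x₀ h t k i) 2 P ∧
    ∫ ω, ‖noiseH G S B x₀ h t k i ω‖ ^ 2 ∂P ≤ (4 * (n i * (L1 i : ℝ))) ^ 2 :=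
  (H.fresh_W ht hk i).memLp_two
    (X := fun ω => (halfIterate G S B x₀ t k ω i, outer G S B x₀ ω t i))
    (((measurable_profile_apply i).comp (H.measurable_halfIterate ht hk)).prodMk
      ((measurable_profile_apply i).comp
        ((H.measurable_outer ht).mono (H.ℱ_le_𝒜' t k) le_rfl)))
    (H.measurable_centeredH i)
    (Filter.Eventually.of_forall fun _ => H.meanLE_centeredH_sq ht i _ _)

omit [IsProbabilityMeasure G.law] in
theorem integral_inner_noiseH {Q : Ω → Vec (n i)} (hQ : Measurable[𝒜 t k] Q) (hQ2 : MemLp Q 2 P) :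
    ∫ ω, inner ℝ (noiseH G S B x₀ h t k i ω) (Q ω) ∂P = 0 :=
  (H.fresh_W ht hk i).integral_inner_eq_zero
    (X := fun ω => (halfIterate G S B x₀ t k ω i, outer G S B x₀ ω t i))
    (((measurable_profile_apply i).comp (H.measurable_halfIterate ht hk)).prodMk
      ((measurable_profile_apply i).comp
        ((H.measurable_outer ht).mono (H.ℱ_le_𝒜' t k) le_rfl)))
    (H.measurable_centeredH i) (H.noiseH_memLp ht hk i).1
    (Filter.Eventually.of_forall fun _ => (H.integral_centeredH i _ _ _).1)
    (Filter.Eventually.of_forall fun _ => (H.integral_centeredH i _ _ _).2) hQ hQ2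

omit [IsProbabilityMeasure G.law] in
theorem measurable_noiseH : Measurable[𝒜 t (k + 1)] (noiseH G S B x₀ h t k i) := by
  have hm := measurable_sphDiffMean (H.h_lipschitz i).continuous (S.δ t) (H.n_pos i)
  have h0 := measurable_profile_apply (n := n) i
  have h3 : Measurable[𝒜 t (k + 1)] fun ω =>
      sphDiffMean (h i) (S.δ t) (halfIterate G S B x₀ t k ω i) :=
    hm.comp (h0.comp ((H.measurable_halfIterate ht hk).mono
      (H.run.𝒜_mono t (Nat.le_succ k)) le_rfl))
  have h4 : Measurable[𝒜 t (k + 1)] fun ω =>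
      sphDiffMean (h i) (S.δ t) (outer G S B x₀ ω t i) :=
    hm.comp (h0.comp ((H.measurable_outer ht).mono (H.ℱ_le_𝒜' t _) le_rfl))
  exact ((H.measurable_sphDiff_half ht hk i).sub (H.measurable_sphDiff_outer ht hk i)).sub
    (h3.sub h4)

end Noise

/-! ### Error of the mini-batch direction -/

section Batch

variable (H : Setting G S B D P x₀ ℱ 𝒜 C R Lf M L1 L2 δ₀ h Λ)
  [IsProbabilityMeasure G.law] [IsProbabilityMeasure P]
  {t : ℕ} (ht : t < S.T) (i : ι)
include H ht

/-- The oracle variance enters the rate here: averaging at least `T ^ 2` samples brings the standard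
deviation down to `M / T`. -/
theorem meanLE_batchV_noise :
    MeanLE P (fun ω => ‖(S.b t : ℝ)⁻¹ • ∑ s ∈ Finset.range (S.b t),
      ((G.Vhat (anchor G S B x₀ t ω) (B.ξb t s i ω)) i
        - G.meanOracle (anchor G S B x₀ t ω) i)‖) (M / S.T) := by
  have hV := H.oracle.measurable
  have hm := H.oracle.measurable_meanOracle
  have h0 := measurable_profile_apply (n := n) i
  have hΨ : Measurable fun q : Profile n × Ξ => (G.Vhat q.1 q.2) i - G.meanOracle q.1 i :=
    (h0.comp hV).sub (h0.comp (hm.comp measurable_fst))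
  have key := meanLE_norm_batch (P := P) (𝒢 := ℱ t) (ν := G.law) (H.b_pos ht)
    (ξ := fun (s : Fin (S.b t)) ω => B.ξb t s i ω) (H.run.ℱ_le t)
    (fun s => H.measurable_ξb ht s.2 i) (fun s => H.run.ξb_law t ht s s.2 i) (H.run.ξb_iid t ht i)
    (H.run.ξb_fresh t ht i) (H.measurable_anchor ht) hΨ
    (Filter.Eventually.of_forall fun ω =>
      (H.oracle.memLp_apply (H.anchor_mem t ω) i).sub
        (memLp_const (G.meanOracle (anchor G S B x₀ t ω) i)))
    (Filter.Eventually.of_forall fun ω => by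
      simp only
      rw [integral_sub ((H.oracle.memLp_apply (H.anchor_mem t ω) i).integrable one_le_two)
        (integrable_const _), H.oracle.integral_apply (H.anchor_mem t ω) i]
      simp) M.coe_nonneg
    (Filter.Eventually.of_forall fun ω =>
      (H.oracle.meanLE_variance_apply (H.anchor_mem t ω) i).2)
  simp_rw [Finset.sum_range]
  refine key.trans ?_
  exact div_le_div_of_nonneg_left M.coe_nonneg H.cast_T_pos (H.T_le_sqrt ht)

omit [IsProbabilityMeasure G.law] ht in
theorem measurable_centeredSphDiff (δ : ℝ) : Measurable fun q : Vec (n i) × Vec (n i) =>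
    sphDiff (h i) δ q.1 q.2 - sphDiffMean (h i) δ q.1 := by
  have hc := (H.h_lipschitz i).continuous
  have h1 : Measurable fun q : Vec (n i) × Vec (n i) => sphDiff (h i) δ q.1 q.2 :=
    measurable_sphDiff (Ω := Vec (n i) × Vec (n i)) hc δ measurable_fst measurable_snd
  exact h1.sub ((measurable_sphDiffMean hc δ (H.n_pos i)).comp measurable_fst)

omit [IsProbabilityMeasure G.law] in
theorem centeredSphDiff_moments (x : Vec (n i)) :
    MemLp (fun w => sphDiff (h i) (S.δ t) x w - sphDiffMean (h i) (S.δ t) x) 2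
      (sphereUniform (n i)) ∧
    ∫ w, (sphDiff (h i) (S.δ t) x w - sphDiffMean (h i) (S.δ t) x) ∂sphereUniform (n i) = 0 ∧
    ∫ w, ‖sphDiff (h i) (S.δ t) x w - sphDiffMean (h i) (S.δ t) x‖ ^ 2 ∂sphereUniform (n i)
      ≤ (2 * (n i * (L1 i : ℝ))) ^ 2 := by
  have := isProbabilityMeasure_sphereUniform (H.n_pos i)
  have hm0 := (H.measurable_centeredSphDiff i (S.δ t)).comp (measurable_prodMk_left (x := x))
  have hm : Measurable fun w => sphDiff (h i) (S.δ t) x w - sphDiffMean (h i) (S.δ t) x := by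
    simpa only [Function.comp_def] using hm0
  have hbd : ∀ᵐ w ∂sphereUniform (n i),
      ‖sphDiff (h i) (S.δ t) x w - sphDiffMean (h i) (S.δ t) x‖ ≤ 2 * (n i * L1 i) := by
    filter_upwards [ae_norm_sphereUniform (n i)] with w hw
    have a1 := norm_sphDiff_le (H.h_lipschitz i) (H.δ_pos ht) x hw
    have a3 := norm_sphDiffMean_le (H.h_lipschitz i) (H.δ_pos ht) (H.n_pos i) x
    refine (norm_sub_le _ _).trans ?_
    linarith
  refine ⟨MemLp.of_bound hm.aestronglyMeasurable _ hbd, ?_, ?_⟩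
  · rw [integral_sub (H.integrable_sphDiff i _ _) (integrable_const _)]
    simp [sphDiffMean]
  · refine ((MeanLE.const (P := sphereUniform (n i)) ((2 * (n i * (L1 i : ℝ))) ^ 2)).mono
      (hm.norm.pow_const 2).aestronglyMeasurable
      (Filter.Eventually.of_forall fun _ => by positivity) ?_).2
    filter_upwards [hbd] with w hw
    exact pow_le_pow_left₀ (norm_nonneg _) hw 2

omit [IsProbabilityMeasure G.law] in
theorem meanLE_batchH_noise :
    MeanLE P (fun ω => ‖(S.b t : ℝ)⁻¹ • ∑ s ∈ Finset.range (S.b t),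
      (sphDiff (h i) (S.δ t) (outer G S B x₀ ω t i) (B.Wb t s i ω)
        - sphDiffMean (h i) (S.δ t) (outer G S B x₀ ω t i))‖) (2 * (n i * L1 i) / S.T) := by
  have := isProbabilityMeasure_sphereUniform (H.n_pos i)
  have hX : Measurable[ℱ t] fun ω => outer G S B x₀ ω t i :=
    (measurable_profile_apply i).comp (H.measurable_outer ht)
  have key := meanLE_norm_batch (P := P) (𝒢 := ℱ t) (ν := sphereUniform (n i)) (H.b_pos ht)
    (ξ := fun (s : Fin (S.b t)) ω => B.Wb t s i ω) (H.run.ℱ_le t)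
    (fun s => H.measurable_Wb ht s.2 i) (fun s => H.run.Wb_law t ht s s.2 i) (H.run.Wb_iid t ht i)
    (H.run.Wb_fresh t ht i) hX
    (Ψ := fun q : Vec (n i) × Vec (n i) =>
      sphDiff (h i) (S.δ t) q.1 q.2 - sphDiffMean (h i) (S.δ t) q.1)
    (H.measurable_centeredSphDiff i (S.δ t)) (B := 2 * (n i * L1 i))
    (Filter.Eventually.of_forall fun ω => (H.centeredSphDiff_moments ht i _).1)
    (Filter.Eventually.of_forall fun ω => (H.centeredSphDiff_moments ht i _).2.1) (by positivity)
    (Filter.Eventually.of_forall fun ω => (H.centeredSphDiff_moments ht i _).2.2)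
  simp_rw [Finset.sum_range]
  refine key.trans ?_
  exact div_le_div_of_nonneg_left (by positivity) H.cast_T_pos (H.T_le_sqrt ht)

theorem measurable_batchErr : Measurable (batchErr G S B x₀ h t i) := by
  have h0 := measurable_profile_apply (n := n) i
  have h1 := (H.measurable_roundDir ht).mono (H.run.𝒜_le t 0) le_rfl
  have hm := measurable_sphDiffMean (H.h_lipschitz i).continuous (S.δ t) (H.n_pos i)
  exact (((h0.comp h1).sub ((h0.comp (H.measurable_anchor' ht)).const_smul (S.η t))).sub
    (h0.comp (H.oracle.measurable_meanOracle.comp (H.measurable_anchor' ht)))).sub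
    (hm.comp (h0.comp (H.measurable_outer' ht)))

omit [IsProbabilityMeasure G.law] [IsProbabilityMeasure P] in
-- The summands are, in order, oracle noise at the anchor, the oracle increment to `x^t`, the
-- Tikhonov increment, sampling noise of the directions and solver error. The two noises are small
-- by averaging, the increments by the distance to the anchor, the last term by the choice of `ε`.
theorem batchErr_eq (ω : Ω) : batchErr G S B x₀ h t i ω =
    (S.b t : ℝ)⁻¹ • ∑ s ∈ Finset.range (S.b t),
      ((G.Vhat (anchor G S B x₀ t ω) (B.ξb t s i ω)) i - G.meanOracle (anchor G S B x₀ t ω) i)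
    + (S.b t : ℝ)⁻¹ • ∑ s ∈ Finset.range (S.b t),
      ((G.Vhat (outer G S B x₀ ω t) (B.ξb t s i ω)) i
        - (G.Vhat (anchor G S B x₀ t ω) (B.ξb t s i ω)) i)
    + S.η t • (outer G S B x₀ ω t i - anchor G S B x₀ t ω i)
    + (S.b t : ℝ)⁻¹ • ∑ s ∈ Finset.range (S.b t),
      (sphDiff (h i) (S.δ t) (outer G S B x₀ ω t i) (B.Wb t s i ω)
        - sphDiffMean (h i) (S.δ t) (outer G S B x₀ ω t i))
    + (S.b t : ℝ)⁻¹ • ∑ s ∈ Finset.range (S.b t),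
      (G.finiteDiff i (S.δ t) (outer G S B x₀ ω t i) (B.Wb t s i ω) (B.ybBase t s i ω)
          (B.ybPert t s i ω)
        - sphDiff (h i) (S.δ t) (outer G S B x₀ ω t i) (B.Wb t s i ω)) := by
  have hb : (S.b t : ℝ) ≠ 0 := by exact_mod_cast (H.b_pos ht).ne'
  have hcst : ∀ c : Vec (n i), (S.b t : ℝ)⁻¹ • (S.b t : ℝ) • c = c := fun c => by
    rw [smul_smul, inv_mul_cancel₀ hb, one_smul]
  have e : roundDir G S B x₀ t ω i =
      (S.b t : ℝ)⁻¹ • ∑ s ∈ Finset.range (S.b t),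
        (G.Vhat (outer G S B x₀ ω t) (B.ξb t s i ω)) i + S.η t • outer G S B x₀ ω t i
      + (S.b t : ℝ)⁻¹ • ∑ s ∈ Finset.range (S.b t),
        G.finiteDiff i (S.δ t) (outer G S B x₀ ω t i) (B.Wb t s i ω) (B.ybBase t s i ω)
          (B.ybPert t s i ω) := rfl
  rw [batchErr, e]
  simp only [Finset.sum_sub_distrib, Finset.sum_const, Finset.card_range, smul_sub,
    ← Nat.cast_smul_eq_nsmul ℝ, hcst]
  abel

theorem meanLE_batchErr {d : ℝ}
    (hd : MeanLE P (fun ω => ‖outer G S B x₀ ω t - anchor G S B x₀ t ω‖) d) :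
    MeanLE P (fun ω => ‖batchErr G S B x₀ h t i ω‖)
      ((Lf + 1) * d + (M + 2 * (n i * L1 i) + 2 * (n i * L2 i)) / S.T) := by
  have hb := H.b_pos ht
  have hb' : (0 : ℝ) < S.b t := by exact_mod_cast hb
  have hδ := H.δ_pos ht
  have hmx : Measurable fun ω => outer G S B x₀ ω t i :=
    (measurable_profile_apply i).comp (H.measurable_outer' ht)
  have hc : 0 ≤ n i * (L2 i : ℝ) / S.δ t := by positivity
  have m1 := H.meanLE_batchV_noise ht i
  have m2 := MeanLE.average hb fun s hs => (H.fresh_ξb ht hs i).meanLE_mul H.Λ_measurable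
    H.Λ_nonneg H.meanLE_Λ Lf.coe_nonneg (H.measurable_dist_anchor ht) (fun ω => norm_nonneg _) hd
  have m4 := H.meanLE_batchH_noise ht i
  have m5 := MeanLE.average hb fun s hs =>
    (((H.run.ybBase_eps t ht s hs i).meanLE hmx).add
      ((H.run.ybPert_eps t ht s hs i).meanLE
        (hmx.add ((H.measurable_Wb ht hs i).const_smul (S.δ t))))).const_mul hc
  refine (((((m1.add m2).add hd).add m4).add m5).mono
    (H.measurable_batchErr ht i).norm.aestronglyMeasurable
    (Filter.Eventually.of_forall fun ω => norm_nonneg _) ?_).trans ?_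
  · have hae : ∀ᵐ ω ∂P, ∀ s < S.b t, (∀ x ∈ Game.prodSet D, ∀ x' ∈ Game.prodSet D,
        ‖G.Vhat x' (B.ξb t s i ω) - G.Vhat x (B.ξb t s i ω)‖ ≤ Λ (B.ξb t s i ω) * ‖x' - x‖) ∧
        ‖B.Wb t s i ω‖ = 1 ∧ B.ybBase t s i ω ∈ G.Y i ∧ B.ybPert t s i ω ∈ G.Y i := by
      rw [ae_all_iff]
      intro s
      by_cases hs : s < S.b t
      · filter_upwards [(H.fresh_ξb ht hs i).ae H.Λ_lipschitz, H.ae_norm_Wb ht hs i,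
          (H.run.ybBase_eps t ht s hs i).1, (H.run.ybPert_eps t ht s hs i).1] with ω h1 h2 h3 h4 _
        exact ⟨h1, h2, h3, h4⟩
      · exact Filter.Eventually.of_forall fun ω h1 => absurd h1 hs
    filter_upwards [hae, H.ae_outer_mem, H.ae_outer_add_mem] with ω hω hX hX'
    have hx := H.anchor_mem t ω
    rw [H.batchErr_eq ht i ω]
    have havg : ∀ (f : ℕ → Vec (n i)) (c : ℕ → ℝ), (∀ s < S.b t, ‖f s‖ ≤ c s) →
        ‖(S.b t : ℝ)⁻¹ • ∑ s ∈ Finset.range (S.b t), f s‖ ≤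
          (S.b t : ℝ)⁻¹ * ∑ s ∈ Finset.range (S.b t), c s := by
      intro f c hf
      rw [norm_smul, Real.norm_of_nonneg (inv_nonneg.2 hb'.le)]
      refine mul_le_mul_of_nonneg_left ((norm_sum_le _ _).trans
        (Finset.sum_le_sum fun s hs => hf s (Finset.mem_range.1 hs))) (inv_nonneg.2 hb'.le)
    refine (norm_add_le _ _).trans (add_le_add ((norm_add_le _ _).trans (add_le_add
      ((norm_add_le _ _).trans (add_le_add ((norm_add_le _ _).trans (add_le_add le_rfl ?_)) ?_))
      le_rfl)) ?_)
    · refine havg _ _ fun s hs => ?_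
      rw [mul_comm]
      exact (norm_apply_le (G.Vhat (outer G S B x₀ ω t) (B.ξb t s i ω)
        - G.Vhat (anchor G S B x₀ t ω) (B.ξb t s i ω)) i).trans
        ((hω s hs).1 _ (H.profiles_subset hx) _ (hX t ht))
    · rw [norm_smul, Real.norm_of_nonneg (H.η_nonneg ht)]
      refine (mul_le_mul (H.ηγ_le_one ht)
        (norm_apply_le (outer G S B x₀ ω t - anchor G S B x₀ t ω) i) (norm_nonneg _)
        zero_le_one).trans (by simp)
    · refine havg _ _ fun s hs => ?_
      obtain ⟨-, hW, h3, h4⟩ := hω s hs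
      exact norm_finiteDiff_sub_sphDiff_le H.lower H.standing.g_lipschitz H.h_eq hδ
        (hX t ht i) (hX' t ht i _ hW) hW h3 h4
  · rw [H.ε_eq ht, H.δ_eq ht]
    have := H.cast_T_pos
    refine le_of_eq ?_
    field_simp
    ring

end Batch

end Setting

/-- For `j ≤ T` one has `j! ≤ T ^ j`, so each term is dominated by a term of the exponential series.
This makes the constant independent of `T`. -/
theorem geom_sum_div_le_exp {a : ℝ} (ha : 0 ≤ a) {T t : ℕ} (ht : t ≤ T) :
    ∑ j ∈ Finset.range t, (a / T) ^ j ≤ Real.exp a := by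
  refine (Finset.sum_le_sum fun j hj => ?_).trans (Real.sum_le_exp_of_nonneg ha t)
  have hj' : j ≤ T := (Finset.mem_range.1 hj).le.trans ht
  have h1 : (j.factorial : ℝ) ≤ (T : ℝ) ^ j := by
    exact_mod_cast j.factorial_le_pow.trans (Nat.pow_le_pow_left hj' j)
  rw [div_pow]
  exact div_le_div_of_nonneg_left (pow_nonneg ha j) (by exact_mod_cast j.factorial_pos) h1

/-! ### Constants of the rate -/

section Constants

variable {ι : Type*} [Fintype ι] (n : ι → ℕ) (C R Lf : ℝ≥0) (L1 L2 : ι → ℝ≥0)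

/-- Bound for the second moment of the exact correction of player `i`. -/
noncomputable def exactBound (i : ι) : ℝ :=
  3 * (Fintype.card ι * (C : ℝ) ^ 2 * (Lf : ℝ) ^ 2 + (C : ℝ) ^ 2 + (2 * (n i * (L1 i : ℝ))) ^ 2)

/-- `T` times the mean distance of the outer iterates from the strategy profiles is bounded by
this constant. -/
noncomputable def distConst : ℝ :=
  (∑ i, (√(exactBound n C Lf L1 i) + 4 * (n i * (L2 i : ℝ)))) *
    Real.exp (Fintype.card ι * ((Lf : ℝ) + 1))

/-- Bound for the second moment of the first order noise. -/
noncomputable def noiseBound (ι : Type*) [Fintype ι] (C Lf : ℝ≥0) : ℝ :=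
  4 * (Fintype.card ι * (C : ℝ) ^ 2 * (Lf : ℝ) ^ 2)

/-- Contribution of player `i` to the rate, apart from the oracle noise. -/
noncomputable def playerConst (i : ι) : ℝ :=
  exactBound n C Lf L1 i / 2
    + C * (2 * ((Lf + 1) * distConst n C Lf L1 L2) + 6 * (n i * L2 i) + 2 * (n i * L1 i))
    + C * √(noiseBound ι C Lf) + C * (4 * (n i * L1 i)) + C * R + 2 * L1 i

/-- The constant of the convergence rate. -/
noncomputable def rateConst : ℝ :=
  Fintype.card ι * (C : ℝ) ^ 2 / 2 + ∑ i, playerConst n C R Lf L1 L2 i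

theorem exactBound_nonneg (i : ι) : 0 ≤ exactBound n C Lf L1 i := by
  unfold exactBound
  positivity

theorem distConst_nonneg : 0 ≤ distConst n C Lf L1 L2 := by
  unfold distConst
  positivity

theorem playerConst_nonneg (i : ι) : 0 ≤ playerConst n C R Lf L1 L2 i := by
  have h1 := exactBound_nonneg n C Lf L1 i
  have h2 := distConst_nonneg n C Lf L1 L2
  unfold playerConst
  positivity

theorem rateConst_nonneg : 0 ≤ rateConst n C R Lf L1 L2 :=
  add_nonneg (by positivity) (Finset.sum_nonneg fun i _ => playerConst_nonneg n C R Lf L1 L2 i)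

end Constants

namespace Setting

variable {ι : Type*} [Fintype ι] [DecidableEq ι] {n : ι → ℕ} {Ξ Ω : Type*}
    [MeasurableSpace Ξ] [MeasurableSpace Ω] {G : Game n Ξ} {S : Schedule} {B : Feedback n G.m Ξ Ω}
    {D : ∀ i, Set (Vec (n i))} {P : Measure Ω} {x₀ : Profile n} {ℱ : ℕ → MeasurableSpace Ω}
    {𝒜 : ℕ → ℕ → MeasurableSpace Ω} {C R Lf M : ℝ≥0} {L1 L2 : ι → ℝ≥0} {δ₀ : ℝ}
    {h : ∀ i, Vec (n i) → ℝ} {Λ : Ξ → ℝ}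
  (H : Setting G S B D P x₀ ℱ 𝒜 C R Lf M L1 L2 δ₀ h Λ)

include H

/-! ### Distance of the outer iterates from the profiles -/

section Distance

variable [IsProbabilityMeasure G.law] [IsProbabilityMeasure P]

omit [IsProbabilityMeasure G.law] in
theorem meanLE_norm_exactDir {t k : ℕ} (ht : t < S.T) (hk : k < S.K) (i : ι) :
    MeanLE P (fun ω => ‖exactDir G S B x₀ h t k ω i‖) √(exactBound n C Lf L1 i) :=
  MeanLE.of_sq (H.measurable_exactDir_apply ht hk i).norm.aestronglyMeasurable
    (H.meanLE_exactDir_sq ht hk i)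

/-- The last half iterate of a round is feasible, and the next outer iterate differs from it by `γ`
times the correction. With `A` the sum over the players, a mean distance `d` becomes at most `(A +
Fintype.card ι * (Lf + 1) * d) / T`, which unrolls to a geometric sum starting from the feasible
`x₀`. -/
theorem meanLE_dist_anchor_geom {t : ℕ} (ht : t < S.T) :
    MeanLE P (fun ω => ‖outer G S B x₀ ω t - anchor G S B x₀ t ω‖)
      ((∑ i, (√(exactBound n C Lf L1 i) + 4 * (n i * (L2 i : ℝ)))) / S.T *
        ∑ j ∈ Finset.range t, ((Fintype.card ι * ((Lf : ℝ) + 1)) / S.T) ^ j) := by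
  have hne := H.standing.nonempty_profiles
  have hcl := H.standing.isClosed_profiles
  have hcv := H.standing.convex_profiles
  have hT := H.cast_T_pos
  induction t with
  | zero =>
    refine (MeanLE.const (P := P) 0).mono
      ((H.measurable_outer' ht).sub (H.measurable_anchor' ht)).norm.aestronglyMeasurable
      (Filter.Eventually.of_forall fun ω => norm_nonneg _)
      (Filter.Eventually.of_forall fun ω => ?_) |>.trans (by simp)
    have := norm_sub_proj_le hne hcl hcv x₀ H.run.start
    rw [sub_self, norm_zero] at this
    exact this
  | succ t ih =>
    have ht' : t < S.T := by omega
    have hd := ih ht'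
    set A := ∑ i, (√(exactBound n C Lf L1 i) + 4 * (n i * (L2 i : ℝ))) with hA
    set q := ∑ j ∈ Finset.range t, ((Fintype.card ι * ((Lf : ℝ) + 1)) / S.T) ^ j with hq
    obtain ⟨k, hk⟩ : ∃ k, S.K = k + 1 := ⟨S.K - 1, by have := H.K_pos; omega⟩
    have hkK : k < S.K := by omega
    have hsum := (MeanLE.sum (s := Finset.univ) fun i _ =>
      (H.meanLE_norm_exactDir ht' hkK i).add
        (H.meanLE_corrDir_sub_exactDir ht' hkK i hd)).const_mul
        (c := 1 / (S.T : ℝ)) (by positivity)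
    refine (hsum.mono
      ((H.measurable_outer' ht).sub (H.measurable_anchor' ht)).norm.aestronglyMeasurable
      (Filter.Eventually.of_forall fun ω => norm_nonneg _)
      (Filter.Eventually.of_forall fun ω => ?_)).trans ?_
    · refine (norm_sub_proj_le hne hcl hcv _ (H.halfIterate_mem t k ω)).trans ?_
      simp only [outer_succ_eq G S B x₀ t k hk]
      rw [sub_sub_cancel_left, norm_neg, norm_smul, H.γ_eq ht',
        Real.norm_of_nonneg (by positivity)]
      refine mul_le_mul_of_nonneg_left ((norm_le_sum _).trans
        (Finset.sum_le_sum fun i _ => ?_)) (by positivity)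
      have := norm_add_le (exactDir G S B x₀ h t k ω i)
        (corrDir G S B x₀ t k ω i - exactDir G S B x₀ h t k ω i)
      rwa [add_sub_cancel] at this
    · have e1 : A / S.T * ∑ j ∈ Finset.range (t + 1),
          ((Fintype.card ι * ((Lf : ℝ) + 1)) / S.T) ^ j =
          1 / S.T * (A + Fintype.card ι * (((Lf : ℝ) + 1) * (A / S.T * q))) := by
        rw [Finset.sum_range_succ']
        simp only [pow_succ, ← Finset.sum_mul, ← hq, pow_zero]
        ring
      rw [e1]
      refine mul_le_mul_of_nonneg_left ?_ (by positivity)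
      rw [hA, ← nsmul_eq_mul, ← Finset.card_univ, ← Finset.sum_const, ← Finset.sum_add_distrib]
      refine Finset.sum_le_sum fun i _ => ?_
      have : 4 * (n i * (L2 i : ℝ)) / S.T ≤ 4 * (n i * (L2 i : ℝ)) :=
        div_le_self (by positivity) H.one_le_T
      linarith

theorem meanLE_dist_anchor {t : ℕ} (ht : t < S.T) :
    MeanLE P (fun ω => ‖outer G S B x₀ ω t - anchor G S B x₀ t ω‖)
      (distConst n C Lf L1 L2 / S.T) := by
  refine (H.meanLE_dist_anchor_geom ht).trans ?_
  have h1 : 0 ≤ ∑ i, (√(exactBound n C Lf L1 i) + 4 * (n i * (L2 i : ℝ))) := by positivity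
  have h2 := geom_sum_div_le_exp (a := Fintype.card ι * ((Lf : ℝ) + 1)) (by positivity) ht.le
  have hT := H.cast_T_pos
  refine (mul_le_mul_of_nonneg_left h2 (div_nonneg h1 hT.le)).trans (le_of_eq ?_)
  rw [distConst, div_mul_eq_mul_div]

end Distance

/-! ### The run as one sequence of `T ^ 2` steps -/

section Flat

omit H in
/-- The round of the `j`-th step is one of the run. -/
theorem div_lt {j : ℕ} (hj : j < S.T * S.K) : j / S.K < S.T := Nat.div_lt_of_lt_mul (by
  rwa [Nat.mul_comm] at hj)

theorem mod_lt (j : ℕ) : j % S.K < S.K := Nat.mod_lt _ H.K_pos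

theorem card_steps : ((S.T * S.K : ℕ) : ℝ) = (S.T : ℝ) ^ 2 := by
  rw [H.K_eq]
  push_cast
  ring

theorem ℱ_mono : Monotone ℱ := monotone_nat_of_le_succ fun t =>
  (H.ℱ_le_𝒜' t S.K).trans (H.run.𝒜_le_ℱ t)

/-- In the order of the run the σ-algebras form one filtration: two steps share a round, or the
chain passes through the start of a later round. -/
theorem 𝒜_succ_le {j l : ℕ} (hlj : l < j) :
    𝒜 (l / S.K) (l % S.K + 1) ≤ 𝒜 (j / S.K) (j % S.K) := by
  have h1 := Nat.div_add_mod l S.K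
  have h2 := Nat.div_add_mod j S.K
  rcases eq_or_lt_of_le (Nat.div_le_div_right (c := S.K) hlj.le) with h3 | h3
  · rw [h3] at h1 ⊢
    exact H.run.𝒜_mono _ (by omega)
  · calc 𝒜 (l / S.K) (l % S.K + 1) ≤ 𝒜 (l / S.K) S.K := H.run.𝒜_mono _ (H.mod_lt l)
      _ ≤ ℱ (l / S.K + 1) := H.run.𝒜_le_ℱ _
      _ ≤ ℱ (j / S.K) := H.ℱ_mono h3
      _ ≤ _ := H.ℱ_le_𝒜' _ _

/-- Consecutive half iterates, in the order of the run. -/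
theorem halfIterate_step {j : ℕ} (hj : j + 1 < S.T * S.K) (ω : Ω) :
    halfIterate G S B x₀ ((j + 1) / S.K) ((j + 1) % S.K) ω =
      proj G.profiles (halfIterate G S B x₀ (j / S.K) (j % S.K) ω
        - (1 / (S.T : ℝ)) • (corrDir G S B x₀ (j / S.K) (j % S.K) ω
          + roundDir G S B x₀ ((j + 1) / S.K) ω)) := by
  have hK := H.K_pos
  have h1 := Nat.div_add_mod j S.K
  have hγ := H.γ_eq (div_lt (by omega : j < S.T * S.K))
  have hγ' := H.γ_eq (div_lt hj)
  rw [smul_add, ← sub_sub]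
  -- Either step `j` closes its round and `j + 1` is step `0` of the next one, or both belong to the
  -- same round.
  rcases eq_or_lt_of_le (Nat.succ_le_of_lt (H.mod_lt j)) with h2 | h2
  · have e : j + 1 = S.K * (j / S.K + 1) := by
      rw [Nat.mul_add, Nat.mul_one]
      omega
    have e1 : (j + 1) / S.K = j / S.K + 1 := by
      rw [e, Nat.mul_div_cancel_left _ hK]
    have e2 : (j + 1) % S.K = 0 := by rw [e, Nat.mul_mod_right]
    rw [e2, e1]
    rw [e1] at hγ'
    rw [halfIterate_round_succ G S B x₀ _ (j % S.K) h2.symm, hγ, hγ']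
  · have e : j + 1 = S.K * (j / S.K) + (j % S.K + 1) := by omega
    have e1 : (j + 1) / S.K = j / S.K := by
      nth_rewrite 1 [e]
      rw [Nat.mul_add_div hK, Nat.div_eq_of_lt h2, Nat.add_zero]
    have e2 : (j + 1) % S.K = j % S.K + 1 := by
      nth_rewrite 1 [e]
      rw [Nat.mul_add_mod, Nat.mod_eq_of_lt h2]
    rw [e2, e1, halfIterate_succ, hγ]

/-- This is the regret bound with `exactDir` as idealised correction, multiplied by `T / 2`. Only
`exactDir` appears squared; `corrDir`, whose second moment is not controlled, enters through a norm.
-/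
theorem regret_le (ω : Ω) {z : Profile n} (hz : z ∈ G.profiles) :
    ∑ j ∈ Finset.range (S.T * S.K),
        inner ℝ (roundDir G S B x₀ (j / S.K) ω + exactDir G S B x₀ h (j / S.K) (j % S.K) ω)
          (halfIterate G S B x₀ (j / S.K) (j % S.K) ω - z) ≤
      S.T * (Fintype.card ι * (C : ℝ) ^ 2 / 2)
        + ∑ i, (1 / (2 * (S.T : ℝ)) * ∑ j ∈ Finset.range (S.T * S.K),
            ‖exactDir G S B x₀ h (j / S.K) (j % S.K) ω i‖ ^ 2
          + C * ∑ j ∈ Finset.range (S.T * S.K),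
            ‖corrDir G S B x₀ (j / S.K) (j % S.K) ω i
              - exactDir G S B x₀ h (j / S.K) (j % S.K) ω i‖) := by
  have hT := H.cast_T_pos
  have hreg := extragradient_regret H.standing.nonempty_profiles H.standing.isClosed_profiles
    H.standing.convex_profiles (γ := 1 / (S.T : ℝ)) (by positivity) (J := S.T * S.K)
    (p := fun j => halfIterate G S B x₀ (j / S.K) (j % S.K) ω)
    (g := fun j => roundDir G S B x₀ (j / S.K) ω)
    (e := fun j => corrDir G S B x₀ (j / S.K) (j % S.K) ω)
    (e' := fun j => exactDir G S B x₀ h (j / S.K) (j % S.K) ω)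
    (r := fun j => C * ∑ i, ‖corrDir G S B x₀ (j / S.K) (j % S.K) ω i
      - exactDir G S B x₀ h (j / S.K) (j % S.K) ω i‖) (x₀ := x₀) hz
    (by
      simp only [Nat.zero_div, Nat.zero_mod]
      rw [halfIterate_zero_zero, H.γ_eq H.T_pos])
    (fun j hj => H.halfIterate_step hj ω)
    (fun j hj q hq => by
      rw [inner_eq_sum, Finset.mul_sum]
      refine (Finset.abs_sum_le_sum_abs _ _).trans (Finset.sum_le_sum fun i _ => ?_)
      refine (abs_real_inner_le_norm _ _).trans ?_
      rw [mul_comm]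
      exact mul_le_mul_of_nonneg_right (H.standing.diam i _ (hq i) _ (hz i)) (norm_nonneg _))
    (Nat.mul_pos H.T_pos H.K_pos)
  have h0 := H.standing.norm_sub_sq_le H.run.start hz
  simp only [norm_sq_eq_sum (exactDir G S B x₀ h _ _ ω)] at hreg
  rw [Finset.sum_comm (s := Finset.range (S.T * S.K)) (t := Finset.univ)] at hreg
  rw [← Finset.mul_sum, Finset.sum_comm (s := Finset.range (S.T * S.K)) (t := Finset.univ)] at hreg
  rw [Finset.sum_add_distrib, ← Finset.mul_sum, ← Finset.mul_sum]
  have h2 : (0 : ℝ) < 2 * (1 / S.T) := by positivity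
  refine le_of_mul_le_mul_left (hreg.trans ?_) h2
  have e : ∀ a b : ℝ, 2 * (1 / (S.T : ℝ)) * (S.T * (Fintype.card ι * (C : ℝ) ^ 2 / 2)
      + (1 / (2 * (S.T : ℝ)) * a + C * b)) =
      Fintype.card ι * (C : ℝ) ^ 2 + (1 / (S.T : ℝ)) ^ 2 * a + 2 * (1 / (S.T : ℝ)) * (C * b) := by
    intro a b
    field_simp
    ring
  rw [e]
  linarith

end Flat

end Setting

section PlayerErr

variable {ι : Type*} [Fintype ι] {n : ι → ℕ} {Ξ Ω : Type*} [MeasurableSpace Ξ] (G : Game n Ξ)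
  (S : Schedule) (B : Feedback n G.m Ξ Ω) (x₀ : Profile n) (h : ∀ i, Vec (n i) → ℝ)
  (C R : ℝ≥0) (L1 : ι → ℝ≥0)

/-- Contribution of player `i` to the bound for the gap along a run. -/
noncomputable def playerErr (i : ι) (ω : Ω) : ℝ :=
  1 / (2 * (S.T : ℝ)) * ∑ j ∈ Finset.range (S.T * S.K),
      ‖exactDir G S B x₀ h (j / S.K) (j % S.K) ω i‖ ^ 2
    + C * ∑ j ∈ Finset.range (S.T * S.K), ‖corrDir G S B x₀ (j / S.K) (j % S.K) ω i
        - exactDir G S B x₀ h (j / S.K) (j % S.K) ω i‖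
    + C * ∑ j ∈ Finset.range (S.T * S.K), ‖batchErr G S B x₀ h (j / S.K) i ω‖
    + C * ‖∑ j ∈ Finset.range (S.T * S.K), noiseV G S B x₀ (j / S.K) (j % S.K) i ω‖
    + C * ‖∑ j ∈ Finset.range (S.T * S.K), noiseH G S B x₀ h (j / S.K) (j % S.K) i ω‖
    + ∑ j ∈ Finset.range (S.T * S.K), inner ℝ (noiseV G S B x₀ (j / S.K) (j % S.K) i ω)
        (x₀ i - halfIterate G S B x₀ (j / S.K) (j % S.K) ω i)
    + ∑ j ∈ Finset.range (S.T * S.K), inner ℝ (noiseH G S B x₀ h (j / S.K) (j % S.K) i ω)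
        (x₀ i - halfIterate G S B x₀ (j / S.K) (j % S.K) ω i)
    + (S.T : ℝ) * (C * R + 2 * L1 i)

end PlayerErr

namespace Setting

variable {ι : Type*} [Fintype ι] [DecidableEq ι] {n : ι → ℕ} {Ξ Ω : Type*}
    [MeasurableSpace Ξ] [MeasurableSpace Ω] {G : Game n Ξ} {S : Schedule} {B : Feedback n G.m Ξ Ω}
    {D : ∀ i, Set (Vec (n i))} {P : Measure Ω} {x₀ : Profile n} {ℱ : ℕ → MeasurableSpace Ω}
    {𝒜 : ℕ → ℕ → MeasurableSpace Ω} {C R Lf M : ℝ≥0} {L1 L2 : ι → ℝ≥0} {δ₀ : ℝ}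
    {h : ∀ i, Vec (n i) → ℝ} {Λ : Ξ → ℝ}
  (H : Setting G S B D P x₀ ℱ 𝒜 C R Lf M L1 L2 δ₀ h Λ)

include H

/-! ### Martingale differences along the run -/

section MartingaleDifferences

variable [IsProbabilityMeasure P] {i : ι} {N : ℕ → ℕ → Ω → Vec (n i)} {b : ℝ}

/-- The norm of a sum of martingale differences along the run. -/
theorem meanLE_norm_sum
    (hN : ∀ {t k}, t < S.T → k < S.K → MemLp (N t k) 2 P ∧ ∫ ω, ‖N t k ω‖ ^ 2 ∂P ≤ b)
    (hmeas : ∀ {t k}, t < S.T → k < S.K → Measurable[𝒜 t (k + 1)] (N t k))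
    (horth : ∀ {t k}, t < S.T → k < S.K → ∀ Q : Ω → Vec (n i), Measurable[𝒜 t k] Q →
      MemLp Q 2 P → ∫ ω, inner ℝ (N t k ω) (Q ω) ∂P = 0) :
    MeanLE P (fun ω => ‖∑ j ∈ Finset.range (S.T * S.K), N (j / S.K) (j % S.K) ω‖)
      (S.T * √b) := by
  have hlt : ∀ {j}, j ∈ Finset.range (S.T * S.K) → j / S.K < S.T := fun hj =>
    div_lt (Finset.mem_range.1 hj)
  -- The earlier difference is measurable with respect to the information preceding the later
  -- sample, so `horth` applies with the later one as noise.
  have hort : ∀ j ∈ Finset.range (S.T * S.K), ∀ l ∈ Finset.range (S.T * S.K), l < j →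
      ∫ ω, inner ℝ (N (j / S.K) (j % S.K) ω) (N (l / S.K) (l % S.K) ω) ∂P = 0 :=
    fun j hj l hl hlj => horth (hlt hj) (H.mod_lt j) _
      ((hmeas (hlt hl) (H.mod_lt l)).mono (H.𝒜_succ_le hlj) le_rfl)
      (hN (hlt hl) (H.mod_lt l)).1
  have key := meanLE_norm_sum_sq (P := P) (Finset.range (S.T * S.K))
    (N := fun j => N (j / S.K) (j % S.K)) (B := b)
    (fun j hj => (hN (hlt hj) (H.mod_lt j)).1) (fun j hj => (hN (hlt hj) (H.mod_lt j)).2)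
    (fun j hj l hl hjl => by
      rcases lt_or_gt_of_ne hjl with h1 | h1
      · simp_rw [real_inner_comm (N (l / S.K) (l % S.K) _)]
        exact hort l hl j hj h1
      · exact hort j hj l hl h1)
  have hm : AEStronglyMeasurable
      (fun ω => ∑ j ∈ Finset.range (S.T * S.K), N (j / S.K) (j % S.K) ω) P :=
    Finset.aestronglyMeasurable_fun_sum _ fun j hj => (hN (hlt hj) (H.mod_lt j)).1.1
  refine (MeanLE.of_sq hm.norm key).trans (le_of_eq ?_)
  rw [Finset.card_range, H.card_steps, Real.sqrt_mul (sq_nonneg _), Real.sqrt_sq H.cast_T_pos.le]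

/-- The deterministic `x₀` serves as reference point. Its difference from the half iterate is
bounded and known before the fresh sample is drawn, whereas the worst `z` may depend on the whole
run. -/
theorem meanLE_sum_inner
    (hN : ∀ {t k}, t < S.T → k < S.K → MemLp (N t k) 2 P ∧ ∫ ω, ‖N t k ω‖ ^ 2 ∂P ≤ b)
    (horth : ∀ {t k}, t < S.T → k < S.K → ∀ Q : Ω → Vec (n i), Measurable[𝒜 t k] Q →
      MemLp Q 2 P → ∫ ω, inner ℝ (N t k ω) (Q ω) ∂P = 0) :
    MeanLE P (fun ω => ∑ j ∈ Finset.range (S.T * S.K), inner ℝ (N (j / S.K) (j % S.K) ω)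
      (x₀ i - halfIterate G S B x₀ (j / S.K) (j % S.K) ω i)) 0 := by
  refine (MeanLE.sum (a := fun _ => 0) fun j hj => ?_).trans (by simp)
  have hj' := div_lt (Finset.mem_range.1 hj)
  have hk := H.mod_lt j
  have hQ : Measurable[𝒜 (j / S.K) (j % S.K)] fun ω =>
      x₀ i - halfIterate G S B x₀ (j / S.K) (j % S.K) ω i :=
    ((measurable_profile_apply i).comp (H.measurable_halfIterate hj' hk)).const_sub _
  have hQ2 : MemLp (fun ω => x₀ i - halfIterate G S B x₀ (j / S.K) (j % S.K) ω i) 2 P :=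
    MemLp.of_bound (hQ.mono (H.run.𝒜_le _ _) le_rfl).aestronglyMeasurable C
      (Filter.Eventually.of_forall fun ω =>
        H.standing.diam i _ (H.run.start i) _ (H.halfIterate_mem _ _ ω i))
  exact ⟨integrable_inner_of_memLp (hN hj' hk).1 hQ2, (horth hj' hk _ hQ hQ2).le⟩

end MartingaleDifferences

/-! ### Pathwise bound for the terms of the gap -/

section PathBound

/-- Constant step sizes and `K = T` make the weighted average the plain mean of all half iterates.
-/
theorem averaged_eq (ω : Ω) : averaged G S B x₀ ω =
    ((S.T : ℝ) ^ 2)⁻¹ • ∑ j ∈ Finset.range (S.T * S.K),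
      halfIterate G S B x₀ (j / S.K) (j % S.K) ω := by
  have hT := H.cast_T_pos
  have h1 : ∑ t ∈ Finset.range S.T, S.γ t = 1 := by
    rw [Finset.sum_congr rfl fun t ht => H.γ_eq (Finset.mem_range.1 ht)]
    simp [hT.ne']
  rw [averaged, h1, inv_one, one_smul, sum_range_mul_div_mod S.T S.K
    (fun t k => halfIterate G S B x₀ t k ω) H.K_pos, Finset.smul_sum]
  refine Finset.sum_congr rfl fun t ht => ?_
  rw [H.γ_eq (Finset.mem_range.1 ht), H.K_eq, smul_smul]
  congr 1
  field_simp

theorem averaged_mem (ω : Ω) : averaged G S B x₀ ω ∈ G.profiles := by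
  have hT := H.cast_T_pos
  rw [H.averaged_eq, Finset.smul_sum]
  refine H.standing.convex_profiles.sum_mem (fun _ _ => by positivity) ?_
    fun j _ => H.halfIterate_mem _ _ ω
  rw [Finset.sum_const, Finset.card_range, nsmul_eq_mul, H.card_steps]
  field_simp

theorem implicit_eq {x : Profile n} (hx : x ∈ G.profiles) (i : ι) :
    G.implicit i (x i) = h i (x i) := h_eq H i (H.profiles_subset hx i)

/-- Jensen's inequality for each player, multiplied by the number `T ^ 2` of steps. -/
theorem implicitSum_averaged_le (ω : Ω) :
    (S.T : ℝ) ^ 2 * G.implicitSum (averaged G S B x₀ ω) ≤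
      ∑ j ∈ Finset.range (S.T * S.K),
        G.implicitSum (halfIterate G S B x₀ (j / S.K) (j % S.K) ω) := by
  have hT := H.cast_T_pos
  simp only [Game.implicitSum]
  rw [Finset.sum_comm, Finset.mul_sum]
  refine Finset.sum_le_sum fun i _ => ?_
  have hjen := (H.implicitConvex i).map_sum_le (t := Finset.range (S.T * S.K))
    (w := fun _ => ((S.T : ℝ) ^ 2)⁻¹)
    (p := fun j => halfIterate G S B x₀ (j / S.K) (j % S.K) ω i) (fun _ _ => by positivity)
    (by
      rw [Finset.sum_const, Finset.card_range, nsmul_eq_mul, H.card_steps]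
      field_simp)
    (fun j _ => Game.subset_enlarged H.δ₀_pos.le i (H.halfIterate_mem _ _ ω i))
  have e : averaged G S B x₀ ω i = ∑ j ∈ Finset.range (S.T * S.K),
      ((S.T : ℝ) ^ 2)⁻¹ • halfIterate G S B x₀ (j / S.K) (j % S.K) ω i := by
    rw [H.averaged_eq, PiLp.smul_apply, ← Finset.smul_sum]
    congr 1
    exact map_sum (PiLp.proj 2 (fun i => Vec (n i)) i : _ →L[ℝ] _) _ _
  rw [← e] at hjen
  refine (mul_le_mul_of_nonneg_left hjen (by positivity)).trans (le_of_eq ?_)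
  simp only [smul_eq_mul]
  rw [← Finset.mul_sum, ← mul_assoc, mul_inv_cancel₀ (by positivity), one_mul]

/-- Since `δ = 1 / T ≤ δ₀`, the balls around `p` and `z` stay where `h i` is convex, so the
approximate subgradient inequality applies. -/
theorem inner_sphDiffMean_ge {t : ℕ} (ht : t < S.T) (i : ι) (hn : 0 < n i) {p z : Vec (n i)}
    (hp : p ∈ G.X i) (hz : z ∈ G.X i) :
    h i p - h i z - 2 * L1 i / S.T ≤ inner ℝ (sphDiffMean (h i) (S.δ t) p) (p - z) := by
  have hδ : S.δ t ≤ δ₀ := (H.δ_eq ht).le.trans H.inv_T_le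
  have hconv : ConvexOn ℝ (G.enlarged δ₀ i) (h i) :=
    (H.implicitConvex i).congr ((H.h_eq i).mono (H.enlarged_subset i))
  have key := inner_integral_finiteDifference_le hn (H.h_lipschitz i) hconv (H.δ_pos ht)
    (Game.closedBall_subset_enlarged hp hδ) (Game.closedBall_subset_enlarged hz hδ)
  have e : inner ℝ (sphDiffMean (h i) (S.δ t) p) (p - z) =
      - inner ℝ (sphDiffMean (h i) (S.δ t) p) (z - p) := by
    rw [← inner_neg_right, neg_sub]
  rw [e]
  change inner ℝ (sphDiffMean (h i) (S.δ t) p) (z - p) ≤ _ at key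
  rw [H.δ_eq ht] at key ⊢
  have : 2 * (L1 i : ℝ) / S.T = 2 * L1 i * (1 / S.T) := by ring
  linarith

/-- Monotonicity exchanges `G.V z` for `G.V p`, and the approximate subgradient inequality produces
the difference of the implicit functions. The Tikhonov term costs at most `C * R / T` and the
smoothing `2 * L1 i / T` per player. -/
theorem step_le {t k : ℕ} (ht : t < S.T) (hn : ∀ i, 0 < n i) (ω : Ω) {z : Profile n}
    (hz : z ∈ G.profiles) :
    inner ℝ (G.V z) (halfIterate G S B x₀ t k ω - z)
        + G.implicitSum (halfIterate G S B x₀ t k ω) - G.implicitSum z ≤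
      inner ℝ (roundDir G S B x₀ t ω + exactDir G S B x₀ h t k ω)
          (halfIterate G S B x₀ t k ω - z)
        + ∑ i, (C * ‖batchErr G S B x₀ h t i ω‖ + (C * R + 2 * L1 i) / S.T
          + inner ℝ (noiseV G S B x₀ t k i ω + noiseH G S B x₀ h t k i ω)
            (z i - halfIterate G S B x₀ t k ω i)) := by
  set p := halfIterate G S B x₀ t k ω with hp
  have hpm : p ∈ G.profiles := H.halfIterate_mem t k ω
  have hmono := H.standing.V_monotone p (Game.profiles_subset H.δ₀_pos.le hpm) z
    (Game.profiles_subset H.δ₀_pos.le hz)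
  rw [inner_sub_left] at hmono
  have hV : inner ℝ (G.V z) (p - z) ≤ ∑ i, inner ℝ (G.V p i) (p i - z i) := by
    have := inner_eq_sum (G.V p) (p - z)
    simp only [PiLp.sub_apply] at this
    linarith
  have key : ∀ i, inner ℝ (G.V p i) (p i - z i) + G.implicit i (p i) - G.implicit i (z i) ≤
      inner ℝ ((roundDir G S B x₀ t ω + exactDir G S B x₀ h t k ω) i) (p i - z i)
        + (C * ‖batchErr G S B x₀ h t i ω‖ + (C * R + 2 * L1 i) / S.T
          + inner ℝ (noiseV G S B x₀ t k i ω + noiseH G S B x₀ h t k i ω) (z i - p i)) := by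
    intro i
    rw [roundDir_add_exactDir_apply, ← hp, H.oracle.meanOracle_eq hpm, H.implicit_eq hpm,
      H.implicit_eq hz, ← neg_sub (p i) (z i)]
    simp only [inner_add_left, inner_neg_right, inner_smul_left, conj_trivial]
    have h1 := H.inner_sphDiffMean_ge ht i (hn i) (hpm i) (hz i)
    have hC := H.standing.diam i _ (hpm i) _ (hz i)
    have h2 : - (C * ‖batchErr G S B x₀ h t i ω‖) ≤
        inner ℝ (batchErr G S B x₀ h t i ω) (p i - z i) := by
      refine (abs_le.1 ((abs_real_inner_le_norm _ _).trans ?_)).1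
      rw [mul_comm]
      exact mul_le_mul_of_nonneg_right hC (norm_nonneg _)
    have h3 : - ((C : ℝ) * R) ≤ inner ℝ (p i) (p i - z i) := by
      refine (abs_le.1 ((abs_real_inner_le_norm _ _).trans ?_)).1
      rw [mul_comm]
      exact mul_le_mul hC ((norm_apply_le p i).trans (H.standing.norm_le p hpm))
        (norm_nonneg _) C.coe_nonneg
    have h4 := mul_le_mul_of_nonneg_left h3 (H.η_nonneg ht)
    rw [H.η_eq ht] at h4 ⊢
    have e : ((C : ℝ) * R + 2 * L1 i) / S.T = 1 / S.T * (C * R) + 2 * L1 i / S.T := by ring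
    rw [e]
    linarith
  have hsum := Finset.sum_le_sum fun i (_ : i ∈ Finset.univ) => key i
  have e := inner_eq_sum (roundDir G S B x₀ t ω + exactDir G S B x₀ h t k ω) (p - z)
  simp only [PiLp.sub_apply] at e
  rw [e]
  simp only [Finset.sum_add_distrib, Finset.sum_sub_distrib, Game.implicitSum] at hsum ⊢
  linarith

/-- The right-hand side does not contain `z`: the noise meets `z` only through `z i - x₀ i`, and
Cauchy–Schwarz with the diameter removes it. Hence the bound survives the supremum over `z`. -/
theorem gap_term_le (hn : ∀ i, 0 < n i) (ω : Ω) {z : Profile n} (hz : z ∈ G.profiles) :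
    (S.T : ℝ) ^ 2 * (inner ℝ (G.V z) (averaged G S B x₀ ω - z)
        + G.implicitSum (averaged G S B x₀ ω) - G.implicitSum z) ≤
      S.T * (Fintype.card ι * (C : ℝ) ^ 2 / 2) + ∑ i, playerErr G S B x₀ h C R L1 i ω := by
  have hT := H.cast_T_pos
  have hreg := H.regret_le ω hz
  have himp := H.implicitSum_averaged_le ω
  have hstep := Finset.sum_le_sum fun j (hj : j ∈ Finset.range (S.T * S.K)) =>
    H.step_le (k := j % S.K) (div_lt (Finset.mem_range.1 hj)) hn ω hz
  have hinner : (S.T : ℝ) ^ 2 * inner ℝ (G.V z) (averaged G S B x₀ ω - z) =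
      ∑ j ∈ Finset.range (S.T * S.K),
        inner ℝ (G.V z) (halfIterate G S B x₀ (j / S.K) (j % S.K) ω - z) := by
    rw [← inner_sum, ← inner_smul_right, Finset.sum_sub_distrib, smul_sub, H.averaged_eq,
      smul_smul, mul_inv_cancel₀ (by positivity), one_smul, Finset.sum_const, Finset.card_range,
      ← Nat.cast_smul_eq_nsmul ℝ, H.card_steps]
  have hconst : ∑ j ∈ Finset.range (S.T * S.K), G.implicitSum z =
      (S.T : ℝ) ^ 2 * G.implicitSum z := by
    rw [Finset.sum_const, Finset.card_range, nsmul_eq_mul, H.card_steps]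
  have hnoise : ∀ i, ∀ N : ℕ → Vec (n i), ∑ j ∈ Finset.range (S.T * S.K), inner ℝ (N j)
      (z i - halfIterate G S B x₀ (j / S.K) (j % S.K) ω i) ≤
      C * ‖∑ j ∈ Finset.range (S.T * S.K), N j‖ + ∑ j ∈ Finset.range (S.T * S.K),
        inner ℝ (N j) (x₀ i - halfIterate G S B x₀ (j / S.K) (j % S.K) ω i) := by
    intro i N
    have e : ∀ j, inner ℝ (N j) (z i - halfIterate G S B x₀ (j / S.K) (j % S.K) ω i) =
        inner ℝ (N j) (z i - x₀ i)
          + inner ℝ (N j) (x₀ i - halfIterate G S B x₀ (j / S.K) (j % S.K) ω i) := fun j => by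
      rw [← inner_add_right, sub_add_sub_cancel]
    simp only [e, Finset.sum_add_distrib, ← sum_inner]
    refine add_le_add ((real_inner_le_norm _ _).trans ?_) le_rfl
    rw [mul_comm]
    exact mul_le_mul_of_nonneg_right (H.standing.diam i _ (hz i) _ (H.run.start i)) (norm_nonneg _)
  have hplayer : ∑ j ∈ Finset.range (S.T * S.K), ∑ i,
        (C * ‖batchErr G S B x₀ h (j / S.K) i ω‖ + (C * R + 2 * L1 i) / S.T
          + inner ℝ (noiseV G S B x₀ (j / S.K) (j % S.K) i ω
            + noiseH G S B x₀ h (j / S.K) (j % S.K) i ω)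
            (z i - halfIterate G S B x₀ (j / S.K) (j % S.K) ω i)) +
      ∑ i, (1 / (2 * (S.T : ℝ)) * ∑ j ∈ Finset.range (S.T * S.K),
            ‖exactDir G S B x₀ h (j / S.K) (j % S.K) ω i‖ ^ 2
          + C * ∑ j ∈ Finset.range (S.T * S.K),
            ‖corrDir G S B x₀ (j / S.K) (j % S.K) ω i
              - exactDir G S B x₀ h (j / S.K) (j % S.K) ω i‖) ≤
      ∑ i, playerErr G S B x₀ h C R L1 i ω := by
    rw [Finset.sum_comm, ← Finset.sum_add_distrib]
    refine Finset.sum_le_sum fun i _ => ?_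
    have h1 := hnoise i fun j => noiseV G S B x₀ (j / S.K) (j % S.K) i ω
    have h2 := hnoise i fun j => noiseH G S B x₀ h (j / S.K) (j % S.K) i ω
    simp only [inner_add_left, Finset.sum_add_distrib, ← Finset.mul_sum, Finset.sum_const,
      Finset.card_range, nsmul_eq_mul, H.card_steps, playerErr]
    have e : (S.T : ℝ) ^ 2 * ((C * R + 2 * L1 i) / S.T) = S.T * (C * R + 2 * L1 i) := by
      field_simp
    rw [e]
    linarith
  simp only [Finset.sum_add_distrib, Finset.sum_sub_distrib, hconst] at hstep
  simp only [Finset.sum_add_distrib] at hplayer hreg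
  rw [mul_sub, mul_add, hinner]
  linarith

end PathBound

end Setting

namespace Setting

variable {ι : Type*} [Fintype ι] [DecidableEq ι] {n : ι → ℕ} {Ξ Ω : Type*}
    [MeasurableSpace Ξ] [MeasurableSpace Ω] {G : Game n Ξ} {S : Schedule} {B : Feedback n G.m Ξ Ω}
    {D : ∀ i, Set (Vec (n i))} {P : Measure Ω} {x₀ : Profile n} {ℱ : ℕ → MeasurableSpace Ω}
    {𝒜 : ℕ → ℕ → MeasurableSpace Ω} {C R Lf M : ℝ≥0} {L1 L2 : ι → ℝ≥0} {δ₀ : ℝ}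
    {h : ∀ i, Vec (n i) → ℝ} {Λ : Ξ → ℝ}
  (H : Setting G S B D P x₀ ℱ 𝒜 C R Lf M L1 L2 δ₀ h Λ)

include H

/-- Every nonzero contribution is of order `T`: `T ^ 2` bounded means with weight `1 / T`, `T ^ 2`
means of order `1 / T`, norms of sums of `T ^ 2` orthogonal terms, and the deterministic remainder.
The remaining inner products have mean zero. -/
theorem meanLE_playerErr [IsProbabilityMeasure G.law] [IsProbabilityMeasure P] (i : ι) :
    MeanLE P (playerErr G S B x₀ h C R L1 i)
      (S.T * (playerConst n C R Lf L1 L2 i + C * M)) := by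
  have hT := H.cast_T_pos
  have hlt : ∀ {j}, j ∈ Finset.range (S.T * S.K) → j / S.K < S.T := fun hj =>
    div_lt (Finset.mem_range.1 hj)
  have hsum : ∀ {f : ℕ → Ω → ℝ} {a : ℝ},
      (∀ j ∈ Finset.range (S.T * S.K), MeanLE P (f j) a) →
      MeanLE P (fun ω => ∑ j ∈ Finset.range (S.T * S.K), f j ω) ((S.T : ℝ) ^ 2 * a) :=
    fun hf => (MeanLE.sum hf).trans (le_of_eq (by
      rw [Finset.sum_const, Finset.card_range, nsmul_eq_mul, H.card_steps]))
  have m1 := (hsum fun j hj => H.meanLE_exactDir_sq (hlt hj) (H.mod_lt j) i).const_mul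
    (c := 1 / (2 * (S.T : ℝ))) (by positivity)
  have m2 := (hsum fun j hj => H.meanLE_corrDir_sub_exactDir (hlt hj) (H.mod_lt j) i
    (H.meanLE_dist_anchor (hlt hj))).const_mul C.coe_nonneg
  have m3 := (hsum fun j hj => H.meanLE_batchErr (hlt hj) i
    (H.meanLE_dist_anchor (hlt hj))).const_mul C.coe_nonneg
  have m4 := (H.meanLE_norm_sum (N := fun t k => noiseV G S B x₀ t k i)
    (fun ht hk => H.noiseV_memLp ht hk i) (fun ht hk => H.measurable_noiseV ht hk i)
    (fun ht hk _ hQ hQ2 => H.integral_inner_noiseV ht hk i hQ hQ2)).const_mul C.coe_nonneg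
  have m5 := (H.meanLE_norm_sum (N := fun t k => noiseH G S B x₀ h t k i)
    (fun ht hk => H.noiseH_memLp ht hk i) (fun ht hk => H.measurable_noiseH ht hk i)
    (fun ht hk _ hQ hQ2 => H.integral_inner_noiseH ht hk i hQ hQ2)).const_mul C.coe_nonneg
  have m6 := H.meanLE_sum_inner (N := fun t k => noiseV G S B x₀ t k i)
    (fun ht hk => H.noiseV_memLp ht hk i)
    (fun ht hk _ hQ hQ2 => H.integral_inner_noiseV ht hk i hQ hQ2)
  have m7 := H.meanLE_sum_inner (N := fun t k => noiseH G S B x₀ h t k i)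
    (fun ht hk => H.noiseH_memLp ht hk i)
    (fun ht hk _ hQ hQ2 => H.integral_inner_noiseH ht hk i hQ hQ2)
  refine (((((((m1.add m2).add m3).add m4).add m5).add m6).add m7).add
    (MeanLE.const ((S.T : ℝ) * (C * R + 2 * L1 i)))).trans (le_of_eq ?_)
  rw [Real.sqrt_sq (by positivity), playerConst, exactBound, noiseBound]
  field_simp
  ring

/-! ### Regularity of the gap function -/

section Gap

theorem norm_sub_le_two_mul {x y : Profile n} (hx : x ∈ G.profiles) (hy : y ∈ G.profiles) :
    ‖x - y‖ ≤ 2 * R := by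
  have h1 := H.standing.norm_le x hx
  have h2 := H.standing.norm_le y hy
  have := norm_sub_le x y
  linarith

theorem norm_V_le {x : Profile n} (hx : x ∈ G.profiles) :
    ‖G.V x‖ ≤ ‖G.V x₀‖ + Lf * (2 * R) := by
  have h1 := H.standing.norm_V_sub_le H.δ₀_pos.le hx H.run.start
  have h2 := mul_le_mul_of_nonneg_left (H.norm_sub_le_two_mul hx H.run.start) Lf.coe_nonneg
  have h3 := norm_le_insert' (G.V x) (G.V x₀)
  linarith

theorem implicitSum_sub_le {x y : Profile n} (hx : x ∈ G.profiles) (hy : y ∈ G.profiles) :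
    G.implicitSum x - G.implicitSum y ≤ (∑ i, (L1 i : ℝ)) * ‖x - y‖ := by
  simp only [Game.implicitSum]
  rw [← Finset.sum_sub_distrib, Finset.sum_mul]
  refine Finset.sum_le_sum fun i _ => ?_
  rw [H.implicit_eq hx, H.implicit_eq hy]
  have h1 := (H.h_lipschitz i).dist_le_mul (x i) (y i)
  rw [Real.dist_eq, dist_eq_norm] at h1
  exact (le_abs_self _).trans (h1.trans
    (mul_le_mul_of_nonneg_left (norm_apply_le (x - y) i) (L1 i).coe_nonneg))

/-- Changing the first argument of the terms in the definition of the gap function. -/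
theorem gap_term_sub_le {x y z : Profile n} (hx : x ∈ G.profiles) (hy : y ∈ G.profiles)
    (hz : z ∈ G.profiles) :
    inner ℝ (G.V z) (x - z) + G.implicitSum x - G.implicitSum z ≤
      inner ℝ (G.V z) (y - z) + G.implicitSum y - G.implicitSum z
        + (‖G.V x₀‖ + Lf * (2 * R) + ∑ i, (L1 i : ℝ)) * ‖x - y‖ := by
  have h1 := H.implicitSum_sub_le hx hy
  have h2 := (real_inner_le_norm (G.V z) (x - y)).trans
    (mul_le_mul_of_nonneg_right (H.norm_V_le hz) (norm_nonneg _))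
  have h3 : inner ℝ (G.V z) (x - z) = inner ℝ (G.V z) (x - y) + inner ℝ (G.V z) (y - z) := by
    rw [← inner_add_right, sub_add_sub_cancel]
  rw [h3, add_mul]
  linarith

theorem bddAbove_gap_terms {x : Profile n} (hx : x ∈ G.profiles) :
    BddAbove (Set.range fun z : G.profiles =>
      inner ℝ (G.V z) (x - z) + G.implicitSum x - G.implicitSum z) := by
  refine ⟨(‖G.V x₀‖ + Lf * (2 * R) + ∑ i, (L1 i : ℝ)) * (2 * R), ?_⟩
  rintro _ ⟨z, rfl⟩
  refine (H.gap_term_sub_le hx z.2 z.2).trans ?_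
  rw [sub_self, inner_zero_right, zero_add, sub_self, zero_add]
  exact mul_le_mul_of_nonneg_left (H.norm_sub_le_two_mul hx z.2) (by positivity)

theorem gap_le {x : Profile n} {c : ℝ} (hc : ∀ z ∈ G.profiles,
    inner ℝ (G.V z) (x - z) + G.implicitSum x - G.implicitSum z ≤ c) : G.gap x ≤ c := by
  have : Nonempty G.profiles := H.standing.nonempty_profiles.to_subtype
  exact ciSup_le fun z => hc z z.2

/-- A supremum of functions with a common Lipschitz constant, because `G.V` is bounded on the
profiles. The constant involves `G.V x₀` and serves only for integrability; it does not enter the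
rate. -/
theorem lipschitzOnWith_gap : LipschitzOnWith (‖G.V x₀‖₊ + Lf * (2 * R) + ∑ i, L1 i)
    G.gap G.profiles := by
  refine LipschitzOnWith.of_le_add_mul _ fun x hx y hy => H.gap_le fun z hz => ?_
  refine (H.gap_term_sub_le hx hy hz).trans (add_le_add
    (le_ciSup (H.bddAbove_gap_terms hy) ⟨z, hz⟩) (le_of_eq ?_))
  rw [dist_eq_norm]
  push_cast
  rfl

theorem measurable_averaged : Measurable (averaged G S B x₀) := by
  have hm : Measurable fun ω => ∑ j ∈ Finset.range (S.T * S.K),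
      halfIterate G S B x₀ (j / S.K) (j % S.K) ω :=
    Finset.measurable_sum _ fun j hj => H.measurable_halfIterate'
      (div_lt (Finset.mem_range.1 hj)) (H.mod_lt j)
  rw [show averaged G S B x₀ = _ from funext H.averaged_eq]
  exact hm.const_smul (((S.T : ℝ) ^ 2)⁻¹)

theorem integrable_gap_averaged [IsProbabilityMeasure P] :
    Integrable (fun ω => G.gap (averaged G S B x₀ ω)) P := by
  -- The averaged iterate is always feasible, so the gap may be replaced by a globally Lipschitz
  -- extension, which is measurable.
  obtain ⟨W, hW, hWeq⟩ := H.lipschitzOnWith_gap.extend_real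
  have e : (fun ω => G.gap (averaged G S B x₀ ω)) = fun ω => W (averaged G S B x₀ ω) :=
    funext fun ω => hWeq (H.averaged_mem ω)
  rw [e]
  refine Integrable.of_bound
    ((hW.continuous.measurable.comp H.measurable_averaged).aestronglyMeasurable)
    (|W x₀| + (‖G.V x₀‖₊ + Lf * (2 * R) + ∑ i, L1 i : ℝ≥0) * (2 * R))
    (Filter.Eventually.of_forall fun ω => ?_)
  have h1 := hW.dist_le_mul (averaged G S B x₀ ω) x₀
  rw [dist_eq_norm, dist_eq_norm] at h1
  have h2 := mul_le_mul_of_nonneg_left (H.norm_sub_le_two_mul (H.averaged_mem ω) H.run.start)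
    (‖G.V x₀‖₊ + Lf * (2 * R) + ∑ i, L1 i : ℝ≥0).coe_nonneg
  have h3 := norm_le_insert' (W (averaged G S B x₀ ω)) (W x₀)
  rw [Real.norm_eq_abs (W x₀)] at h3
  linarith

end Gap

theorem integral_gap_averaged_le [IsProbabilityMeasure G.law] [IsProbabilityMeasure P] :
    ∫ ω, G.gap (averaged G S B x₀ ω) ∂P ≤
      (rateConst n C R Lf L1 L2 + Fintype.card ι * (C * M)) / S.T := by
  have hT := H.cast_T_pos
  have hmean := ((MeanLE.const (P := P) (S.T * (Fintype.card ι * (C : ℝ) ^ 2 / 2))).add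
    (MeanLE.sum (s := Finset.univ) fun i _ => H.meanLE_playerErr i)).const_mul
    (c := ((S.T : ℝ) ^ 2)⁻¹) (by positivity)
  refine (integral_mono H.integrable_gap_averaged hmean.1 fun ω =>
    H.gap_le fun z hz => ?_).trans (hmean.2.trans (le_of_eq ?_))
  · have key := mul_le_mul_of_nonneg_left (H.gap_term_le H.n_pos ω hz)
      (inv_nonneg.2 (sq_nonneg (S.T : ℝ)))
    rwa [← mul_assoc, inv_mul_cancel₀ (by positivity), one_mul] at key
  · rw [← Finset.mul_sum, Finset.sum_add_distrib, rateConst, Finset.sum_const, Finset.card_univ,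
      nsmul_eq_mul]
    field_simp
    ring

end Setting

theorem le_noiseLevel {ι : Type*} [Fintype ι] (n : ι → ℕ) (L1 : ι → ℝ≥0) (M : ℝ≥0) :
    (M : ℝ) ≤ noiseLevel n L1 M := by
  refine Real.le_sqrt_of_sq_le ?_
  have : 0 ≤ ∑ i, (L1 i : ℝ) ^ 2 * (n i : ℝ) ^ 2 := by positivity
  nlinarith [sq_nonneg (M : ℝ)]

end HierGame

theorem mainTheorem3 {ι : Type*} [Fintype ι] [DecidableEq ι] (n : ι → ℕ)
    (C R Lf : ℝ≥0) (L1 L2 : ι → ℝ≥0) :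
    ∃ c : ℝ, 0 ≤ c ∧
      ∀ {Ξ : Type*} [MeasurableSpace Ξ] (G : HierGame.Game n Ξ) [IsProbabilityMeasure G.law]
        (M : ℝ≥0) (δ₀ : ℝ) (D : ∀ i, Set (HierGame.Vec (n i))),
        0 < δ₀ → (∀ i, G.enlarged δ₀ i ⊆ D i) →
        G.LowerLevel D → G.Standing δ₀ D C R Lf L1 L2 → G.ImplicitConvex δ₀ → G.Oracle D Lf M →
      ∀ (S : HierGame.Schedule), 0 < S.T → 1 / (S.T : ℝ) ≤ δ₀ → S.K = S.T →
        (∀ t < S.T, S.γ t = 1 / (S.T : ℝ) ∧ S.η t = 1 / (S.T : ℝ) ∧ S.δ t = 1 / (S.T : ℝ) ∧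
          S.ε t = 1 / (S.T : ℝ) ^ 2 ∧ S.T ^ 2 ≤ S.b t) →
      ∀ {Ω : Type*} [MeasurableSpace Ω] (P : Measure Ω) [IsProbabilityMeasure P]
        (x₀ : HierGame.Profile n) (B : HierGame.Feedback n G.m Ξ Ω)
        (ℱ : ℕ → MeasurableSpace Ω) (𝒜 : ℕ → ℕ → MeasurableSpace Ω),
        HierGame.IsRun G S B D P x₀ ℱ 𝒜 →
        Integrable (fun ω => G.gap (HierGame.averaged G S B x₀ ω)) P ∧
        ∫ ω, G.gap (HierGame.averaged G S B x₀ ω) ∂P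
          ≤ c * (1 + C * HierGame.noiseLevel n L1 M) / S.T := by
  have hc0 := HierGame.rateConst_nonneg n C R Lf L1 L2
  -- The oracle noise contributes `C * M` per player, and `M` is at most the noise level; this
  -- accounts for the summand `Fintype.card ι`.
  refine ⟨HierGame.rateConst n C R Lf L1 L2 + Fintype.card ι, by positivity, ?_⟩
  intro Ξ _ G _ M δ₀ D hδ hD hlow hst hconv hor S hT hinv hK hpar Ω _ P _ x₀ B ℱ 𝒜 hrun
  -- Nothing is known about the implicit functions outside `D i`. Global Lipschitz extensions make
  -- the finite differences and their means measurable and bounded at every point, and almost surely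
  -- agree with the implicit functions at the queried points.
  choose h hlip heq using fun i => (hst.implicit_lipschitz i).extend_real
  obtain ⟨Λ, hΛ, hΛ0, hΛ2, hΛlip⟩ := hor.exists_measurable_lipschitz
  have H : HierGame.Setting G S B D P x₀ ℱ 𝒜 C R Lf M L1 L2 δ₀ h Λ :=
    ⟨hδ, hD, hlow, hst, hconv, hor, hT, hinv, hK, hpar, hrun, hlip, heq, hΛ, hΛ0, hΛ2, hΛlip⟩
  refine ⟨H.integrable_gap_averaged, H.integral_gap_averaged_le.trans ?_⟩
  have hσ := HierGame.le_noiseLevel n L1 M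
  have hCσ := mul_le_mul_of_nonneg_left hσ C.coe_nonneg
  have hCσ0 : 0 ≤ (C : ℝ) * HierGame.noiseLevel n L1 M :=
    mul_nonneg C.coe_nonneg (M.coe_nonneg.trans hσ)
  refine div_le_div_of_nonneg_right ?_ H.cast_T_pos.le
  have h1 := mul_nonneg hc0 hCσ0
  have h2 := mul_le_mul_of_nonneg_left hCσ (Nat.cast_nonneg (α := ℝ) (Fintype.card ι))
  have h3 : (0 : ℝ) ≤ Fintype.card ι := Nat.cast_nonneg _
  linarith
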